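/- **Setting.** Let $N\ge 1$, let $\omega$ be a primitive $N$-th root of unity, and let $k,k'\in\mathbb C$ with $k\neq 0$ and $k^2+k'^2=1$. A *rapidity* is a triple $p=(x_p,y_p,\mu_p)\in\mathbb C^3$ with $\mu_p\ne0$, $kx_p^N=1-k'\mu_p^{-N}$ and $ky_p^N=1-k'\mu_p^{N}$. Put $t_p=x_py_p$, $\bar p=(y_p,x_p,\mu_p^{-1})$ and $\bar p(s)=(y_p,x_p\omega^s,\mu_p^{-1})$. The normalised Boltzmann weights are, for $n=0,\dots,N-1$ (and $n$ read modulo $N$), $$W_{pq}(n)=\prod_{j=1}^n\frac{\mu_p}{\mu_q}\frac{y_q-x_p\omega^j}{y_p-x_q\omega^j},\qquad \bar W_{pq}(n)=\prod_{j=1}^n\mu_p\mu_q\frac{x_p\omega-x_q\omega^j}{y_q-y_p\omega^j},\qquad \widehat W_{pq}(n)=\sum_{m=0}^{N-1}\omega^{-nm}W_{pq}(m).$$ On $\mathbb C^N$ with basis $v_\sigma$ ($\sigma\in\mathbb Z/N$) let $Zv_\sigma=\omega^\sigma v_\sigma$, $Xv_\sigma=v_{\sigma+1}$, let $P$ be the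 flip on $\mathbb C^N\otimes\mathbb C^N$, and let $$S(p,p';q,q')=\frac1{N^2}P\sum_{n_1,n_2,n_3,n_4\in\mathbb Z/N}\widehat W_{pq'}(n_1)\bar W_{pq}(n_2)\bar W_{p'q'}(n_3)\widehat W_{p'q}(n_4)\;X^{n_1}Z^{n_2}X^{n_4}\otimes X^{-n_1}Z^{n_3}X^{-n_4}.$$ For rapidities $p_1,\dots,p_L$ (arbitrary inhomogeneities), the superintegrable chiral Potts (SCP) transfer matrix on $(\mathbb C^N)^{\otimes L}$ is $$t(q_1,q_2;\{p\})=\operatorname{tr}_{\mathbb C^N}\,S_1(p_1,\bar p_1;q_1,q_2)\cdots S_L(p_L,\bar p_L;q_1,q_2),$$ where $S_i$ acts on the $i$-th site and a common auxiliary space $\mathbb C^N$, over which the trace is taken. For the $\tau_2$-model let $$\mathcal L_i(z)=\begin{pmatrix}-t_{p_i}z+Z_i&-y_{p_i}z(1-Z_i)X_i\\ x_{p_i}X_i^{-1}(1-Z_i)&1-t_{p_i}z\omega Z_i\end{pmatrix},\qquad \mathcal L_1(z)\cdots\mathcal L_L(z)=\begin{pmatrix}A(z)&B(z)\\C(z)&D(z)\end{pmatrix}.$$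 A family $z_1,\dots,z_R$ of non-zero, pairwise distinct complex numbers is a *regular solution of the Bethe equations* if for all $i$ $$a(z_i)\prod_{j\ne i}f(z_i/z_j)=d(z_i)\prod_{j\neq i}f(z_j/z_i),$$ where $a(z)=\prod_n(1-t_{p_n}z)$, $d(z)=\prod_n(1-t_{p_n}z\omega)$ and $f(z)=\frac{z-\omega}{(z-1)\omega}$. The corresponding *regular Bethe state* is $|R\rangle=B(z_1)\cdots B(z_R)\,(v_0\otimes\cdots\otimes v_0)$. Put $F(t)=\prod_{i=1}^R(1-tz_i)$. **Theorem.** Let $q=(x_q,y_q,\mu_q)$ be a rapidity with $x_q^N\ne x_{p_n}^N$ and $y_q^N\neq y_{p_n}^N$ for all $n$, let $s\ge0$ be an integer, and let $|R\rangle$ be the regular Bethe state of a regular solution $z_1,\dots,z_R$. 1. If $|R\rangle\neq0$, then $|R\rangle$ is an eigenvector of the SCP transfer matrix $t(q,\bar q(s);\{p\})$. 2. If $F(t_q\omega^\tau)\ne0$ for $\tau=0,\dots,N-1$, then $$t(q,\bar q(s);\{p\})\,|R\rangle=\sum_{\tau=0}^{N-1}\lambda_\tau\Big(\prod_{i=1}^R\mu_{\tau\tau}(z_i)\Big)|R\rangle,$$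 where $$\lambda_\tau=N^L\Big(\prod_{n=1}^L\frac{x_{p_n}-x_q}{x_{p_n}^N-x_q^N}\,\frac{y_{p_n}-y_q}{y_{p_n}^N-y_q^N}\Big)\Big(\prod_{n=1}^L\frac{t_{p_n}^N-t_q^N}{t_{p_n}-t_q\omega^\tau}\Big)\omega^{\tau L},\qquad \mu_{\tau\tau}(z)=\frac{(t_qz-1)(t_qz\omega^s-1)\omega^\tau}{(t_qz\omega^\tau-1)(t_qz\omega^{\tau+1}-1)},$$ and this eigenvalue equals $$N^L\Big(\prod_{n=1}^L\frac{x_{p_n}-x_q}{x_{p_n}^N-x_q^N}\,\frac{y_{p_n}-y_q}{y_{p_n}^N-y_q^N}\Big)\sum_{\tau=0}^{N-1}\Big(\prod_{n=1}^L\frac{t_{p_n}^N-t_q^N}{t_{p_n}-t_q\omega^\tau}\Big)\frac{\omega^{\tau(L+R)}F(t_q)F(t_q\omega^s)}{F(t_q\omega^\tau)F(t_q\omega^{\tau+1})}.$$ Here $\frac{t_{p_n}^N-t_q^N}{t_{p_n}-t_q\omega^\tau}$ stands for the polynomial $\sum_{j=0}^{N-1}t_{p_n}^{\,j}(t_q\omega^\tau)^{N-1-j}$,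 to which it is equal when its denominator is non-zero. -/

import Mathlib

namespace SCP

open scoped Kronecker

noncomputable section

/-- A rapidity `(x, y, μ)`. -/
structure Rapidity where
  x : ℂ
  y : ℂ
  mu : ℂ

/-- `t_p = x_p y_p`. -/
def Rapidity.t (p : Rapidity) : ℂ := p.x * p.y

/-- The rapidity `p` lies on the curve `k x^N = 1 - k' μ^{-N}`, `k y^N = 1 - k' μ^N`. -/
def Rapidity.OnCurve (p : Rapidity) (N : ℕ) (k k' : ℂ) : Prop :=
  p.mu ≠ 0 ∧ k * p.x ^ N = 1 - k' * (p.mu ^ N)⁻¹ ∧ k * p.y ^ N = 1 - k' * p.mu ^ N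

/-- `p̄ = (y_p, x_p, μ_p⁻¹)`. -/
def Rapidity.bar (p : Rapidity) : Rapidity := ⟨p.y, p.x, p.mu⁻¹⟩

/-- `q̄(s) = (y_q, x_q ω^s, μ_q⁻¹)`. -/
def Rapidity.barShift (q : Rapidity) (ω : ℂ) (s : ℕ) : Rapidity := ⟨q.y, q.x * ω ^ s, q.mu⁻¹⟩

/-! ### Boltzmann weights -/

section Weights

variable {N : ℕ} [NeZero N]

/-- The normalised Boltzmann weight `W_{pq}(n) / W_{pq}(0)`, `n` being represented by
`0, …, N - 1`. -/
def weight (ω : ℂ) (p q : Rapidity) (n : ZMod N) : ℂ :=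
  ∏ j ∈ Finset.Icc 1 n.val, p.mu / q.mu * ((q.y - p.x * ω ^ j) / (p.y - q.x * ω ^ j))

/-- The normalised Boltzmann weight `W̄_{pq}(n) / W̄_{pq}(0)`. -/
def weightBar (ω : ℂ) (p q : Rapidity) (n : ZMod N) : ℂ :=
  ∏ j ∈ Finset.Icc 1 n.val, p.mu * q.mu * ((p.x * ω - q.x * ω ^ j) / (q.y - p.y * ω ^ j))

/-- The Fourier transformed weight `Ŵ_{pq}(n) / W_{pq}(0) = ∑ₘ ω^{-nm} W_{pq}(m) / W_{pq}(0)`. -/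
def weightHat (ω : ℂ) (p q : Rapidity) (n : ZMod N) : ℂ :=
  ∑ m : ZMod N, (ω ^ (n.val * m.val))⁻¹ * weight ω p q m

end Weights

/-! ### Operators on one site and on the chain -/

/-- Operators on `ℂ^N`, in the standard basis `v_σ`, `σ ∈ ℤ/N`. -/
abbrev SiteOp (N : ℕ) := Matrix (ZMod N) (ZMod N) ℂ

/-- Operators on the quantum space `(ℂ^N)^{⊗L}`, in the basis
`v_{σ₁} ⊗ ⋯ ⊗ v_{σ_L}`. -/
abbrev ChainOp (N L : ℕ) := Matrix (Fin L → ZMod N) (Fin L → ZMod N) ℂ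

section Operators

variable {N : ℕ} [NeZero N] {L : ℕ}

/-- `Z v_σ = ω^σ v_σ`. -/
def opZ (ω : ℂ) : SiteOp N := Matrix.diagonal fun σ => ω ^ σ.val

/-- `X v_σ = v_{σ+1}`. -/
def opX : SiteOp N := Matrix.of fun σ' σ => if σ' = σ + 1 then 1 else 0

/-- The permutation operator `v_σ ⊗ v_τ ↦ v_τ ⊗ v_σ` on `ℂ^N ⊗ ℂ^N`. -/
def opP : Matrix (ZMod N × ZMod N) (ZMod N × ZMod N) ℂ :=
  Matrix.of fun a b => if a = b.swap then 1 else 0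

/-- The `S`-operator `S(p, p'; q, q')` on `ℂ^N ⊗ ℂ^N`. -/
def opS (ω : ℂ) (p p' q q' : Rapidity) : Matrix (ZMod N × ZMod N) (ZMod N × ZMod N) ℂ :=
  (1 / (N : ℂ) ^ 2) • (opP *
    ∑ n₁ : ZMod N, ∑ n₂ : ZMod N, ∑ n₃ : ZMod N, ∑ n₄ : ZMod N,
      (weightHat ω p q' n₁ * weightBar ω p q n₂ * weightBar ω p' q' n₃ * weightHat ω p' q n₄) •
        ((opX ^ n₁.val * opZ ω ^ n₂.val * opX ^ n₄.val) ⊗ₖ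
          (opX⁻¹ ^ n₁.val * opZ ω ^ n₃.val * opX⁻¹ ^ n₄.val)))

/-- The operator acting as `O` on the `i`-th site and as the identity on all other sites. -/
def atSite (i : Fin L) (O : SiteOp N) : ChainOp N L :=
  Matrix.of fun σ' σ => if ∀ j, j ≠ i → σ' j = σ j then O (σ' i) (σ i) else 0

/-- The operator on `(ℂ^N)^{⊗L} ⊗ ℂ^N` acting as `O` on the `i`-th site and on the auxiliary
space, and as the identity on all other sites. -/
def atSiteAux (i : Fin L) (O : Matrix (ZMod N × ZMod N) (ZMod N × ZMod N) ℂ) :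
    Matrix ((Fin L → ZMod N) × ZMod N) ((Fin L → ZMod N) × ZMod N) ℂ :=
  Matrix.of fun a b =>
    if ∀ j, j ≠ i → a.1 j = b.1 j then O (a.1 i, a.2) (b.1 i, b.2) else 0

/-! ### The chiral Potts transfer matrix -/

/-- The monodromy matrix `T(q₁, q₂; {p, p'}) = S₁ S₂ ⋯ S_L`. -/
def monodromy (ω : ℂ) (q₁ q₂ : Rapidity) (p p' : Fin L → Rapidity) :
    Matrix ((Fin L → ZMod N) × ZMod N) ((Fin L → ZMod N) × ZMod N) ℂ :=
  (List.ofFn fun i => atSiteAux i (opS ω (p i) (p' i) q₁ q₂)).prod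

/-- The row-to-row transfer matrix `t(q₁, q₂; {p, p'})`: the trace of the monodromy matrix over
the auxiliary space. -/
def transfer (ω : ℂ) (q₁ q₂ : Rapidity) (p p' : Fin L → Rapidity) : ChainOp N L :=
  Matrix.of fun σ' σ => ∑ a : ZMod N, monodromy ω q₁ q₂ p p' (σ', a) (σ, a)

/-- The superintegrable (SCP) transfer matrix `t(q₁, q₂; {p}) = t(q₁, q₂; {p, p̄})`. -/
def transferSCP (ω : ℂ) (q₁ q₂ : Rapidity) (p : Fin L → Rapidity) : ChainOp N L :=
  transfer ω q₁ q₂ p fun i => (p i).bar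

/-! ### The `τ₂`-model -/

/-- The cyclic `L`-operator `𝓛(z; p, p')`, a `2 × 2` matrix of operators on `ℂ^N`. -/
def opL (ω z : ℂ) (p p' : Rapidity) : Matrix (Fin 2) (Fin 2) (SiteOp N) :=
  !![(-(p.y * p'.y * z)) • 1 + (p.mu * p'.mu) • opZ ω,
      (-z) • ((p.y • 1 - (p'.x * p.mu * p'.mu) • opZ ω) * opX);
    opX⁻¹ * (p'.y • 1 - (p.x * p.mu * p'.mu) • opZ ω),
      1 - (p.x * p'.x * p.mu * p'.mu * z * ω) • opZ ω]

/-- The monodromy matrix `𝓣(z; {p}) = 𝓛₁(z; p₁, p̄₁) ⋯ 𝓛_L(z; p_L, p̄_L)` of the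
superintegrable `τ₂`-model, a `2 × 2` matrix of operators on the chain. -/
def monodromyTau (ω z : ℂ) (p : Fin L → Rapidity) : Matrix (Fin 2) (Fin 2) (ChainOp N L) :=
  (List.ofFn fun i => (opL ω z (p i) (p i).bar).map (atSite i)).prod

/-- `B(z)`, the upper right entry of `𝓣(z; {p})`. -/
def opB (ω z : ℂ) (p : Fin L → Rapidity) : ChainOp N L := monodromyTau ω z p 0 1

/-- The reference state `|0⟩ = v₀ ⊗ ⋯ ⊗ v₀`. -/
def refState : (Fin L → ZMod N) → ℂ := Pi.single 0 1

/-- The state `B(z₁) B(z₂) ⋯ B(z_R) |0⟩`. -/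
def betheState (ω : ℂ) (p : Fin L → Rapidity) {R : ℕ} (z : Fin R → ℂ) :
    (Fin L → ZMod N) → ℂ :=
  Matrix.mulVec (List.ofFn fun i => opB ω (z i) p).prod refState

end Operators

/-! ### Bethe equations -/

/-- `a(z) = ∏ₙ (1 - t_{pₙ} z)`. -/
def aFun {L : ℕ} (p : Fin L → Rapidity) (z : ℂ) : ℂ := ∏ n, (1 - (p n).t * z)

/-- `d(z) = ∏ₙ (1 - t_{pₙ} z ω)`. -/
def dFun (ω : ℂ) {L : ℕ} (p : Fin L → Rapidity) (z : ℂ) : ℂ := ∏ n, (1 - (p n).t * z * ω)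

/-- `f(z) = (z - ω) / ((z - 1) ω)`. -/
def fFun (ω z : ℂ) : ℂ := (z - ω) / ((z - 1) * ω)

/-- The family `z₁, …, z_R` is a regular solution of the Bethe equations: its members are
non-zero and pairwise distinct complex numbers that satisfy the equations. -/
structure IsRegularBetheSolution (ω : ℂ) {L : ℕ} (p : Fin L → Rapidity) {R : ℕ}
    (z : Fin R → ℂ) : Prop where
  ne_zero : ∀ i, z i ≠ 0
  injective : Function.Injective z
  bethe : ∀ i,
    aFun p (z i) * ∏ j ∈ Finset.univ.erase i, fFun ω (z i / z j) =
      dFun ω p (z i) * ∏ j ∈ Finset.univ.erase i, fFun ω (z j / z i)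

/-! ### Ingredients of the eigenvalue -/

/-- `F(t) = ∏ᵢ (1 - t zᵢ)`. -/
def FPoly {R : ℕ} (z : Fin R → ℂ) (t : ℂ) : ℂ := ∏ i, (1 - t * z i)

/-- `μ_{τ'τ}(z)`. -/
def muFun (ω : ℂ) (q : Rapidity) (s τ' τ : ℕ) (z : ℂ) : ℂ :=
  (q.t * z - 1) * (q.t * z * ω ^ s - 1) * ω ^ τ' /
    ((q.t * z * ω ^ τ' - 1) * (q.t * z * ω ^ (τ + 1) - 1))

/-- The quotient `(a^N - b^N) / (a - b)`, read as a polynomial in `a` and `b`. -/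
def powQuot (N : ℕ) (a b : ℂ) : ℂ := ∑ j ∈ Finset.range N, a ^ j * b ^ (N - 1 - j)

theorem powQuot_eq_div {N : ℕ} {a b : ℂ} (h : a ≠ b) :
    powQuot N a b = (a ^ N - b ^ N) / (a - b) := by
  rw [eq_div_iff (sub_ne_zero.mpr h)]
  exact Commute.geom_sum₂_mul (Commute.all a b) N

/-- The prefactor `N^L ∏ₙ (x_{pₙ} - x_q)/(x_{pₙ}^N - x_q^N) · (y_{pₙ} - y_q)/(y_{pₙ}^N - y_q^N)`. -/
def prefactor (N : ℕ) {L : ℕ} (p : Fin L → Rapidity) (q : Rapidity) : ℂ :=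
  (N : ℂ) ^ L * ∏ n, (((p n).x - q.x) / ((p n).x ^ N - q.x ^ N) *
    (((p n).y - q.y) / ((p n).y ^ N - q.y ^ N)))

/-- `λ_τ`, the summands of the eigenvalue on the reference state:
the prefactor times `ω^{τL} ∏ₙ (t_{pₙ}^N - t_q^N)/(t_{pₙ} - t_q ω^τ)`. Since `ω^N = 1`, each of the
quotients is the polynomial `powQuot N t_{pₙ} (t_q ω^τ)`. -/
def lam (N : ℕ) (ω : ℂ) {L : ℕ} (p : Fin L → Rapidity) (q : Rapidity) (τ : ℕ) : ℂ :=
  prefactor N p q * (∏ n, powQuot N (p n).t (q.t * ω ^ τ)) * ω ^ (τ * L)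

end

end SCP

/-!
The Bethe state `|R⟩` diagonalises the transfer matrix of the `τ₂`-model by the algebraic Bethe
ansatz, and the superintegrable chiral Potts transfer matrix is tied to the latter by
`TQ`-relations in `s`, strong enough to determine its action on `|R⟩`.

*Reduction.* Up to an explicit scalar, the `S`-operator `S(p, p̄; q, q̄(s))` is the operator `sHat`
(`blocks_opS`), whose matrix elements are polynomials in `X = x_q`, `Y = y_q`, `c = x_q ω^s`. The
sums over `n₁, …, n₄` collapse by the convolution theorem, and the products of weights that remain
lose their denominators by the relation of the curve, which makes the weights periodic. From here on
`X` and `Y` are unconstrained complex numbers, and `T(c)` is the monodromy matrix `sMon` built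
from `sHat`.

*The `TQ`-relation.* At `u = (c Y)⁻¹` the product of the `L`-operator of the `τ₂`-model and of
`sHat`, on the tensor product of the two auxiliary spaces, is block triangular with respect to a
subspace independent of the site; on the subspace and on the quotient it is again an `sHat`, with `c`
multiplied or divided by `ω` (`locL_sHat_fuseIn`, `fuseOut_locL_sHat`). Being local, these intertwining relations
pass to the monodromy matrices, and they give
`τ₂(u) tr T(cω) = a(u) tr T(cω²) + d(u) Z₁⋯Z_L tr T(c)` (`tau_mul_trace_sMon`), where
`u = (c ω Y)⁻¹`.

*Initial values.* The recursion alone does not fix `tr T`. A telescoping sum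
(`sum_pairFun_telescope`) shows that for `c = x_q ω` the auxiliary vector `v_0` splits off, with a
scalar operator (`sMon_zero_row`), and for `c = x_q ω⁻¹` the vector `v_{N-1}`, with a multiple of
`(Z₁⋯Z_L)⁻¹` (`sMon_last_col`). By the first of these `T(x_q ω^s)` leaves the span of
`v_s, …, v_{N-1}` invariant (`sMon_triangular`), and the trace over this span obeys the same
`TQ`-relation, with boundary values now known at `s = N` and `s = N - 1`. Descending from there to
`s = 0` and `s = 1`, and ascending again with the full traces, gives the eigenvalue for every `s`
(`blockTrace_mulVec_betheState`, `trace_sMon_mulVec_betheState`), for `X` and `Y` such that no factor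
that has to be cancelled vanishes.

*Closure.* These conditions hold for `(X + ε, Y + ε)` with small `ε ≠ 0`, and everything is continuous
in `ε`. If the denominators in the eigenvalue do not vanish at `ε = 0` one passes to the limit; if
they do, it is still true that the image of `|R⟩` lies on the line spanned by `|R⟩`, which is closed.
-/

namespace SCP

open scoped Kronecker

noncomputable section

set_option linter.unusedSectionVars false

/-! ### Operators on a single site inside the chain -/

section Chain

variable {N : ℕ} [NeZero N] {L : ℕ}

theorem atSite_mul_apply (i : Fin L) (O : SiteOp N) (M : ChainOp N L) (σ' σ : Fin L → ZMod N) :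
    (atSite i O * M) σ' σ = ∑ a, O (σ' i) a * M (Function.update σ' i a) σ := by
  rw [Matrix.mul_apply]
  symm
  refine Finset.sum_of_injOn (fun a => Function.update σ' i a) ?_ (by simp) ?_ ?_
  · intro a _ b _ h
    simpa using congrFun h i
  · intro τ _ hτ
    have : ¬ ∀ j, j ≠ i → σ' j = τ j := by
      intro h
      apply hτ
      refine ⟨τ i, by simp, ?_⟩
      funext j
      by_cases hj : j = i
      · subst hj; simp
      · simp [hj, h j hj]
    simp [atSite, this]
  · intro a _
    have : ∀ j, j ≠ i → σ' j = Function.update σ' i a j := fun j hj => by simp [hj]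
    simp only [atSite, Matrix.of_apply, if_pos this, Function.update_self]

theorem atSite_apply_update (i : Fin L) (O : SiteOp N) (σ' σ : Fin L → ZMod N) (a : ZMod N) :
    atSite i O (Function.update σ' i a) σ =
      if ∀ j, j ≠ i → σ' j = σ j then O a (σ i) else 0 := by
  have : (∀ j, j ≠ i → Function.update σ' i a j = σ j) ↔ ∀ j, j ≠ i → σ' j = σ j :=
    forall₂_congr fun j hj => by simp [hj]
  simp [atSite, this]

theorem atSite_one (i : Fin L) : atSite i (1 : SiteOp N) = 1 := by
  ext σ' σ
  by_cases h : σ' = σ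
  · subst h; simp [atSite]
  · by_cases h' : ∀ j, j ≠ i → σ' j = σ j
    · have : σ' i ≠ σ i := by
        intro hi
        apply h
        funext j
        by_cases hj : j = i
        · rw [hj, hi]
        · exact h' j hj
      simp [atSite, Matrix.one_apply, h, this]
    · simp [atSite, Matrix.one_apply, h, h']

/-- The embedding of the operators on one site into those on the chain, as a homomorphism of
algebras. -/
def siteHom (i : Fin L) : SiteOp N →ₐ[ℂ] ChainOp N L :=
  AlgHom.ofLinearMap
    { toFun := atSite i
      map_add' := fun O O' => by
        ext σ' σ
        simp only [atSite, Matrix.of_apply, Matrix.add_apply]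
        split_ifs <;> simp
      map_smul' := fun c O => by
        ext σ' σ
        simp only [atSite, Matrix.of_apply, Matrix.smul_apply, RingHom.id_apply]
        split_ifs <;> simp }
    (atSite_one i)
    (fun O O' => by
      ext σ' σ
      simp only [LinearMap.coe_mk, AddHom.coe_mk]
      rw [atSite_mul_apply]
      simp only [atSite_apply_update]
      by_cases h : ∀ j, j ≠ i → σ' j = σ j
      · simp only [atSite, Matrix.of_apply, if_pos h, Matrix.mul_apply]
      · simp only [atSite, Matrix.of_apply, if_neg h, mul_zero, Finset.sum_const_zero])

theorem siteHom_apply (i : Fin L) (O : SiteOp N) : siteHom i O = atSite i O := rfl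

theorem siteHom_mul_apply_of_ne {i j : Fin L} (h : i ≠ j) (O O' : SiteOp N)
    (σ' σ : Fin L → ZMod N) :
    (siteHom i O * siteHom j O') σ' σ =
      if ∀ k, k ≠ i → k ≠ j → σ' k = σ k then O (σ' i) (σ i) * O' (σ' j) (σ j) else 0 := by
  rw [siteHom_apply, atSite_mul_apply, Finset.sum_eq_single (σ i)]
  · have : (∀ k, k ≠ j → Function.update σ' i (σ i) k = σ k) ↔
        ∀ k, k ≠ i → k ≠ j → σ' k = σ k := by
      refine ⟨fun H k hi hj => by simpa [hi] using H k hj, fun H k hj => ?_⟩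
      by_cases hi : k = i
      · subst hi; simp
      · simpa [hi] using H k hi hj
    simp only [siteHom_apply, atSite, Matrix.of_apply, this, mul_ite, mul_zero]
    simp [h.symm]
  · intro a _ ha
    have : ¬ ∀ k, k ≠ j → Function.update σ' i a k = σ k := fun H => ha (by simpa using H i h)
    simp [siteHom_apply, atSite, this]
  · simp

theorem commute_siteHom {i j : Fin L} (h : i ≠ j) (O O' : SiteOp N) :
    Commute (siteHom i O) (siteHom j O') := by
  ext σ' σ
  rw [siteHom_mul_apply_of_ne h, siteHom_mul_apply_of_ne h.symm]
  have : (∀ k, k ≠ i → k ≠ j → σ' k = σ k) ↔ ∀ k, k ≠ j → k ≠ i → σ' k = σ k :=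
    forall_congr' fun k => ⟨fun H h1 h2 => H h2 h1, fun H h1 h2 => H h2 h1⟩
  simp only [this, mul_comm]

/-! ### Monodromy matrices over an arbitrary auxiliary space -/

variable {m n : Type*} [Fintype m] [DecidableEq m] [Fintype n] [DecidableEq n]

/-- The monodromy matrix `E₁ ⋯ E_L` with auxiliary index set `m`: `E i` acts on the auxiliary space
and on the `i`-th site. -/
def glob (E : Fin L → Matrix m m (SiteOp N)) : Matrix m m (ChainOp N L) :=
  (List.ofFn fun i => (E i).map (siteHom i)).prod

theorem glob_eq_prod_map (E : Fin L → Matrix m m (SiteOp N)) :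
    glob E = ((List.finRange L).map fun i => (E i).map (siteHom i)).prod := by
  rw [glob, List.ofFn_eq_map]

/-- A matrix of scalars, as a matrix of operators. -/
abbrev scal (R : Type*) [Semiring R] [Algebra ℂ R] {a b : Type*} (M : Matrix a b ℂ) :
    Matrix a b R := M.map (algebraMap ℂ R)

/-- An intertwiner of the local matrices that does not act on the sites intertwines the monodromy
matrices. -/
theorem glob_mul_scal (E : Fin L → Matrix m m (SiteOp N)) (E' : Fin L → Matrix n n (SiteOp N))
    (ι : Matrix m n ℂ) (h : ∀ i, E i * scal (SiteOp N) ι = scal (SiteOp N) ι * E' i) :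
    glob E * scal (ChainOp N L) ι = scal (ChainOp N L) ι * glob E' := by
  rw [glob_eq_prod_map, glob_eq_prod_map]
  have hs : ∀ i : Fin L, (scal (SiteOp N) ι).map (siteHom i) = scal (ChainOp N L) ι := by
    intro i
    ext a b : 1
    simp only [Matrix.map_apply]
    exact (siteHom i).commutes _
  have h' : ∀ i : Fin L, (E i).map (siteHom i) * scal (ChainOp N L) ι =
      scal (ChainOp N L) ι * (E' i).map (siteHom i) := by
    intro i
    rw [← hs i]
    have := congrArg (fun M => M.map (siteHom i)) (h i)
    simpa only [Matrix.map_mul] using this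
  induction List.finRange L with
  | nil => simp
  | cons i l ih =>
    rw [List.map_cons, List.prod_cons, List.map_cons, List.prod_cons, Matrix.mul_assoc, ih,
      ← Matrix.mul_assoc, h' i, Matrix.mul_assoc]

/-- The product of two local matrices acting on two different auxiliary spaces. -/
def tens {R : Type*} [Mul R] (E : Matrix m m R) (F : Matrix n n R) :
    Matrix (m × n) (m × n) R :=
  Matrix.of fun a b => E a.1 b.1 * F a.2 b.2

theorem tens_apply {R : Type*} [Mul R] (E : Matrix m m R) (F : Matrix n n R) (a b : m × n) :
    tens E F a b = E a.1 b.1 * F a.2 b.2 := rfl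

/-- The entries of a monodromy matrix over the sites in `l` commute with the operators on any other
site. -/
theorem commute_prod_map_apply (E : Fin L → Matrix m m (SiteOp N)) (l : List (Fin L)) {i : Fin L}
    (hi : i ∉ l) (O : SiteOp N) (a b : m) :
    Commute (siteHom i O) ((l.map fun i => (E i).map (siteHom i)).prod a b) := by
  induction l generalizing a with
  | nil =>
    rw [List.map_nil, List.prod_nil, Matrix.one_apply]
    split_ifs
    exacts [Commute.one_right _, Commute.zero_right _]
  | cons j l ih =>
    rw [List.map_cons, List.prod_cons, Matrix.mul_apply]
    refine Commute.sum_right _ _ _ fun c _ => ?_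
    rw [List.mem_cons, not_or] at hi
    exact (commute_siteHom hi.1 _ _).mul_right (ih hi.2 c)

/-- The monodromy matrix of a product of local matrices over two auxiliary spaces is the product of
the two monodromy matrices, since operators on different sites commute. -/
theorem glob_tens (E : Fin L → Matrix m m (SiteOp N)) (F : Fin L → Matrix n n (SiteOp N)) :
    glob (fun i => tens (E i) (F i)) = tens (glob E) (glob F) := by
  simp only [glob_eq_prod_map]
  generalize hl' : List.finRange L = l
  have hl : l.Nodup := hl' ▸ List.nodup_finRange L
  clear hl'
  induction l with
  | nil =>
    ext a b : 1
    simp only [List.map_nil, List.prod_nil, tens_apply, Matrix.one_apply, Prod.ext_iff]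
    split_ifs <;> simp_all
  | cons i l ih =>
    rw [List.nodup_cons] at hl
    ext a b : 1
    rw [tens_apply, List.map_cons, List.map_cons, List.map_cons, List.prod_cons, List.prod_cons,
      List.prod_cons, ih hl.2, Matrix.mul_apply, Matrix.mul_apply, Matrix.mul_apply,
      Finset.sum_mul_sum, Fintype.sum_prod_type]
    refine Finset.sum_congr rfl fun c _ => Finset.sum_congr rfl fun d _ => ?_
    rw [Matrix.map_apply, Matrix.map_apply, Matrix.map_apply, tens_apply, tens_apply, map_mul,
      mul_assoc, mul_assoc]
    congr 1
    rw [← mul_assoc, ← mul_assoc, (commute_prod_map_apply E l hl.1 _ _ _).eq]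

theorem glob_reindex (e : m ≃ n) (E : Fin L → Matrix m m (SiteOp N)) :
    glob (fun i => (E i).submatrix e.symm e.symm) = (glob E).submatrix e.symm e.symm := by
  simp only [glob_eq_prod_map]
  induction List.finRange L with
  | nil => simp
  | cons i l ih =>
    rw [List.map_cons, List.prod_cons, ih, List.map_cons, List.prod_cons,
      Matrix.submatrix_mul _ _ _ _ _ e.symm.bijective]
    rfl

theorem glob_smul (r : Fin L → ℂ)
    (E : Fin L → Matrix m m (SiteOp N)) :
    glob (fun i => r i • E i) = (∏ i, r i) • glob E := by
  rw [glob_eq_prod_map, glob_eq_prod_map, ← List.prod_ofFn, List.ofFn_eq_map]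
  induction List.finRange L with
  | nil => simp
  | cons i l ih =>
    have h : (r i • E i).map (siteHom i) = r i • (E i).map (siteHom i) :=
      Matrix.ext fun a b => map_smul (siteHom i) (r i) (E i a b)
    rw [List.map_cons, List.prod_cons, ih, List.map_cons, List.prod_cons, List.map_cons,
      List.prod_cons, h, Matrix.smul_mul, Matrix.mul_smul, smul_smul]

end Chain

/-! ### Weighted shifts on one site -/

section WeightedShift

variable {N : ℕ} [NeZero N]

/-- The character `a ↦ ω^a` of `ℤ/N`. -/
def chi (ω : ℂ) (a : ZMod N) : ℂ := ω ^ a.val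

variable {ω : ℂ}

theorem chi_natCast (hω : ω ^ N = 1) (j : ℕ) : chi ω (j : ZMod N) = ω ^ j := by
  rw [chi, ZMod.val_natCast, ← pow_eq_pow_mod j hω]

theorem chi_add (hω : ω ^ N = 1) (a b : ZMod N) : chi ω (a + b) = chi ω a * chi ω b := by
  rw [chi, chi, chi, ZMod.val_add, ← pow_eq_pow_mod _ hω, pow_add]

theorem chi_zero : chi ω (0 : ZMod N) = 1 := by simp [chi]

theorem chi_one (hω : ω ^ N = 1) : chi ω (1 : ZMod N) = ω := by
  simpa using chi_natCast hω 1

theorem chi_ne_zero (hω : ω ^ N = 1) (a : ZMod N) : chi ω a ≠ 0 := by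
  apply pow_ne_zero
  rintro rfl
  rw [zero_pow (NeZero.ne N)] at hω
  exact zero_ne_one hω

theorem chi_neg (hω : ω ^ N = 1) (a : ZMod N) : chi ω (-a) = (chi ω a)⁻¹ := by
  apply eq_inv_of_mul_eq_one_left
  rw [← chi_add hω, neg_add_cancel, chi_zero]

theorem chi_sub (hω : ω ^ N = 1) (a b : ZMod N) : chi ω (a - b) = chi ω a * (chi ω b)⁻¹ := by
  rw [sub_eq_add_neg, chi_add hω, chi_neg hω]

theorem chi_pow (hω : ω ^ N = 1) (a : ZMod N) : chi ω a ^ N = 1 := by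
  rw [chi, ← pow_mul, mul_comm, pow_mul, hω, one_pow]

theorem chi_mul_natCast (hω : ω ^ N = 1) (a : ZMod N) (j : ℕ) :
    chi ω (a * (j : ZMod N)) = chi ω a ^ j := by
  rw [← ZMod.natCast_rightInverse a, ← Nat.cast_mul, chi_natCast hω, chi_natCast hω, pow_mul]

/-- Orthogonality of characters. -/
theorem sum_chi_mul (hω : IsPrimitiveRoot ω N) (b : ZMod N) :
    ∑ a : ZMod N, chi ω (a * b) = if b = 0 then (N : ℂ) else 0 := by
  have h := AddChar.sum_mulShift b (AddChar.zmodChar_primitive_of_primitive_root N hω)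
  simp only [AddChar.zmodChar_apply, ZMod.card] at h
  simpa [chi, apply_ite] using h

/-- The weighted shift `v_σ ↦ g(σ + k) v_{σ + k}`. -/
def wshift (k : ZMod N) (g : ZMod N → ℂ) : SiteOp N :=
  Matrix.of fun σ' σ => if σ' = σ + k then g σ' else 0

theorem wshift_mul (k l : ZMod N) (g h : ZMod N → ℂ) :
    wshift k g * wshift l h = wshift (k + l) fun σ => g σ * h (σ - k) := by
  ext σ' σ
  rw [Matrix.mul_apply, Finset.sum_eq_single (σ' - k)]
  · have : σ' - k = σ + l ↔ σ' = σ + (k + l) := by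
      rw [sub_eq_iff_eq_add, add_assoc, add_comm l k]
    simp [wshift, this]
  · intro b _ hb
    have : ¬ σ' = b + k := fun h => hb (by rw [h, add_sub_cancel_right])
    simp [wshift, this]
  · simp

theorem wshift_add (k : ZMod N) (g h : ZMod N → ℂ) :
    wshift k g + wshift k h = wshift k fun σ => g σ + h σ := by
  ext σ' σ
  simp only [wshift, Matrix.add_apply, Matrix.of_apply]
  split_ifs <;> simp

theorem wshift_sub (k : ZMod N) (g h : ZMod N → ℂ) :
    wshift k g - wshift k h = wshift k fun σ => g σ - h σ := by
  ext σ' σ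
  simp only [wshift, Matrix.sub_apply, Matrix.of_apply]
  split_ifs <;> simp

theorem smul_wshift (c : ℂ) (k : ZMod N) (g : ZMod N → ℂ) :
    c • wshift k g = wshift k fun σ => c * g σ := by
  ext σ' σ
  simp only [wshift, Matrix.smul_apply, Matrix.of_apply]
  split_ifs <;> simp

theorem wshift_congr {k l : ZMod N} {g h : ZMod N → ℂ} (hk : k = l) (hg : ∀ σ, g σ = h σ) :
    wshift k g = wshift l h := by
  rw [hk, funext hg]

theorem wshift_zero_one : wshift (0 : ZMod N) (fun _ => 1) = 1 := by
  ext σ' σ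
  simp [wshift, Matrix.one_apply]

theorem wshift_zero_const (c : ℂ) :
    wshift (0 : ZMod N) (fun _ => c) = algebraMap ℂ (SiteOp N) c := by
  rw [Algebra.algebraMap_eq_smul_one, ← wshift_zero_one, smul_wshift]
  simp only [mul_one]

theorem opZ_eq (ω : ℂ) : (opZ ω : SiteOp N) = wshift 0 (chi ω) := by
  ext σ' σ
  by_cases h : σ' = σ <;> simp [opZ, wshift, chi, h]

theorem opX_eq : (opX : SiteOp N) = wshift 1 fun _ => 1 := rfl

theorem opX_inv_eq : (opX⁻¹ : SiteOp N) = wshift (-1) fun _ => 1 := by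
  apply Matrix.inv_eq_right_inv
  rw [opX_eq, wshift_mul, ← wshift_zero_one]
  exact wshift_congr (by ring) fun _ => by ring

theorem opX_pow (n : ℕ) : (opX : SiteOp N) ^ n = wshift n fun _ => 1 := by
  induction n with
  | zero => simp [wshift_zero_one]
  | succ n ih =>
    rw [pow_succ, ih, opX_eq, wshift_mul]
    exact wshift_congr (by push_cast; ring) fun _ => by ring

theorem opX_inv_pow (n : ℕ) : (opX⁻¹ : SiteOp N) ^ n = wshift (-(n : ZMod N)) fun _ => 1 := by
  rw [Matrix.inv_pow', opX_pow]
  apply Matrix.inv_eq_right_inv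
  rw [wshift_mul, ← wshift_zero_one]
  exact wshift_congr (by ring) fun _ => by ring

theorem opZ_pow (n : ℕ) : (opZ ω : SiteOp N) ^ n = wshift 0 fun σ => chi ω σ ^ n := by
  induction n with
  | zero => simp [wshift_zero_one]
  | succ n ih =>
    rw [pow_succ, ih, opZ_eq, wshift_mul]
    exact wshift_congr (by ring) fun σ => by simp [pow_succ]

end WeightedShift

/-! ### The Yang–Baxter algebra of the `τ₂`-model -/

section YangBaxter

variable {N : ℕ} [NeZero N] {L : ℕ} {ω : ℂ}

/-- The local `L`-operator of the superintegrable `τ₂`-model, as a function of `x_p` and `y_p`. -/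
def locL (ω x y z : ℂ) : Matrix (Fin 2) (Fin 2) (SiteOp N) :=
  !![wshift 0 fun σ => chi ω σ - x * y * z, wshift 1 fun σ => -(z * y * (1 - chi ω σ));
    wshift (-1) fun σ => x * (1 - ω * chi ω σ), wshift 0 fun σ => 1 - x * y * z * ω * chi ω σ]

theorem opL_bar_eq (hω : ω ^ N = 1) (z : ℂ) (p : Rapidity) (hp : p.mu ≠ 0) :
    (opL ω z p p.bar : Matrix (Fin 2) (Fin 2) (SiteOp N)) = locL ω p.x p.y z := by
  have hc := chi_add (N := N) hω
  have h1 := chi_one (N := N) hω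
  ext a b : 1
  fin_cases a <;> fin_cases b <;>
    simp only [opL, locL, Rapidity.bar, mul_inv_cancel₀ hp, mul_inv_cancel_right₀ hp, one_smul,
      opX_inv_eq] <;>
    simp only [opZ_eq, opX_eq, ← wshift_zero_one, smul_wshift, wshift_add, wshift_sub,
      wshift_mul, Matrix.of_apply, Matrix.cons_val', Matrix.cons_val_zero, Matrix.cons_val_one,
      Matrix.cons_val_fin_one, Fin.zero_eta, Fin.mk_one, Fin.isValue] <;>
    refine wshift_congr (by ring) fun σ => ?_
  · ring
  · ring
  · rw [sub_neg_eq_add, hc, h1]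
    ring

/-- The six-vertex `R`-matrix of the `τ₂`-model. -/
def rMat (ω u z : ℂ) : Matrix (Fin 2 × Fin 2) (Fin 2 × Fin 2) ℂ :=
  Matrix.of fun a b => match a, b with
    | (0, 0), (0, 0) => z - ω * u
    | (0, 1), (0, 1) => ω * (z - u)
    | (0, 1), (1, 0) => (1 - ω) * u
    | (1, 0), (0, 1) => (1 - ω) * z
    | (1, 0), (1, 0) => z - u
    | (1, 1), (1, 1) => z - ω * u
    | _, _ => 0

/-- The Yang–Baxter relation; the product on the left is taken in the opposite order of the two
auxiliary spaces. -/
theorem locL_rMat (hω : ω ^ N = 1) (x y u z : ℂ) :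
    (tens (locL ω x y z : Matrix _ _ (SiteOp N)) (locL ω x y u)).submatrix Prod.swap Prod.swap *
      scal (SiteOp N) (rMat ω u z) =
    scal (SiteOp N) (rMat ω u z) * tens (locL ω x y u) (locL ω x y z) := by
  have hω0 : ω ≠ 0 := by
    rintro rfl
    rw [zero_pow (NeZero.ne N)] at hω
    exact zero_ne_one hω
  have hc := chi_add (N := N) hω
  have hs := chi_sub (N := N) hω
  have h1 := chi_one (N := N) hω
  have e1 : ∀ (c : ℂ) (M : SiteOp N), algebraMap ℂ (SiteOp N) c * M = c • M :=
    fun c M => (Algebra.smul_def c M).symm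
  have e2 : ∀ (c : ℂ) (M : SiteOp N), M * algebraMap ℂ (SiteOp N) c = c • M :=
    fun c M => by rw [← Algebra.commutes, Algebra.smul_def]
  ext a b : 1
  obtain ⟨a1, a2⟩ := a
  obtain ⟨b1, b2⟩ := b
  simp only [Matrix.mul_apply, Matrix.map_apply, Matrix.submatrix_apply, tens_apply,
    Fintype.sum_prod_type, Fin.sum_univ_two, Prod.swap, e1, e2]
  fin_cases a1 <;> fin_cases a2 <;> fin_cases b1 <;> fin_cases b2 <;>
    simp only [locL, rMat, Matrix.of_apply, Matrix.cons_val', Matrix.cons_val_zero, Matrix.cons_val_one,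
      Matrix.cons_val_fin_one, Fin.zero_eta, Fin.mk_one, Fin.isValue, wshift_mul, smul_wshift, zero_smul,
      add_zero, zero_add, wshift_add, add_neg_cancel, neg_add_cancel] <;>
    (refine wshift_congr (by ring) fun σ => ?_) <;>
    simp only [hs, h1, sub_zero, sub_neg_eq_add, hc] <;> field_simp <;> ring

/-- The monodromy matrix of the superintegrable `τ₂`-model. -/
def tauMon (N : ℕ) [NeZero N] (ω : ℂ) (p : Fin L → Rapidity) (z : ℂ) :
    Matrix (Fin 2) (Fin 2) (ChainOp N L) :=
  glob fun i => locL ω (p i).x (p i).y z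

theorem monodromyTau_eq (hω : ω ^ N = 1) (p : Fin L → Rapidity) (hp : ∀ i, (p i).mu ≠ 0) (z : ℂ) :
    monodromyTau (N := N) ω z p = tauMon N ω p z := by
  simp only [monodromyTau, tauMon, glob, opL_bar_eq hω z _ (hp _)]
  rfl

theorem tauMon_rMat (hω : ω ^ N = 1) (p : Fin L → Rapidity) (u z : ℂ) :
    (tens (tauMon N ω p z) (tauMon N ω p u)).submatrix Prod.swap Prod.swap *
      scal (ChainOp N L) (rMat ω u z) =
    scal (ChainOp N L) (rMat ω u z) * tens (tauMon N ω p u) (tauMon N ω p z) := by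
  have h := glob_mul_scal (L := L) _ _ (rMat ω u z) fun i =>
    locL_rMat (N := N) hω (p i).x (p i).y u z
  have e := glob_reindex (Equiv.prodComm (Fin 2) (Fin 2))
    fun i : Fin L => tens (locL ω (p i).x (p i).y z : Matrix _ _ (SiteOp N))
      (locL ω (p i).x (p i).y u)
  rw [glob_tens] at h e
  exact e ▸ h

/-- The entries of `tauMon_rMat`. -/
theorem tauMon_rMat_apply (hω : ω ^ N = 1) (p : Fin L → Rapidity) (u z : ℂ)
    (a b : Fin 2 × Fin 2) :
    ∑ c : Fin 2 × Fin 2,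
        rMat ω u z c b • (tauMon N ω p z a.2 c.2 * tauMon N ω p u a.1 c.1) =
      ∑ c : Fin 2 × Fin 2,
        rMat ω u z a c • (tauMon N ω p u c.1 b.1 * tauMon N ω p z c.2 b.2) := by
  have h : (_ : Matrix _ _ (ChainOp N L)) a b = _ := congrFun₂ (tauMon_rMat hω p u z) a b
  rw [Matrix.mul_apply, Matrix.mul_apply] at h
  simp only [Matrix.map_apply, ← Algebra.commutes, ← Algebra.smul_def] at h
  exact h

theorem tauMon_A_mul_B (hω : ω ^ N = 1) (p : Fin L → Rapidity) (u z : ℂ) :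
    (u - z) • (tauMon N ω p u 0 0 * tauMon N ω p z 0 1) =
      (u - ω * z) • (tauMon N ω p z 0 1 * tauMon N ω p u 0 0) +
        (-((1 - ω) * z)) • (tauMon N ω p u 0 1 * tauMon N ω p z 0 0) := by
  have h := tauMon_rMat_apply hω p z u (0, 0) (1, 0)
  simp only [Fintype.sum_prod_type, Fin.sum_univ_two, rMat, Matrix.of_apply, zero_smul, add_zero,
    zero_add] at h
  rw [← h]
  module

theorem tauMon_D_mul_B (hω : ω ^ N = 1) (p : Fin L → Rapidity) (u z : ℂ) :
    (u - z) • (tauMon N ω p u 1 1 * tauMon N ω p z 0 1) =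
      (ω * u - z) • (tauMon N ω p z 0 1 * tauMon N ω p u 1 1) +
        ((1 - ω) * z) • (tauMon N ω p u 0 1 * tauMon N ω p z 1 1) := by
  have h := tauMon_rMat_apply hω p u z (1, 0) (1, 1)
  simp only [Fintype.sum_prod_type, Fin.sum_univ_two, rMat, Matrix.of_apply, zero_smul, add_zero,
    zero_add] at h
  rw [← sub_eq_zero] at h ⊢
  rw [← h]
  module

theorem continuous_glob {m T : Type*} [Fintype m] [DecidableEq m] [TopologicalSpace T]
    (E : T → Fin L → Matrix m m (SiteOp N)) (h : ∀ i, Continuous fun t => E t i) :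
    Continuous fun t => glob (E t) := by
  simp only [glob_eq_prod_map]
  refine continuous_list_prod _ fun i _ => ?_
  refine (h i).matrix_map ?_
  exact (siteHom i).toLinearMap.continuous_of_finiteDimensional

theorem continuous_tauMon (p : Fin L → Rapidity) : Continuous (tauMon N ω p) := by
  refine continuous_glob _ fun i => ?_
  refine continuous_matrix fun a b => continuous_matrix fun σ' σ => ?_
  fin_cases a <;> fin_cases b <;> simp only [locL, wshift, Matrix.of_apply, Matrix.cons_val',
    Matrix.cons_val_zero, Matrix.cons_val_one, Matrix.cons_val_fin_one, Fin.zero_eta, Fin.mk_one,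
    Fin.isValue] <;> split_ifs <;> fun_prop

/-- The `R`-matrix gives `[B(u), B(z)] = 0` for `z ≠ ωu`; the remaining case follows by
continuity. -/
theorem tauMon_B_comm (hω : ω ^ N = 1) (p : Fin L → Rapidity) (u z : ℂ) :
    Commute (tauMon N ω p u 0 1) (tauMon N ω p z 0 1) := by
  have hc : Continuous fun z => tauMon N ω p z 0 1 :=
    (continuous_apply_apply (0 : Fin 2) (1 : Fin 2)).comp (continuous_tauMon p)
  have hd : Dense ({ω * u}ᶜ : Set ℂ) := dense_compl_singleton _
  refine congrFun (Continuous.ext_on hd (hc.const_mul _) (hc.mul_const _) ?_) z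
  intro w hw
  have h := tauMon_rMat_apply hω p u w (0, 0) (1, 1)
  simp only [Fintype.sum_prod_type, Fin.sum_univ_two, rMat, Matrix.of_apply, zero_smul, add_zero,
    zero_add] at h
  exact (smul_right_injective _ (sub_ne_zero.mpr hw) h).symm

end YangBaxter

/-! ### The algebraic Bethe ansatz -/

section BetheAnsatz

variable {V ι : Type*} [AddCommGroup V] [Module ℂ V] [DecidableEq ι]

/-- The off-shell action of `A(u)`, or of `D(u)`, on the states `Ψ S = ∏_{i ∈ S} B(z_i) v`: the
exchange relation with coefficients `α`, `γ` produces the wanted term and one unwanted term for each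
`k ∈ S`. The hypothesis `hαγ` is the identity by which the two contributions to an unwanted term add
up when one more factor `B(z_i)` is passed. -/
theorem exchange_offshell (A B : ℂ → V →ₗ[ℂ] V) (a : ℂ → ℂ) (α : ℂ → ℂ → ℂ) (γ : ℂ → ℂ)
    (hex : ∀ u w v, (u - w) • A u (B w v) = α u w • B w (A u v) + γ w • B u (A w v))
    (hαγ : ∀ u i k, α u i * (i - k) * γ k + γ i * γ k * (u - k) = -(γ k * α k i * (u - i)))
    (hB : ∀ u w v, B u (B w v) = B w (B u v))
    (z : ι → ℂ) (hz : Function.Injective z) (Ψ : Finset ι → V) (hvac : ∀ u, A u (Ψ ∅) = a u • Ψ ∅)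
    (hΨ : ∀ i S, i ∉ S → Ψ (insert i S) = B (z i) (Ψ S)) (S : Finset ι) :
    ∀ u, (∀ i ∈ S, u ≠ z i) →
      A u (Ψ S) = (a u * ∏ j ∈ S, α u (z j) / (u - z j)) • Ψ S +
        ∑ k ∈ S, (γ (z k) / (u - z k) * a (z k) *
          ∏ j ∈ S.erase k, α (z k) (z j) / (z k - z j)) • B u (Ψ (S.erase k)) := by
  induction S using Finset.induction_on with
  | empty => intro u _; simp [hvac]
  | insert i S hi ih =>
    intro u hu
    have hui : u - z i ≠ 0 := sub_ne_zero.mpr (hu i (Finset.mem_insert_self i S))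
    have huS : ∀ j ∈ S, u ≠ z j := fun j hj => hu j (Finset.mem_insert_of_mem hj)
    have hiS : ∀ j ∈ S, z i ≠ z j := fun j hj h => hi (hz h ▸ hj)
    have hex' : A u (B (z i) (Ψ S)) = (α u (z i) / (u - z i)) • B (z i) (A u (Ψ S)) +
        (γ (z i) / (u - z i)) • B u (A (z i) (Ψ S)) := by
      rw [div_eq_inv_mul, div_eq_inv_mul, mul_smul, mul_smul, ← smul_add, ← hex,
        inv_smul_smul₀ hui]
    rw [hΨ i S hi, hex', ih u huS, ih (z i) hiS, Finset.sum_insert hi, Finset.prod_insert hi,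
      Finset.erase_insert hi]
    simp only [map_add, map_sum, map_smul, smul_add, Finset.smul_sum, smul_smul]
    have key : ∀ k ∈ S,
        (γ (z k) / (u - z k) * a (z k) *
          ∏ j ∈ (insert i S).erase k, α (z k) (z j) / (z k - z j)) •
            B u (Ψ ((insert i S).erase k)) =
        (α u (z i) / (u - z i) * (γ (z k) / (u - z k) * a (z k) *
          ∏ j ∈ S.erase k, α (z k) (z j) / (z k - z j))) • B (z i) (B u (Ψ (S.erase k))) +
        (γ (z i) / (u - z i) * (γ (z k) / (z i - z k) * a (z k) *
          ∏ j ∈ S.erase k, α (z k) (z j) / (z k - z j))) • B u (B (z i) (Ψ (S.erase k))) := by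
      intro k hk
      have hik : i ≠ k := fun h => hi (h ▸ hk)
      have hi' : i ∉ S.erase k := fun h => hi (Finset.mem_of_mem_erase h)
      rw [Finset.erase_insert_of_ne hik, Finset.prod_insert hi', hΨ i _ hi', hB (z i) u, ← add_smul]
      congr 1
      have h1 : u - z k ≠ 0 := sub_ne_zero.mpr (huS k hk)
      have h2 : z i - z k ≠ 0 := sub_ne_zero.mpr (hiS k hk)
      have h3 : z k - z i ≠ 0 := sub_ne_zero.mpr (hiS k hk).symm
      have e : γ (z k) / (u - z k) * (α (z k) (z i) / (z k - z i)) =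
          α u (z i) / (u - z i) * (γ (z k) / (u - z k)) +
            γ (z i) / (u - z i) * (γ (z k) / (z i - z k)) := by
        rw [← neg_sub (z i) (z k)]
        field_simp
        linear_combination (-1 : ℂ) * hαγ u (z i) (z k)
      linear_combination (a (z k) * ∏ j ∈ S.erase k, α (z k) (z j) / (z k - z j)) * e
    rw [Finset.sum_congr rfl key, Finset.sum_add_distrib]
    have e1 : a u * (α u (z i) / (u - z i) * ∏ j ∈ S, α u (z j) / (u - z j)) =
      α u (z i) / (u - z i) * (a u * ∏ j ∈ S, α u (z j) / (u - z j)) := by ring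
    have e2 : γ (z i) / (u - z i) * a (z i) * ∏ j ∈ S, α (z i) (z j) / (z i - z j) =
      γ (z i) / (u - z i) * (a (z i) * ∏ j ∈ S, α (z i) (z j) / (z i - z j)) := by ring
    rw [e1, e2]
    abel

end BetheAnsatz

/-! ### The Bethe state as an eigenvector of the `τ₂`-model -/

section BetheState

variable {N : ℕ} [NeZero N] {L : ℕ} {ω : ℂ}

theorem siteHom_mulVec_refState (i : Fin L) (O : SiteOp N) (c : ℂ)
    (hO : ∀ a, O a 0 = if a = 0 then c else 0) :
    (siteHom i O).mulVec refState = c • refState := by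
  funext σ
  rw [refState, Matrix.mulVec_single_one, Matrix.col_apply, siteHom_apply]
  simp only [atSite, Matrix.of_apply, Pi.zero_apply, hO, Pi.smul_apply, Pi.single_apply,
    smul_eq_mul, mul_ite, mul_one, mul_zero]
  by_cases h : σ = 0
  · simp [h]
  · rw [if_neg h]
    split_ifs with h1 h2
    · exact absurd (funext fun j => if hj : j = i then hj ▸ h2 else h1 j hj) h
    · rfl
    · rfl

/-- The reference state is a highest weight vector: it is annihilated by `C(u)` and an eigenvector
of `A(u)` and `D(u)`. -/
theorem tauMon_mulVec_refState (hω : ω ^ N = 1) (p : Fin L → Rapidity) (u : ℂ) :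
    (tauMon N ω p u 1 0).mulVec refState = 0 ∧
      (tauMon N ω p u 0 0).mulVec refState = aFun p u • refState ∧
      (tauMon N ω p u 1 1).mulVec refState = dFun ω p u • refState := by
  have h1 := chi_one (N := N) hω
  have hA : ∀ i, (siteHom i (locL ω (p i).x (p i).y u 0 0 : SiteOp N)).mulVec refState =
      (1 - (p i).t * u) • (refState : (Fin L → ZMod N) → ℂ) := fun i =>
    siteHom_mulVec_refState i _ _ fun a => by
      by_cases h : a = 0 <;> simp [locL, wshift, h, chi_zero, Rapidity.t]
  have hD : ∀ i, (siteHom i (locL ω (p i).x (p i).y u 1 1 : SiteOp N)).mulVec refState =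
      (1 - (p i).t * u * ω) • (refState : (Fin L → ZMod N) → ℂ) := fun i =>
    siteHom_mulVec_refState i _ _ fun a => by
      by_cases h : a = 0 <;> simp [locL, wshift, h, chi_zero, Rapidity.t]
  have hC : ∀ i, (siteHom i (locL ω (p i).x (p i).y u 1 0 : SiteOp N)).mulVec refState =
      (0 : (Fin L → ZMod N) → ℂ) := fun i => by
    rw [siteHom_mulVec_refState i _ 0 fun a => ?_, zero_smul]
    by_cases h : a = -1
    · simp [locL, wshift, h, chi_neg hω, h1,
        mul_inv_cancel₀ (h1 ▸ chi_ne_zero hω (1 : ZMod N) : ω ≠ 0)]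
    · simp [locL, wshift, h]
  rw [tauMon, glob_eq_prod_map]
  have ha : aFun p u = ((List.finRange L).map fun i => (1 - (p i).t * u)).prod := by
    rw [aFun, ← List.prod_ofFn, List.ofFn_eq_map]
  have hd : dFun ω p u = ((List.finRange L).map fun i => (1 - (p i).t * u * ω)).prod := by
    rw [dFun, ← List.prod_ofFn, List.ofFn_eq_map]
  rw [ha, hd]
  generalize hl' : List.finRange L = l
  have hl : l.Nodup := hl' ▸ List.nodup_finRange L
  clear hl' ha hd
  induction l with
  | nil => simp
  | cons i l ih =>
    rw [List.nodup_cons] at hl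
    obtain ⟨ih0, iha, ihd⟩ := ih hl.2
    simp only [List.map_cons, List.prod_cons, Matrix.mul_apply (n := Fin 2), Fin.sum_univ_two,
      Matrix.add_mulVec, Matrix.map_apply, ← Matrix.mulVec_mulVec, ih0, iha, ihd,
      Matrix.mulVec_smul, Matrix.mulVec_zero, hA, hC, hD, smul_zero, add_zero, smul_smul]
    refine ⟨trivial, by rw [mul_comm], ?_⟩
    rw [Matrix.mulVec_mulVec, (commute_prod_map_apply _ l hl.1 _ _ _).eq, ← Matrix.mulVec_mulVec,
      hC, Matrix.mulVec_zero, zero_add, mul_comm]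

/-- The eigenvalue of `A(u) + D(u)` on the Bethe state. -/
def tauEig (ω : ℂ) (p : Fin L → Rapidity) {R : ℕ} (z : Fin R → ℂ) (u : ℂ) : ℂ :=
  aFun p u * ∏ j, (u - ω * z j) / (u - z j) + dFun ω p u * ∏ j, (ω * u - z j) / (u - z j)

/-- The operator `∏_{i ∈ S} B(z_i)`. -/
def creationProd (hω : ω ^ N = 1) (p : Fin L → Rapidity) {R : ℕ} (z : Fin R → ℂ)
    (S : Finset (Fin R)) : ChainOp N L :=
  S.noncommProd (fun i => tauMon N ω p (z i) 0 1) fun i _ j _ _ => tauMon_B_comm hω p (z i) (z j)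

theorem creationProd_insert (hω : ω ^ N = 1) (p : Fin L → Rapidity) {R : ℕ} (z : Fin R → ℂ)
    (i : Fin R) (S : Finset (Fin R)) (hi : i ∉ S) :
    creationProd (N := N) hω p z (insert i S) =
      tauMon N ω p (z i) 0 1 * creationProd hω p z S :=
  Finset.noncommProd_insert_of_notMem _ _ _ _ hi

theorem creationProd_empty (hω : ω ^ N = 1) (p : Fin L → Rapidity) {R : ℕ} (z : Fin R → ℂ) :
    creationProd (N := N) hω p z ∅ = 1 :=
  Finset.noncommProd_empty _ _

/-- The state `∏_{i ∈ S} B(z_i) |0⟩`. -/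
def subState (hω : ω ^ N = 1) (p : Fin L → Rapidity) {R : ℕ} (z : Fin R → ℂ) (S : Finset (Fin R)) :
    (Fin L → ZMod N) → ℂ :=
  (creationProd hω p z S).mulVec refState

theorem betheState_eq (hω : ω ^ N = 1) (p : Fin L → Rapidity) (hp : ∀ i, (p i).mu ≠ 0)
    {R : ℕ} (z : Fin R → ℂ) : betheState (N := N) ω p z = subState hω p z Finset.univ := by
  rw [betheState, subState]
  congr 1
  simp only [opB, monodromyTau_eq hω p hp, List.ofFn_eq_map]
  refine (Multiset.noncommProd_coe (α := ChainOp N L)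
    ((List.finRange R).map fun i => tauMon N ω p (z i) 0 1) ?_).symm
  intro x hx y hy _
  obtain ⟨i, _, rfl⟩ := List.mem_map.mp hx
  obtain ⟨j, _, rfl⟩ := List.mem_map.mp hy
  exact tauMon_B_comm hω p (z i) (z j)

theorem subState_insert (hω : ω ^ N = 1) (p : Fin L → Rapidity) {R : ℕ} (z : Fin R → ℂ)
    (i : Fin R) (S : Finset (Fin R)) (hi : i ∉ S) :
    subState (N := N) hω p z (insert i S) =
      (tauMon N ω p (z i) 0 1).mulVec (subState hω p z S) := by
  rw [subState, subState, creationProd_insert hω p z i S hi, Matrix.mulVec_mulVec]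

/-- The Bethe state of a regular solution of the Bethe equations is an eigenvector of the transfer
matrix of the `τ₂`-model. -/
theorem tau_mulVec_betheState (hω : IsPrimitiveRoot ω N) (p : Fin L → Rapidity)
    (hp : ∀ i, (p i).mu ≠ 0) {R : ℕ} (z : Fin R → ℂ) (hz : IsRegularBetheSolution ω p z) (u : ℂ)
    (hu : ∀ i, u ≠ z i) :
    (tauMon N ω p u 0 0 + tauMon N ω p u 1 1).mulVec (betheState ω p z) =
      tauEig ω p z u • betheState ω p z := by
  have h1 := hω.pow_eq_one
  have hω0 : ω ≠ 0 := hω.ne_zero (NeZero.ne N)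
  have hB : ∀ (u w : ℂ) (v : (Fin L → ZMod N) → ℂ),
      (tauMon N ω p u 0 1).mulVecLin ((tauMon N ω p w 0 1).mulVecLin v) =
        (tauMon N ω p w 0 1).mulVecLin ((tauMon N ω p u 0 1).mulVecLin v) := by
    intro u w v
    simp only [Matrix.mulVecLin_apply, Matrix.mulVec_mulVec, (tauMon_B_comm h1 p u w).eq]
  have hvac : ∀ a, (tauMon N ω p a 0 0).mulVecLin (subState h1 p z ∅) =
      aFun p a • subState h1 p z ∅ := by
    intro a
    simp only [subState, creationProd_empty, Matrix.one_mulVec, Matrix.mulVecLin_apply]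
    exact (tauMon_mulVec_refState h1 p a).2.1
  have hvac' : ∀ a, (tauMon N ω p a 1 1).mulVecLin (subState h1 p z ∅) =
      dFun ω p a • subState h1 p z ∅ := by
    intro a
    simp only [subState, creationProd_empty, Matrix.one_mulVec, Matrix.mulVecLin_apply]
    exact (tauMon_mulVec_refState h1 p a).2.2
  have hΨ := fun i S hi => subState_insert (N := N) h1 p z i S hi
  have hA := exchange_offshell (fun u => (tauMon N ω p u 0 0).mulVecLin)
    (fun u => (tauMon N ω p u 0 1).mulVecLin) (aFun p) (fun u w => u - ω * w)
    (fun w => -((1 - ω) * w))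
    (fun u w v => by
      simp only [Matrix.mulVecLin_apply, Matrix.mulVec_mulVec, ← Matrix.smul_mulVec,
        ← Matrix.add_mulVec, tauMon_A_mul_B h1])
    (fun u i k => by ring) hB z hz.injective _ hvac hΨ Finset.univ u fun i _ => hu i
  have hD := exchange_offshell (fun u => (tauMon N ω p u 1 1).mulVecLin)
    (fun u => (tauMon N ω p u 0 1).mulVecLin) (dFun ω p) (fun u w => ω * u - w)
    (fun w => (1 - ω) * w)
    (fun u w v => by
      simp only [Matrix.mulVecLin_apply, Matrix.mulVec_mulVec, ← Matrix.smul_mulVec,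
        ← Matrix.add_mulVec, tauMon_D_mul_B h1])
    (fun u i k => by ring) hB z hz.injective _ hvac' hΨ Finset.univ u fun i _ => hu i
  simp only [Matrix.mulVecLin_apply] at hA hD
  rw [betheState_eq h1 p hp, Matrix.add_mulVec, hA, hD, add_add_add_comm, ← add_smul,
    ← Finset.sum_add_distrib, Finset.sum_eq_zero, add_zero, tauEig]
  intro k _
  rw [← add_smul]
  -- the coefficient of the `k`-th unwanted term vanishes by the `k`-th Bethe equation
  have e1 : ∏ j ∈ Finset.univ.erase k, (z k - ω * z j) / (z k - z j) =
      ω ^ (Finset.univ.erase k).card * ∏ j ∈ Finset.univ.erase k, fFun ω (z k / z j) := by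
    rw [← Finset.prod_const, ← Finset.prod_mul_distrib]
    refine Finset.prod_congr rfl fun j hj => ?_
    have h2 := hz.ne_zero j
    have h3 : z k - z j ≠ 0 :=
      sub_ne_zero.mpr fun h => Finset.ne_of_mem_erase hj (hz.injective h).symm
    have h4 : z k / z j - 1 ≠ 0 := by
      rwa [div_sub_one h2, ne_eq, div_eq_zero_iff, not_or, and_iff_left h2]
    rw [fFun]
    field_simp
  have e2 : ∏ j ∈ Finset.univ.erase k, (ω * z k - z j) / (z k - z j) =
      ω ^ (Finset.univ.erase k).card * ∏ j ∈ Finset.univ.erase k, fFun ω (z j / z k) := by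
    rw [← Finset.prod_const, ← Finset.prod_mul_distrib]
    refine Finset.prod_congr rfl fun j hj => ?_
    have h2 := hz.ne_zero k
    have h3 : z j - z k ≠ 0 :=
      sub_ne_zero.mpr fun h => Finset.ne_of_mem_erase hj (hz.injective h)
    have h4 : z j / z k - 1 ≠ 0 := by
      rwa [div_sub_one h2, ne_eq, div_eq_zero_iff, not_or, and_iff_left h2]
    have h5 : z k - z j ≠ 0 := by rwa [← neg_sub, neg_ne_zero] at h3
    rw [fFun]
    field_simp
    ring
  rw [e1, e2]
  have hb := hz.bethe k
  convert zero_smul ℂ _ using 2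
  linear_combination (-((1 - ω) * z k)) / (u - z k) * ω ^ (Finset.univ.erase k).card * hb

/-- A monodromy matrix with one-dimensional auxiliary space. -/
theorem glob_unit_wshift (g : Fin L → ZMod N → ℂ) :
    glob (m := Unit) (fun i => Matrix.of fun _ _ => wshift 0 (g i)) () () =
      Matrix.diagonal fun σ : Fin L → ZMod N => ∏ i, g i (σ i) := by
  have h : ∀ i, siteHom i (wshift 0 (g i)) =
      Matrix.diagonal fun σ : Fin L → ZMod N => g i (σ i) := by
    intro i
    ext σ' σ
    rw [siteHom_apply, Matrix.diagonal_apply]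
    simp only [atSite, wshift, Matrix.of_apply, add_zero]
    by_cases h : σ' = σ
    · simp [h]
    · rw [if_neg h]
      split_ifs with h1 h2
      · exact absurd (funext fun j => if hj : j = i then hj ▸ h2 else h1 j hj) h
      · rfl
      · rfl
  have e : (fun σ : Fin L → ZMod N => ∏ i, g i (σ i)) =
      fun σ => ((List.finRange L).map fun i => g i (σ i)).prod := by
    funext σ
    rw [← List.prod_ofFn, List.ofFn_eq_map]
  rw [glob_eq_prod_map, e]
  induction List.finRange L with
  | nil => simp
  | cons i l ih =>
    rw [List.map_cons, List.prod_cons, Matrix.mul_apply, Fintype.sum_unique, PUnit.default_eq_unit, ih,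
      Matrix.map_apply, Matrix.of_apply, h, Matrix.diagonal_mul_diagonal]
    simp

/-- The charge operator `Z₁ ⋯ Z_L`. -/
def chargeOp (N L : ℕ) [NeZero N] (ω : ℂ) : ChainOp N L :=
  Matrix.diagonal fun σ => ∏ i, chi ω (σ i)

theorem chargeOp_eq (ω : ℂ) : chargeOp N L ω =
    glob (m := Unit) (fun _ => Matrix.of fun _ _ => wshift 0 (chi ω)) () () :=
  (glob_unit_wshift fun _ => chi ω).symm

/-- Each `B(u)` raises the charge by one: conjugation by `Z` acts on the local `L`-operator like
conjugation by the matrix `diag(ω, 1)` of scalars. -/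
theorem chargeOp_mul_B (hω : ω ^ N = 1) (p : Fin L → Rapidity) (u : ℂ) :
    chargeOp N L ω * tauMon N ω p u 0 1 = ω • (tauMon N ω p u 0 1 * chargeOp N L ω) := by
  have hω0 : ω ≠ 0 := by
    rw [← chi_one (N := N) hω]
    exact chi_ne_zero hω _
  let Zm : Matrix Unit Unit (SiteOp N) := Matrix.of fun _ _ => wshift 0 (chi ω)
  let ι : Matrix (Unit × Fin 2) (Unit × Fin 2) ℂ :=
    Matrix.diagonal fun a => if a.2 = 0 then ω else 1
  have hl : ∀ i, tens Zm (locL ω (p i).x (p i).y u) * scal (SiteOp N) ι =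
      scal (SiteOp N) ι * (tens (locL ω (p i).x (p i).y u) Zm).submatrix Prod.swap Prod.swap := by
    intro i
    ext a b : 1
    obtain ⟨⟨⟩, a⟩ := a
    obtain ⟨⟨⟩, b⟩ := b
    simp only [ι, scal, Matrix.diagonal_map (map_zero _), Matrix.mul_diagonal,
      Matrix.diagonal_mul, Matrix.submatrix_apply, tens_apply, Prod.swap, ← Algebra.commutes,
      ← Algebra.smul_def, Zm, Matrix.of_apply]
    fin_cases a <;> fin_cases b <;>
      simp only [locL, Matrix.of_apply, Matrix.cons_val', Matrix.cons_val_zero, Matrix.cons_val_one,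
        Matrix.cons_val_fin_one, Fin.zero_eta, Fin.mk_one, Fin.isValue, wshift_mul, smul_wshift,
        if_true, one_ne_zero, if_false] <;>
      (refine wshift_congr (by ring) fun σ => ?_) <;>
      simp only [sub_zero, sub_neg_eq_add, chi_add hω, chi_sub hω, chi_one hω] <;> field_simp
  have h := glob_mul_scal (L := L) _ _ ι hl
  have e := glob_reindex (Equiv.prodComm (Fin 2) Unit)
    fun i : Fin L => tens (locL ω (p i).x (p i).y u : Matrix _ _ (SiteOp N)) Zm
  rw [glob_tens] at e
  have h' : tens (glob (L := L) fun _ => Zm) (tauMon N ω p u) * scal (ChainOp N L) ι =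
      scal (ChainOp N L) ι *
        (tens (tauMon N ω p u) (glob fun _ => Zm)).submatrix Prod.swap Prod.swap := by
    rw [glob_tens] at h
    exact e ▸ h
  have h'' := congrFun₂ h' ((), 0) ((), 1)
  simp only [ι, scal, Matrix.diagonal_map (map_zero _), Matrix.mul_diagonal,
      Matrix.diagonal_mul, Matrix.submatrix_apply, tens_apply, Prod.swap, ← Algebra.commutes,
      ← Algebra.smul_def, if_true, one_ne_zero, if_false, one_smul] at h''
  rw [chargeOp_eq]
  exact h''

theorem chargeOp_mulVec_betheState (hω : ω ^ N = 1) (p : Fin L → Rapidity)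
    (hp : ∀ i, (p i).mu ≠ 0) {R : ℕ} (z : Fin R → ℂ) :
    (chargeOp N L ω).mulVec (betheState ω p z) = ω ^ R • betheState ω p z := by
  suffices h : ∀ S : Finset (Fin R), (chargeOp N L ω).mulVec (subState hω p z S) =
      ω ^ S.card • subState hω p z S by
    simpa [betheState_eq hω p hp] using h Finset.univ
  intro S
  induction S using Finset.induction_on with
  | empty =>
    funext σ
    simp only [subState, creationProd_empty, Matrix.one_mulVec, chargeOp, Matrix.mulVec_diagonal,
      refState, Finset.card_empty, pow_zero, one_smul]
    by_cases h : σ = 0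
    · simp [h, chi_zero]
    · simp [h]
  | insert i S hi ih =>
    rw [subState_insert hω p z i S hi, Matrix.mulVec_mulVec, chargeOp_mul_B hω, Matrix.smul_mulVec,
      ← Matrix.mulVec_mulVec, ih, Matrix.mulVec_smul, smul_smul, Finset.card_insert_of_notMem hi,
      pow_succ']

end BetheState

/-! ### The local `S`-operator -/

section LocalS

variable {N : ℕ} [NeZero N] {ω : ℂ}

theorem sum_zmod_eq_sum_range {M : Type*} [AddCommMonoid M] (f : ZMod N → M) :
    ∑ a, f a = ∑ j ∈ Finset.range N, f j := by
  refine Finset.sum_nbij' ZMod.val (fun j => (j : ZMod N)) ?_ ?_ ?_ ?_ ?_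
  · intro a _
    exact Finset.mem_range.mpr (ZMod.val_lt a)
  · intro j _
    exact Finset.mem_univ _
  · intro a _
    exact ZMod.natCast_rightInverse a
  · intro j hj
    exact ZMod.val_cast_of_lt (Finset.mem_range.mp hj)
  · intro a _
    rw [ZMod.natCast_rightInverse a]

/-- The Fourier transform on `ℤ/N`, at the frequency `σ + 1`. -/
def dft (ω : ℂ) (f : ZMod N → ℂ) (σ : ZMod N) : ℂ := ∑ m, chi ω (m * (σ + 1)) * f m

theorem chi_mul_dft (hω : ω ^ N = 1) (f : ZMod N → ℂ) (σ : ZMod N) :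
    chi ω (σ + 1) * dft ω f σ = dft ω (fun m => f (m - 1)) σ := by
  rw [dft, dft, Finset.mul_sum,
    ← Equiv.sum_comp (Equiv.addRight (1 : ZMod N)) fun m => chi ω (m * (σ + 1)) * f (m - 1)]
  refine Finset.sum_congr rfl fun m _ => ?_
  simp only [Equiv.coe_addRight, add_sub_cancel_right, add_mul, one_mul, chi_add hω]
  ring

theorem dft_add_one (hω : ω ^ N = 1) (f : ZMod N → ℂ) (σ : ZMod N) :
    dft ω f (σ + 1) = dft ω (fun m => chi ω m * f m) σ := by
  refine Finset.sum_congr rfl fun m _ => ?_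
  rw [mul_add m, mul_one, chi_add hω]
  ring

theorem dft_add (f g : ZMod N → ℂ) (σ : ZMod N) :
    dft ω f σ + dft ω g σ = dft ω (fun m => f m + g m) σ := by
  simp only [dft, mul_add, Finset.sum_add_distrib]

theorem mul_dft (c : ℂ) (f : ZMod N → ℂ) (σ : ZMod N) :
    c * dft ω f σ = dft ω (fun m => c * f m) σ := by
  rw [dft, dft, Finset.mul_sum]
  exact Finset.sum_congr rfl fun m _ => by ring

/-- The polynomial `∏_{j=1}^e (c - b ω^j u) ∏_{j=e+1}^{N-1} (a - d ω^j u)`: with `u = ω^m`, it is up to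
elementary factors the product of the weights `W(m + e)` and `W̄(m)`, free of denominators. -/
def pairFun (N : ℕ) (ω a b c d : ℂ) (e : ℕ) (u : ℂ) : ℂ :=
  (∏ j ∈ Finset.range e, (c - b * ω ^ (j + 1) * u)) *
    ∏ j ∈ Finset.Ico (e + 1) N, (a - d * ω ^ j * u)

/-- The replacement of `c` by `c ω` shifts the first product in `pairFun` by one factor. -/
theorem pairFun_shift_param (a b c d : ℂ) (e : ℕ) (u : ℂ) :
    ω ^ e * (pairFun N ω a b c d e u * (c - b * u)) =
      pairFun N ω a b (c * ω) d e u * (c - b * ω ^ e * u) := by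
  have h : ∏ j ∈ Finset.range e, (c * ω - b * ω ^ (j + 1) * u) =
      ω ^ e * ∏ j ∈ Finset.range e, (c - b * ω ^ j * u) := by
    rw [show ω ^ e = ∏ _j ∈ Finset.range e, ω by simp, ← Finset.prod_mul_distrib]
    exact Finset.prod_congr rfl fun j _ => by ring
  have h1 := Finset.prod_range_succ (fun j => c - b * ω ^ j * u) e
  rw [Finset.prod_range_succ'] at h1
  rw [pairFun, pairFun, h]
  simp only [pow_zero, mul_one] at h1
  linear_combination ω ^ e * (∏ j ∈ Finset.Ico (e + 1) N, (a - d * ω ^ j * u)) * h1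

/-- The replacement of `c` by `c ω` and of `u` by `ω u` shifts the second product in `pairFun` by one
factor. -/
theorem pairFun_shift_both (hω : ω ^ N = 1) (a b c d : ℂ) {e : ℕ} (he : e < N) (u : ℂ) :
    ω ^ e * (pairFun N ω a b c d e u * (a - d * u)) =
      pairFun N ω a b (c * ω) d e (ω * u) * (a - d * ω ^ e * (ω * u)) := by
  have h : ∏ j ∈ Finset.range e, (c * ω - b * ω ^ (j + 1) * (ω * u)) =
      ω ^ e * ∏ j ∈ Finset.range e, (c - b * ω ^ (j + 1) * u) := by
    rw [show ω ^ e = ∏ _j ∈ Finset.range e, ω by simp, ← Finset.prod_mul_distrib]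
    exact Finset.prod_congr rfl fun j _ => by ring
  have h1 := Finset.prod_Ico_succ_top (show e + 1 ≤ N from he) fun j => a - d * ω ^ j * u
  rw [Finset.prod_eq_prod_Ico_succ_bot (show e + 1 < N + 1 by omega),
    ← Finset.prod_Ico_add' _ (e + 1) N 1, hω] at h1
  have h2 : ∏ j ∈ Finset.Ico (e + 1) N, (a - d * ω ^ (j + 1) * u) =
      ∏ j ∈ Finset.Ico (e + 1) N, (a - d * ω ^ j * (ω * u)) :=
    Finset.prod_congr rfl fun j _ => by ring
  rw [h2] at h1
  rw [pairFun, pairFun, h]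
  linear_combination (-ω ^ e * ∏ j ∈ Finset.range e, (c - b * ω ^ (j + 1) * u)) * h1

/-- The Fourier transform of `pairFun` on the group of `N`-th roots of unity. -/
def pairDft (ω a b c d : ℂ) (e : ℕ) (σ : ZMod N) : ℂ :=
  dft ω (fun m => pairFun N ω a b c d e (chi ω m)) σ

/-! Each of the next four relations between `pairDft` at `c` and at `c ω` is the Fourier transform of a
linear combination of `pairFun_shift_param` and `pairFun_shift_both`; the coefficients in them are
essentially the entries of the local `L`-operator. -/

variable (x y X Y c : ℂ)

theorem pairDft_rel₁ (hω : ω ^ N = 1) (hY : Y ≠ 0) (hc : c ≠ 0) {e : ℕ} (he : e < N)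
    (σ : ZMod N) :
    Y * ((chi ω (σ + 1) - x * y * (c * Y)⁻¹) * pairDft ω y x c Y e (σ + 1)) +
        y * ((1 - chi ω (σ + 1)) * pairDft ω y x c Y e σ) =
      Y * ((1 - x * y * (c * Y)⁻¹) * pairDft ω y x (c * ω) Y e (σ + 1)) := by
  have hω0 : ω ^ e ≠ 0 := by
    rw [← chi_natCast (N := N) hω]
    exact chi_ne_zero hω _
  have e1 : Y * ((chi ω (σ + 1) - x * y * (c * Y)⁻¹) * pairDft ω y x c Y e (σ + 1)) +
        y * ((1 - chi ω (σ + 1)) * pairDft ω y x c Y e σ) =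
      Y * (chi ω (σ + 1) * pairDft ω y x c Y e (σ + 1)) + -(Y * (x * y * (c * Y)⁻¹)) *
        pairDft ω y x c Y e (σ + 1) + y * pairDft ω y x c Y e σ +
          -y * (chi ω (σ + 1) * pairDft ω y x c Y e σ) := by ring
  rw [e1]
  simp only [pairDft, dft_add_one hω, chi_mul_dft hω, mul_dft, dft_add]
  congr 1
  funext m
  obtain ⟨m, rfl⟩ : ∃ m', m = m' + 1 := ⟨m - 1, by ring⟩
  simp only [add_sub_cancel_right, chi_add hω, chi_one hω, mul_comm _ ω]
  have h1 := pairFun_shift_param (N := N) (ω := ω) y x c Y e (ω * chi ω m)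
  have h2 := pairFun_shift_both hω y x c Y he (chi ω m)
  rw [mul_comm c ω] at h1 h2
  generalize pairFun N ω y x (ω * c) Y e (ω * chi ω m) = Q₁ at h1 h2 ⊢
  generalize pairFun N ω y x c Y e (ω * chi ω m) = Q₂ at h1 h2 ⊢
  generalize pairFun N ω y x c Y e (chi ω m) = Q₃ at h1 h2 ⊢
  field_simp
  refine mul_left_cancel₀ hω0 ?_
  linear_combination y * h1 - c * h2

theorem pairDft_rel₂ (hω : ω ^ N = 1) (hY : Y ≠ 0) (hc : c ≠ 0) {e : ℕ} (he : e < N)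
    (σ : ZMod N) :
    ω ^ e * ((1 - x * y * (c * Y)⁻¹ * chi ω (σ + 1)) * pairDft ω y x c Y e σ -
        c⁻¹ * x * ((1 - chi ω (σ + 1)) * pairDft ω y x c Y e (σ + 1))) =
      (1 - x * y * (c * Y)⁻¹) * pairDft ω y x (c * ω) Y e σ := by
  have e1 : ω ^ e * ((1 - x * y * (c * Y)⁻¹ * chi ω (σ + 1)) * pairDft ω y x c Y e σ -
        c⁻¹ * x * ((1 - chi ω (σ + 1)) * pairDft ω y x c Y e (σ + 1))) =
      ω ^ e * pairDft ω y x c Y e σ + -(ω ^ e * (x * y * (c * Y)⁻¹)) *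
        (chi ω (σ + 1) * pairDft ω y x c Y e σ) + -(ω ^ e * (c⁻¹ * x)) *
          pairDft ω y x c Y e (σ + 1) + ω ^ e * (c⁻¹ * x) *
            (chi ω (σ + 1) * pairDft ω y x c Y e (σ + 1)) := by ring
  rw [e1]
  simp only [pairDft, dft_add_one hω, chi_mul_dft hω, mul_dft, dft_add]
  congr 1
  funext m
  obtain ⟨m, rfl⟩ : ∃ m', m = m' + 1 := ⟨m - 1, by ring⟩
  simp only [add_sub_cancel_right, chi_add hω, chi_one hω, mul_comm _ ω]
  have h1 := pairFun_shift_param (N := N) (ω := ω) y x c Y e (ω * chi ω m)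
  have h2 := pairFun_shift_both hω y x c Y he (chi ω m)
  rw [mul_comm c ω] at h1 h2
  field_simp
  linear_combination Y * h1 - x * h2

theorem pairDft_rel₃ (hω : ω ^ N = 1) (hY : Y ≠ 0) (hc : c ≠ 0) {e : ℕ} (he : e < N)
    (σ : ZMod N) :
    (chi ω (σ + 1) - x * y * (c * Y)⁻¹) * pairDft ω y x (c * ω) Y e σ +
        c⁻¹ * x * ω ^ e * ((1 - chi ω (σ + 1)) * pairDft ω y x (c * ω) Y e (σ + 1)) =
      (1 - x * y * (c * Y)⁻¹) * ω ^ e * (chi ω (σ + 1) * pairDft ω y x c Y e σ) := by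
  have e1 : (chi ω (σ + 1) - x * y * (c * Y)⁻¹) * pairDft ω y x (c * ω) Y e σ +
        c⁻¹ * x * ω ^ e * ((1 - chi ω (σ + 1)) * pairDft ω y x (c * ω) Y e (σ + 1)) =
      chi ω (σ + 1) * pairDft ω y x (c * ω) Y e σ + -(x * y * (c * Y)⁻¹) *
        pairDft ω y x (c * ω) Y e σ + c⁻¹ * x * ω ^ e * pairDft ω y x (c * ω) Y e (σ + 1) +
          -(c⁻¹ * x * ω ^ e) * (chi ω (σ + 1) * pairDft ω y x (c * ω) Y e (σ + 1)) := by ring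
  rw [e1]
  simp only [pairDft, dft_add_one hω, chi_mul_dft hω, mul_dft, dft_add]
  congr 1
  funext m
  obtain ⟨m, rfl⟩ : ∃ m', m = m' + 1 := ⟨m - 1, by ring⟩
  simp only [add_sub_cancel_right, chi_add hω, chi_one hω, mul_comm _ ω]
  have h1 := pairFun_shift_param (N := N) (ω := ω) y x c Y e (chi ω m)
  have h2 := pairFun_shift_both hω y x c Y he (chi ω m)
  rw [mul_comm c ω] at h1 h2
  field_simp
  linear_combination x * h2 - Y * h1

theorem pairDft_rel₄ (hω : ω ^ N = 1) (hY : Y ≠ 0) (hc : c ≠ 0) {e : ℕ} (he : e < N)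
    (σ : ZMod N) :
    Y * ω ^ e * ((1 - x * y * (c * Y)⁻¹ * chi ω (σ + 1)) * pairDft ω y x (c * ω) Y e (σ + 1)) -
        y * ((1 - chi ω (σ + 1)) * pairDft ω y x (c * ω) Y e σ) =
      Y * ω ^ e * ((1 - x * y * (c * Y)⁻¹) *
        (chi ω (σ + 1) * pairDft ω y x c Y e (σ + 1))) := by
  have e1 : Y * ω ^ e * ((1 - x * y * (c * Y)⁻¹ * chi ω (σ + 1)) *
        pairDft ω y x (c * ω) Y e (σ + 1)) -
        y * ((1 - chi ω (σ + 1)) * pairDft ω y x (c * ω) Y e σ) =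
      Y * ω ^ e * pairDft ω y x (c * ω) Y e (σ + 1) + -(Y * ω ^ e * (x * y * (c * Y)⁻¹)) *
        (chi ω (σ + 1) * pairDft ω y x (c * ω) Y e (σ + 1)) +
          -y * pairDft ω y x (c * ω) Y e σ +
            y * (chi ω (σ + 1) * pairDft ω y x (c * ω) Y e σ) := by ring
  rw [e1]
  simp only [pairDft, dft_add_one hω, chi_mul_dft hω, mul_dft, dft_add]
  congr 1
  funext m
  obtain ⟨m, rfl⟩ : ∃ m', m = m' + 1 := ⟨m - 1, by ring⟩
  simp only [add_sub_cancel_right, chi_add hω, chi_one hω, mul_comm _ ω]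
  have h1 := pairFun_shift_param (N := N) (ω := ω) y x c Y e (chi ω m)
  have h2 := pairFun_shift_both hω y x c Y he (chi ω m)
  rw [mul_comm c ω] at h1 h2
  field_simp
  linear_combination c * h2 - y * h1

/-- The `S`-operator of the superintegrable model, up to a scalar factor, as a matrix of operators on
the site. It depends on `p` and `q` through `x = x_p`, `y = y_p`, `X = x_q`, `Y = y_q` and on
`c = x_q ω^s`. -/
def sHat (N : ℕ) [NeZero N] (ω x y X Y c : ℂ) : Matrix (ZMod N) (ZMod N) (SiteOp N) :=
  Matrix.of fun τ' τ => wshift (τ - τ') fun σ => ∑ e ∈ Finset.range N,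
    chi ω (σ - τ) ^ e * (pairDft ω x y Y X e (σ + τ' - τ) * pairDft ω y x c Y e σ)

/-- The columns of this matrix, for `c = x_q ω^s`, are vectors in the tensor product of the two
auxiliary spaces that are annihilated by the degenerate matrix `𝓛(z; q, q̄(s))`,
`z = (t_q ω^s)⁻¹`. -/
def fuseIn (N : ℕ) (c : ℂ) : Matrix (Fin 2 × ZMod N) (ZMod N) ℂ :=
  Matrix.of fun a τ => if a.1 = 0 then (if a.2 = τ + 1 then -c⁻¹ else 0)
    else if a.2 = τ then 1 else 0

/-- The projection along the columns of `fuseIn`. -/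
def fuseOut (N : ℕ) (c : ℂ) : Matrix (ZMod N) (Fin 2 × ZMod N) ℂ :=
  Matrix.of fun τ a => if a.1 = 0 then (if a.2 = τ then 1 else 0)
    else if a.2 + 1 = τ then c⁻¹ else 0

theorem mul_fuseIn_apply {R : Type*} [Semiring R] [Algebra ℂ R] {n : Type*}
    (M : Matrix n (Fin 2 × ZMod N) R) (a : n) (τ : ZMod N) :
    (M * scal R (fuseIn N c)) a τ = (-c⁻¹) • M a (0, τ + 1) + M a (1, τ) := by
  simp [Matrix.mul_apply, Fintype.sum_prod_type, fuseIn, apply_ite (algebraMap ℂ R), ← Algebra.commutes,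
    ← Algebra.smul_def]

theorem fuseIn_mul_apply {R : Type*} [Semiring R] [Algebra ℂ R] {n : Type*}
    (M : Matrix (ZMod N) n R) (a : Fin 2 × ZMod N) (b : n) :
    (scal R (fuseIn N c) * M) a b = if a.1 = 0 then (-c⁻¹) • M (a.2 - 1) b else M a.2 b := by
  obtain ⟨a, τ⟩ := a
  have h : ∀ σ : ZMod N, τ = σ + 1 ↔ τ - 1 = σ := fun σ => sub_eq_iff_eq_add.symm
  fin_cases a <;> simp [Matrix.mul_apply, fuseIn, apply_ite (algebraMap ℂ R), ← Algebra.smul_def, h]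

theorem mul_fuseOut_apply {R : Type*} [Semiring R] [Algebra ℂ R] {n : Type*}
    (M : Matrix n (ZMod N) R) (a : n) (b : Fin 2 × ZMod N) :
    (M * scal R (fuseOut N c)) a b = if b.1 = 0 then M a b.2 else c⁻¹ • M a (b.2 + 1) := by
  obtain ⟨b, τ⟩ := b
  fin_cases b <;> simp [Matrix.mul_apply, fuseOut, apply_ite (algebraMap ℂ R), ← Algebra.commutes,
    ← Algebra.smul_def]

theorem fuseOut_mul_apply {R : Type*} [Semiring R] [Algebra ℂ R] {n : Type*}
    (M : Matrix (Fin 2 × ZMod N) n R) (τ : ZMod N) (b : n) :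
    (scal R (fuseOut N c) * M) τ b = M (0, τ) b + c⁻¹ • M (1, τ - 1) b := by
  have h : ∀ σ : ZMod N, σ + 1 = τ ↔ σ = τ - 1 := fun σ => eq_sub_iff_add_eq.symm
  simp [Matrix.mul_apply, Fintype.sum_prod_type, fuseOut, apply_ite (algebraMap ℂ R), ← Algebra.smul_def, h]

/-- The product of `𝓛` and `S` leaves the span of the columns of `fuseIn` invariant, and its
restriction is again an `S`-operator, with `c` replaced by `c ω`. -/
theorem locL_sHat_fuseIn (hω : ω ^ N = 1) (hY : Y ≠ 0) (hc : c ≠ 0) :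
    tens (locL ω x y (c * Y)⁻¹) (sHat N ω x y X Y c) * scal (SiteOp N) (fuseIn N c) =
      scal (SiteOp N) (fuseIn N c) * ((1 - x * y * (c * Y)⁻¹) •
        (sHat N ω x y X Y (c * ω)).submatrix (· + 1) (· + 1)) := by
  have hω0 : ω ≠ 0 := by
    rw [← chi_one (N := N) hω]
    exact chi_ne_zero hω _
  ext a τ : 1
  obtain ⟨a, τ'⟩ := a
  rw [mul_fuseIn_apply, fuseIn_mul_apply]
  simp only [tens_apply, Matrix.smul_apply, Matrix.submatrix_apply]
  fin_cases a <;>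
    simp only [locL, sHat, Matrix.of_apply, Matrix.cons_val', Matrix.cons_val_zero,
      Matrix.cons_val_one, Matrix.cons_val_fin_one, Fin.zero_eta, Fin.mk_one, Fin.isValue,
      wshift_mul, smul_wshift, if_true, one_ne_zero, if_false]
  · refine (congrArg₂ (· + ·) (wshift_congr (l := τ - τ' + 1) (by ring) fun _ => rfl)
      (wshift_congr (l := τ - τ' + 1) (by ring) fun _ => rfl)).trans ?_
    rw [wshift_add]
    refine wshift_congr (by ring) fun σ => ?_
    simp only [Finset.mul_sum, ← Finset.sum_add_distrib]
    refine Finset.sum_congr rfl fun e he => ?_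
    obtain ⟨ρ, rfl⟩ : ∃ ρ, σ = ρ + 1 := ⟨σ - 1, by ring⟩
    have h := pairDft_rel₁ x y Y c hω hY hc (Finset.mem_range.mp he) ρ
    rw [show ρ + 1 - 0 + τ' - (τ + 1) = ρ + τ' - τ by ring,
      show ρ + 1 - 0 - (τ + 1) = ρ - τ by ring, show ρ + 1 - 1 + τ' - τ = ρ + τ' - τ by ring,
      show ρ + 1 - 1 - τ = ρ - τ by ring, show ρ + 1 - 0 = ρ + 1 by ring,
      show ρ + 1 - 1 = ρ by ring, show ρ + 1 + (τ' - 1 + 1) - (τ + 1) = ρ + τ' - τ by ring,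
      show ρ + 1 - (τ + 1) = ρ - τ by ring, show c⁻¹ = Y * (c * Y)⁻¹ by field_simp]
    linear_combination (-(c * Y)⁻¹ * chi ω (ρ - τ) ^ e * pairDft ω x y Y X e (ρ + τ' - τ)) * h
  · refine (congrArg₂ (· + ·) (wshift_congr (l := τ - τ') (by ring) fun _ => rfl)
      (wshift_congr (l := τ - τ') (by ring) fun _ => rfl)).trans ?_
    rw [wshift_add]
    refine wshift_congr (by ring) fun σ => ?_
    simp only [Finset.mul_sum, ← Finset.sum_add_distrib]
    refine Finset.sum_congr rfl fun e he => ?_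
    have h := pairDft_rel₂ x y Y c hω hY hc (Finset.mem_range.mp he) σ
    rw [show σ - -1 + τ' - (τ + 1) = σ + τ' - τ by ring, show σ - -1 - (τ + 1) = σ - τ by ring,
      show σ - 0 + τ' - τ = σ + τ' - τ by ring, show σ - 0 = σ by ring,
      show σ - -1 = σ + 1 by ring, show σ + (τ' + 1) - (τ + 1) = σ + τ' - τ by ring,
      show σ - τ = σ - (τ + 1) + 1 by ring, chi_add hω (σ - (τ + 1)), chi_one hω]
    rw [chi_add hω σ, chi_one hω] at h
    linear_combination (chi ω (σ - (τ + 1)) ^ e * pairDft ω x y Y X e (σ + τ' - τ)) * h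

/-- On the quotient by the span of the columns of `fuseIn`, the product of `𝓛` and `S` is an
`S`-operator with `c ω` replaced by `c`, multiplied by `Z`. -/
theorem fuseOut_locL_sHat (hω : ω ^ N = 1) (hY : Y ≠ 0) (hc : c ≠ 0) :
    scal (SiteOp N) (fuseOut N (c * ω)) *
        tens (locL ω x y (c * ω * Y)⁻¹) (sHat N ω x y X Y (c * ω)) =
      ((1 - x * y * (c * Y)⁻¹) • (Matrix.of fun τ' τ => wshift 0 (chi ω) *
        sHat N ω x y X Y c (τ' - 1) (τ - 1))) * scal (SiteOp N) (fuseOut N (c * ω)) := by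
  have hω0 : ω ≠ 0 := by
    rw [← chi_one (N := N) hω]
    exact chi_ne_zero hω _
  ext τ' a : 1
  obtain ⟨a, τ⟩ := a
  rw [fuseOut_mul_apply, mul_fuseOut_apply]
  simp only [tens_apply, Matrix.smul_apply]
  fin_cases a <;>
    simp only [locL, sHat, Matrix.of_apply, Matrix.cons_val', Matrix.cons_val_zero,
      Matrix.cons_val_one, Matrix.cons_val_fin_one, Fin.zero_eta, Fin.mk_one, Fin.isValue,
      wshift_mul, smul_wshift, if_true, one_ne_zero, if_false]
  · refine (congrArg₂ (· + ·) (wshift_congr (l := τ - τ') (by ring) fun _ => rfl)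
      (wshift_congr (l := τ - τ') (by ring) fun _ => rfl)).trans ?_
    rw [wshift_add]
    refine wshift_congr (by ring) fun σ => ?_
    simp only [Finset.mul_sum, ← Finset.sum_add_distrib]
    refine Finset.sum_congr rfl fun e he => ?_
    have h := pairDft_rel₃ x y Y c hω hY hc (Finset.mem_range.mp he) σ
    rw [show σ - -1 + (τ' - 1) - τ = σ + τ' - τ by ring, show σ - -1 - τ = σ - τ + 1 by ring,
      show σ - 0 + τ' - τ = σ + τ' - τ by ring, show σ - 0 = σ by ring,
      show σ - -1 = σ + 1 by ring, show σ + (τ' - 1) - (τ - 1) = σ + τ' - τ by ring,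
      show σ - (τ - 1) = σ - τ + 1 by ring, chi_add hω (σ - τ), chi_one hω,
      show (c * ω * Y)⁻¹ = ω⁻¹ * (c * Y)⁻¹ by field_simp, mul_inv c ω]
    rw [chi_add hω σ, chi_one hω] at h
    have hi : ω⁻¹ * ω = 1 := inv_mul_cancel₀ hω0
    linear_combination (ω⁻¹ * chi ω (σ - τ) ^ e * pairDft ω x y Y X e (σ + τ' - τ)) * h -
      chi ω (σ - τ) ^ e * pairDft ω x y Y X e (σ + τ' - τ) * chi ω σ *
        (pairDft ω y x (c * ω) Y e σ -
          (1 - x * y * (c * Y)⁻¹) * ω ^ e * pairDft ω y x c Y e σ) * hi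
  · refine (congrArg₂ (· + ·) (wshift_congr (l := τ - τ' + 1) (by ring) fun _ => rfl)
      (wshift_congr (l := τ - τ' + 1) (by ring) fun _ => rfl)).trans ?_
    rw [wshift_add]
    refine wshift_congr (by ring) fun σ => ?_
    simp only [Finset.mul_sum, ← Finset.sum_add_distrib]
    refine Finset.sum_congr rfl fun e he => ?_
    obtain ⟨ρ, rfl⟩ : ∃ ρ, σ = ρ + 1 := ⟨σ - 1, by ring⟩
    have h := pairDft_rel₄ x y Y c hω hY hc (Finset.mem_range.mp he) ρ
    rw [show ρ + 1 - 1 + τ' - τ = ρ + τ' - τ by ring, show ρ + 1 - 1 - τ = ρ - τ by ring,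
      show ρ + 1 - 1 = ρ by ring, show ρ + 1 - 0 = ρ + 1 by ring,
      show ρ + 1 + (τ' - 1) - τ = ρ + τ' - τ by ring,
      show ρ + 1 + (τ' - 1) - (τ + 1 - 1) = ρ + τ' - τ by ring,
      show ρ + 1 - (τ + 1 - 1) = ρ - τ + 1 by ring, show ρ + 1 - τ = ρ - τ + 1 by ring,
      chi_add hω (ρ - τ), chi_one hω, show (c * ω * Y)⁻¹ = ω⁻¹ * (c * Y)⁻¹ by field_simp,
      show (c * ω)⁻¹ = ω⁻¹ * (Y * (c * Y)⁻¹) by field_simp]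
    have hi : x * y * (ω⁻¹ * (c * Y)⁻¹) * ω = x * y * (c * Y)⁻¹ := by field_simp
    rw [hi]
    linear_combination (ω⁻¹ * (c * Y)⁻¹ * chi ω (ρ - τ) ^ e *
      pairDft ω x y Y X e (ρ + τ' - τ)) * h

end LocalS

/-! ### Where the `S`-operator degenerates -/

section Telescope

variable {N : ℕ} [NeZero N] {ω : ℂ}

theorem prod_sub_mul_pow (hω : IsPrimitiveRoot ω N) (a b : ℂ) :
    ∏ j ∈ Finset.range N, (a - b * ω ^ j) = a ^ N - b ^ N := by
  have h := congrArg (Polynomial.eval a)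
    (X_pow_sub_C_eq_prod hω (NeZero.pos N) (rfl : b ^ N = b ^ N))
  rw [Polynomial.eval_prod] at h
  simp only [Polynomial.eval_sub, Polynomial.eval_pow, Polynomial.eval_X, Polynomial.eval_C] at h
  rw [h]
  exact Finset.prod_congr rfl fun j _ => by rw [mul_comm]

theorem prod_sub_mul_pow_succ (hω : IsPrimitiveRoot ω N) (a b : ℂ) :
    ∏ j ∈ Finset.range N, (a - b * ω ^ (j + 1)) = a ^ N - b ^ N := by
  have h := prod_sub_mul_pow hω a (b * ω)
  rw [mul_pow, hω.pow_eq_one, mul_one] at h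
  rw [← h]
  exact Finset.prod_congr rfl fun j _ => by ring

/-- After multiplication by `(x y - X Y) (1 - u w)`, the summand with index `e` is a difference
`H e - H (e + 1)` of products. -/
theorem sum_pairFun_telescope (hω : IsPrimitiveRoot ω N) (x y X Y u w : ℂ) :
    (∑ e ∈ Finset.range N, pairFun N ω x y Y X e ((ω ^ e)⁻¹ * u) *
        ((ω ^ e)⁻¹ * pairFun N ω y x (X * ω) Y e w)) * ((x * y - X * Y) * (1 - u * w)) =
      ((x * y) ^ N - (X * Y) ^ N) * (1 - (u * w) ^ N) := by
  have hω0 : ω ≠ 0 := hω.ne_zero (NeZero.ne N)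
  let H : ℕ → ℂ := fun e => (∏ j ∈ Finset.range e, (Y - y * ω⁻¹ ^ j * u)) *
    (∏ j ∈ Finset.range e, (X - x * ω ^ j * w)) *
    (∏ j ∈ Finset.range (N - e), (x - X * ω ^ (j + 1) * u)) *
    ∏ j ∈ Finset.Ico e N, (y - Y * ω ^ j * w)
  have hterm : ∀ e ∈ Finset.range N, pairFun N ω x y Y X e ((ω ^ e)⁻¹ * u) *
        ((ω ^ e)⁻¹ * pairFun N ω y x (X * ω) Y e w) * ((x * y - X * Y) * (1 - u * w)) =
      H e - H (e + 1) := by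
    intro e he
    have he' := Finset.mem_range.mp he
    have hωe : ω ^ e ≠ 0 := pow_ne_zero e hω0
    have p1 : ∏ j ∈ Finset.range e, (Y - y * ω ^ (j + 1) * ((ω ^ e)⁻¹ * u)) =
        ∏ j ∈ Finset.range e, (Y - y * ω⁻¹ ^ j * u) := by
      rw [← Finset.prod_range_reflect]
      refine Finset.prod_congr rfl fun j hj => ?_
      have : ω ^ e = ω ^ j * ω ^ (e - 1 - j + 1) := by
        rw [← pow_add]
        congr 1
        have := Finset.mem_range.mp hj
        omega
      rw [this, inv_pow]
      field_simp
    have p2 : ∏ j ∈ Finset.Ico (e + 1) N, (x - X * ω ^ j * ((ω ^ e)⁻¹ * u)) =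
        ∏ j ∈ Finset.range (N - (e + 1)), (x - X * ω ^ (j + 1) * u) := by
      rw [Finset.prod_Ico_eq_prod_range]
      refine Finset.prod_congr rfl fun j _ => ?_
      rw [show e + 1 + j = e + (j + 1) by ring, pow_add]
      field_simp
    have p3 : ∏ j ∈ Finset.range e, (X * ω - x * ω ^ (j + 1) * w) =
        ω ^ e * ∏ j ∈ Finset.range e, (X - x * ω ^ j * w) := by
      rw [show ω ^ e = ∏ _j ∈ Finset.range e, ω by simp, ← Finset.prod_mul_distrib]
      exact Finset.prod_congr rfl fun j _ => by ring
    have p4 : ∏ j ∈ Finset.range (N - e), (x - X * ω ^ (j + 1) * u) =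
        (∏ j ∈ Finset.range (N - (e + 1)), (x - X * ω ^ (j + 1) * u)) * (x - X * (ω ^ e)⁻¹ * u) := by
      have h1 : N - e = N - (e + 1) + 1 := by omega
      have h2 : ω ^ (N - e) = (ω ^ e)⁻¹ := by
        apply eq_inv_of_mul_eq_one_left
        rw [← pow_add, Nat.sub_add_cancel he'.le, hω.pow_eq_one]
      rw [h1, Finset.prod_range_succ, ← h1, h2]
    have p5 := Finset.prod_eq_prod_Ico_succ_bot he' fun j => y - Y * ω ^ j * w
    simp only [H]
    rw [Finset.prod_range_succ _ e, Finset.prod_range_succ _ e, p4, p5, pairFun, pairFun, p1, p2,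
      p3, inv_pow]
    field_simp
    ring_nf
  rw [Finset.sum_mul, Finset.sum_congr rfl hterm, Finset.sum_range_sub']
  have q1 : ∏ j ∈ Finset.range N, (x - X * ω ^ (j + 1) * u) = x ^ N - X ^ N * u ^ N := by
    rw [← mul_pow, ← prod_sub_mul_pow_succ hω]
    exact Finset.prod_congr rfl fun j _ => by ring
  have q2 : ∏ j ∈ Finset.range N, (y - Y * ω ^ j * w) = y ^ N - Y ^ N * w ^ N := by
    rw [← mul_pow, ← prod_sub_mul_pow hω]
    exact Finset.prod_congr rfl fun j _ => by ring
  have q3 : ∏ j ∈ Finset.range N, (Y - y * ω⁻¹ ^ j * u) = Y ^ N - y ^ N * u ^ N := by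
    rw [← mul_pow, ← prod_sub_mul_pow hω.inv]
    exact Finset.prod_congr rfl fun j _ => by ring
  have q4 : ∏ j ∈ Finset.range N, (X - x * ω ^ j * w) = X ^ N - x ^ N * w ^ N := by
    rw [← mul_pow, ← prod_sub_mul_pow hω]
    exact Finset.prod_congr rfl fun j _ => by ring
  simp only [H, Finset.range_zero, Finset.prod_empty, Nat.sub_zero, Nat.sub_self, Finset.Ico_self,
    ← Finset.range_eq_Ico, q1, q2, q3, q4]
  ring

theorem continuous_pairFun {T : Type*} [TopologicalSpace T] {a b c d u : T → ℂ}
    (ha : Continuous a) (hb : Continuous b) (hc : Continuous c) (hd : Continuous d)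
    (hu : Continuous u) (e : ℕ) :
    Continuous fun t => pairFun N ω (a t) (b t) (c t) (d t) e (u t) := by
  unfold pairFun
  fun_prop

/-- The sum in `sum_pairFun_telescope`; where `u w = 1`, it is found by continuity in `u`. -/
theorem sum_pairFun (hω : IsPrimitiveRoot ω N) {x y X Y : ℂ} (h : x * y ≠ X * Y) (u w : ℂ) :
    ∑ e ∈ Finset.range N, pairFun N ω x y Y X e ((ω ^ e)⁻¹ * u) *
        ((ω ^ e)⁻¹ * pairFun N ω y x (X * ω) Y e w) =
      powQuot N (x * y) (X * Y) * ∑ k ∈ Finset.range N, (u * w) ^ k := by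
  have h0 : x * y - X * Y ≠ 0 := sub_ne_zero.mpr h
  have key : ∀ u, u * w ≠ 1 → ∑ e ∈ Finset.range N, pairFun N ω x y Y X e ((ω ^ e)⁻¹ * u) *
        ((ω ^ e)⁻¹ * pairFun N ω y x (X * ω) Y e w) =
      powQuot N (x * y) (X * Y) * ∑ k ∈ Finset.range N, (u * w) ^ k := by
    intro u hu
    have h1 : 1 - u * w ≠ 0 := sub_ne_zero.mpr hu.symm
    refine mul_right_cancel₀ (mul_ne_zero h0 h1) ?_
    rw [sum_pairFun_telescope hω, powQuot_eq_div h, geom_sum_eq hu]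
    have h2 : u * w - 1 ≠ 0 := sub_ne_zero.mpr hu
    field_simp
    ring
  by_cases hw : w = 0
  · exact key u (by simp [hw])
  have hd : Dense ({w⁻¹}ᶜ : Set ℂ) := dense_compl_singleton _
  refine congrFun (Continuous.ext_on hd ?_ ?_ fun v hv => key v fun h => hv ?_) u
  · refine continuous_finsetSum _ fun e _ => Continuous.mul ?_ continuous_const
    exact continuous_pairFun (by fun_prop) (by fun_prop) (by fun_prop) (by fun_prop)
      (by fun_prop) e
  · fun_prop
  · exact eq_inv_of_mul_eq_one_left h

theorem sum_chi_pow (hω : IsPrimitiveRoot ω N) (m : ZMod N) :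
    ∑ k ∈ Finset.range N, chi ω m ^ k = if m = 0 then (N : ℂ) else 0 := by
  rw [← sum_chi_mul hω, sum_zmod_eq_sum_range]
  exact Finset.sum_congr rfl fun k _ => by rw [mul_comm, chi_mul_natCast hω.pow_eq_one]

theorem chi_pow_mul_dft (h1 : ω ^ N = 1) (f : ZMod N → ℂ) (σ : ZMod N) (e : ℕ) :
    chi ω (σ + 1) ^ e * dft ω f σ = dft ω (fun m : ZMod N => f (m - (e : ZMod N))) σ := by
  induction e generalizing f with
  | zero => simp
  | succ e ih =>
    rw [pow_succ, mul_assoc, chi_mul_dft h1, ih]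
    congr 1
    funext m
    push_cast
    congr 1
    ring

theorem sum_dft_mul_dft (s : Finset ℕ) (f g : ℕ → ZMod N → ℂ) (ρ σ : ZMod N) :
    ∑ e ∈ s, dft ω (f e) ρ * dft ω (g e) σ =
      ∑ n, ∑ m, chi ω (n * (σ + 1)) * chi ω (m * (ρ + 1)) * ∑ e ∈ s, f e m * g e n := by
  have h : ∀ e, dft ω (f e) ρ * dft ω (g e) σ =
      ∑ n, ∑ m, chi ω (n * (σ + 1)) * chi ω (m * (ρ + 1)) * (f e m * g e n) := by
    intro e
    rw [dft, dft, mul_comm, Finset.sum_mul_sum]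
    exact Finset.sum_congr rfl fun n _ => Finset.sum_congr rfl fun m _ => by ring
  rw [Finset.sum_congr rfl fun e _ => h e, Finset.sum_comm]
  refine Finset.sum_congr rfl fun n _ => ?_
  rw [Finset.sum_comm]
  exact Finset.sum_congr rfl fun m _ => Finset.mul_sum _ _ _ |>.symm

/-- For `s = 1` the auxiliary vector `v_0` spans a quotient on which the `S`-operator is a
scalar. -/
theorem sHat_zero_row (hω : IsPrimitiveRoot ω N) {x y X Y : ℂ} (h : x * y ≠ X * Y) (τ : ZMod N) :
    sHat N ω x y X Y (X * ω) 0 τ =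
      if τ = 0 then algebraMap ℂ (SiteOp N) ((N : ℂ) ^ 2 * powQuot N (x * y) (X * Y)) else 0 := by
  have h1 := hω.pow_eq_one
  have hω0 : ω ≠ 0 := hω.ne_zero (NeZero.ne N)
  have key : ∀ σ, ∑ e ∈ Finset.range N, chi ω (σ - τ) ^ e *
      (pairDft ω x y Y X e (σ + 0 - τ) * pairDft ω y x (X * ω) Y e σ) =
        if τ = 0 then (N : ℂ) ^ 2 * powQuot N (x * y) (X * Y) else 0 := by
    intro σ
    -- the powers of `χ` turn into shifts under the Fourier transform
    have e1 : ∀ e ∈ Finset.range N, chi ω (σ - τ) ^ e *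
        (pairDft ω x y Y X e (σ + 0 - τ) * pairDft ω y x (X * ω) Y e σ) =
        dft ω (fun m => pairFun N ω x y Y X e ((ω ^ e)⁻¹ * chi ω m)) (σ - τ) *
          dft ω (fun n => (ω ^ e)⁻¹ * pairFun N ω y x (X * ω) Y e (chi ω n)) σ := by
      intro e _
      have e2 : ∀ m : ZMod N, (ω ^ e)⁻¹ * chi ω m = chi ω (m - (e : ZMod N)) := fun m => by
        rw [chi_sub h1, chi_natCast h1, mul_comm]
      have e3 : chi ω (σ - τ) ^ e = chi ω (σ - τ + 1) ^ e * (ω ^ e)⁻¹ := by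
        rw [chi_add h1 (σ - τ), chi_one h1, mul_pow, mul_inv_cancel_right₀ (pow_ne_zero e hω0)]
      simp only [e2]
      rw [← chi_pow_mul_dft h1 (fun m => pairFun N ω x y Y X e (chi ω m)), ← mul_dft, e3, add_zero,
        pairDft, pairDft]
      ring
    rw [Finset.sum_congr rfl e1, sum_dft_mul_dft]
    have e4 : ∀ n, ∑ m, chi ω (n * (σ + 1)) * chi ω (m * (σ - τ + 1)) *
        ∑ e ∈ Finset.range N, pairFun N ω x y Y X e ((ω ^ e)⁻¹ * chi ω m) *
          ((ω ^ e)⁻¹ * pairFun N ω y x (X * ω) Y e (chi ω n)) =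
        powQuot N (x * y) (X * Y) * N * chi ω (n * τ) := by
      intro n
      simp only [sum_pairFun hω h, ← chi_add h1, sum_chi_pow hω]
      rw [Finset.sum_eq_single (-n)]
      · rw [neg_add_cancel, if_pos rfl, show n * (σ + 1) + -n * (σ - τ + 1) = n * τ by ring]
        ring
      · intro m _ hm
        rw [if_neg fun h => hm (eq_neg_of_add_eq_zero_left h), mul_zero, mul_zero]
      · simp
    rw [Finset.sum_congr rfl fun n _ => e4 n, ← Finset.mul_sum, sum_chi_mul hω]
    split_ifs <;> ring
  simp only [sHat, Matrix.of_apply, key]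
  split_ifs with h2
  · rw [h2, sub_zero, wshift_zero_const]
  · ext a b
    simp [wshift]

/-- For `ω^s = ω⁻¹` the auxiliary vector `v_{N-1}` spans an invariant subspace on which the
`S`-operator is a multiple of `Z⁻¹`. -/
theorem sHat_last_col (hω : IsPrimitiveRoot ω N) {x y X Y : ℂ} (h : x * y ≠ X * Y * ω⁻¹)
    (τ' : ZMod N) :
    sHat N ω x y X Y (X * ω⁻¹) τ' (-1) =
      if τ' = -1 then wshift 0 fun σ => (N : ℂ) ^ 2 * powQuot N (x * y) (X * Y * ω⁻¹) *
        (chi ω (σ + 1))⁻¹ else 0 := by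
  have h1 := hω.pow_eq_one
  have hω0 : ω ≠ 0 := hω.ne_zero (NeZero.ne N)
  have h' : y * x ≠ Y * (X * ω⁻¹) := by rwa [mul_comm y, ← mul_assoc, mul_comm Y]
  have key : ∀ σ, ∑ e ∈ Finset.range N, chi ω (σ - -1) ^ e *
      (pairDft ω x y Y X e (σ + τ' - -1) * pairDft ω y x (X * ω⁻¹) Y e σ) =
        if τ' = -1 then (N : ℂ) ^ 2 * powQuot N (x * y) (X * Y * ω⁻¹) *
          (chi ω (σ + 1))⁻¹ else 0 := by
    intro σ
    -- the shift of `m` by one brings the parameters to the form required by `sum_pairFun`, with the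
    -- two factors in exchanged roles
    have e1 : ∀ e ∈ Finset.range N, chi ω (σ - -1) ^ e *
        (pairDft ω x y Y X e (σ + τ' - -1) * pairDft ω y x (X * ω⁻¹) Y e σ) =
        dft ω (fun n => pairFun N ω y x (X * ω⁻¹) Y e ((ω ^ e)⁻¹ * chi ω n)) σ *
        dft ω (fun m => (ω ^ e)⁻¹ * pairFun N ω x y (Y * ω) (X * ω⁻¹) e (chi ω (m + 1)))
          (σ + τ' + 1) := by
      intro e he
      have e2 : ∀ m : ZMod N, (ω ^ e)⁻¹ * chi ω m = chi ω (m - (e : ZMod N)) := fun m => by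
        rw [chi_sub h1, chi_natCast h1, mul_comm]
      have e3 : ∀ m : ZMod N, (ω ^ e)⁻¹ * pairFun N ω x y (Y * ω) (X * ω⁻¹) e (chi ω (m + 1)) =
          pairFun N ω x y Y X e (chi ω m) := by
        intro m
        have p1 : ∏ j ∈ Finset.range e, (Y * ω - y * ω ^ (j + 1) * chi ω (m + 1)) =
            ω ^ e * ∏ j ∈ Finset.range e, (Y - y * ω ^ (j + 1) * chi ω m) := by
          rw [show ω ^ e = ∏ _j ∈ Finset.range e, ω by simp, ← Finset.prod_mul_distrib]
          exact Finset.prod_congr rfl fun j _ => by rw [chi_add h1, chi_one h1]; ring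
        have p2 : ∏ j ∈ Finset.Ico (e + 1) N, (x - X * ω⁻¹ * ω ^ j * chi ω (m + 1)) =
            ∏ j ∈ Finset.Ico (e + 1) N, (x - X * ω ^ j * chi ω m) :=
          Finset.prod_congr rfl fun j _ => by rw [chi_add h1, chi_one h1]; field_simp
        rw [pairFun, pairFun, p1, p2, mul_assoc, inv_mul_cancel_left₀ (pow_ne_zero e hω0)]
      simp only [e2, e3]
      rw [← chi_pow_mul_dft h1 (fun m => pairFun N ω y x (X * ω⁻¹) Y e (chi ω m)), sub_neg_eq_add,
        sub_neg_eq_add, pairDft, pairDft]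
      ring
    rw [Finset.sum_congr rfl e1, sum_dft_mul_dft]
    have e4 : ∀ n, ∑ m, chi ω (n * (σ + τ' + 1 + 1)) * chi ω (m * (σ + 1)) *
        ∑ e ∈ Finset.range N, pairFun N ω y x (X * ω⁻¹) Y e ((ω ^ e)⁻¹ * chi ω m) *
          ((ω ^ e)⁻¹ * pairFun N ω x y (Y * ω) (X * ω⁻¹) e (chi ω (n + 1))) =
        powQuot N (x * y) (X * Y * ω⁻¹) * N * (chi ω (σ + 1))⁻¹ * chi ω (n * (τ' + 1)) := by
      intro n
      simp only [sum_pairFun hω h', ← chi_add h1, sum_chi_pow hω]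
      rw [Finset.sum_eq_single (-(n + 1))]
      · rw [neg_add_cancel, if_pos rfl,
          show n * (σ + τ' + 1 + 1) + -(n + 1) * (σ + 1) = n * (τ' + 1) + -(σ + 1) by ring,
          chi_add h1, chi_neg h1, mul_comm y, mul_comm X Y, mul_assoc Y]
        ring
      · intro m _ hm
        rw [if_neg fun h => hm (eq_neg_of_add_eq_zero_left h), mul_zero, mul_zero]
      · simp
    rw [Finset.sum_congr rfl fun n _ => e4 n, ← Finset.mul_sum, sum_chi_mul hω]
    simp only [add_eq_zero_iff_eq_neg]
    split_ifs <;> ring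
  simp only [sHat, Matrix.of_apply, key]
  split_ifs with h2
  · rw [h2, sub_self]
  · ext a b
    simp [wshift]

end Telescope

/-! ### Relations between the monodromy matrices -/

section TQ

variable {N : ℕ} [NeZero N] {L : ℕ} {ω : ℂ}

/-- The monodromy matrix built from the `S`-operators `sHat`. -/
def sMon (N : ℕ) [NeZero N] (ω : ℂ) (p : Fin L → Rapidity) (X Y c : ℂ) :
    Matrix (ZMod N) (ZMod N) (ChainOp N L) :=
  glob fun i => sHat N ω (p i).x (p i).y X Y c

variable {p : Fin L → Rapidity} {X Y c : ℂ}

theorem tauMon_sMon_fuseIn (hω : ω ^ N = 1) (hY : Y ≠ 0) (hc : c ≠ 0) :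
    tens (tauMon N ω p (c * Y)⁻¹) (sMon N ω p X Y c) * scal (ChainOp N L) (fuseIn N c) =
      scal (ChainOp N L) (fuseIn N c) * (aFun p (c * Y)⁻¹ •
        (sMon N ω p X Y (c * ω)).submatrix (· + 1) (· + 1)) := by
  have h := glob_mul_scal (L := L) _ _ (fuseIn N c) fun i =>
    locL_sHat_fuseIn (N := N) (p i).x (p i).y X Y c hω hY hc
  have e := glob_reindex (Equiv.addRight (1 : ZMod N)).symm
    fun i : Fin L => sHat N ω (p i).x (p i).y X Y (c * ω)
  rw [glob_tens, glob_smul] at h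
  exact (e ▸ h :)

theorem fuseOut_tauMon_sMon (hω : ω ^ N = 1) (hY : Y ≠ 0) (hc : c ≠ 0) :
    scal (ChainOp N L) (fuseOut N (c * ω)) *
        tens (tauMon N ω p (c * ω * Y)⁻¹) (sMon N ω p X Y (c * ω)) =
      (dFun ω p (c * ω * Y)⁻¹ • Matrix.of fun τ' τ => chargeOp N L ω *
        sMon N ω p X Y c (τ' - 1) (τ - 1)) * scal (ChainOp N L) (fuseOut N (c * ω)) := by
  have hω0 : ω ≠ 0 := by
    rw [← chi_one (N := N) hω]
    exact chi_ne_zero hω _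
  have h := glob_mul_scal (L := L) _ _ (fuseOut N (c * ω)) fun i =>
    (fuseOut_locL_sHat (N := N) (p i).x (p i).y X Y c hω hY hc).symm
  let Zm : Matrix Unit Unit (SiteOp N) := Matrix.of fun _ _ => wshift 0 (chi ω)
  let ε : Unit × ZMod N ≃ ZMod N :=
    { toFun := fun a => a.2 + 1
      invFun := fun τ => ((), τ - 1)
      left_inv := fun a => by simp
      right_inv := fun τ => by simp }
  have e := glob_reindex ε fun i : Fin L => tens Zm (sHat N ω (p i).x (p i).y X Y c)
  rw [glob_tens] at e
  have hd : ∏ i, (1 - (p i).x * (p i).y * (c * Y)⁻¹) = dFun ω p (c * ω * Y)⁻¹ := by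
    refine Finset.prod_congr rfl fun i _ => ?_
    rw [Rapidity.t]
    field_simp
  rw [glob_tens, glob_smul, hd] at h
  rw [chargeOp_eq]
  exact (e ▸ h :).symm

/-! The entries of the two matrix relations above; `A`, `B`, `C`, `D` are the entries of `tauMon`. -/

theorem fuse_A_B (hω : ω ^ N = 1) (hY : Y ≠ 0) (hc : c ≠ 0) (τ' τ : ZMod N) :
    (-c⁻¹) • (tauMon N ω p (c * Y)⁻¹ 0 0 * sMon N ω p X Y c τ' (τ + 1)) +
        tauMon N ω p (c * Y)⁻¹ 0 1 * sMon N ω p X Y c τ' τ =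
      (-c⁻¹) • aFun p (c * Y)⁻¹ • sMon N ω p X Y (c * ω) τ' (τ + 1) := by
  have h :=
    congrFun₂ (tauMon_sMon_fuseIn (p := p) (X := X) hω hY hc) (0, τ') τ
  rw [mul_fuseIn_apply, fuseIn_mul_apply, if_pos rfl, tens_apply, tens_apply, Matrix.smul_apply,
    Matrix.submatrix_apply, sub_add_cancel] at h
  exact h

theorem fuse_C_D (hω : ω ^ N = 1) (hY : Y ≠ 0) (hc : c ≠ 0) (τ' τ : ZMod N) :
    (-c⁻¹) • (tauMon N ω p (c * Y)⁻¹ 1 0 * sMon N ω p X Y c τ' (τ + 1)) +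
        tauMon N ω p (c * Y)⁻¹ 1 1 * sMon N ω p X Y c τ' τ =
      aFun p (c * Y)⁻¹ • sMon N ω p X Y (c * ω) (τ' + 1) (τ + 1) := by
  have h :=
    congrFun₂ (tauMon_sMon_fuseIn (p := p) (X := X) hω hY hc) (1, τ') τ
  rw [mul_fuseIn_apply, fuseIn_mul_apply, if_neg (by simp), tens_apply, tens_apply,
    Matrix.smul_apply, Matrix.submatrix_apply] at h
  exact h

theorem fuse_A_C (hω : ω ^ N = 1) (hY : Y ≠ 0) (hc : c ≠ 0) (τ' τ : ZMod N) :
    tauMon N ω p (c * ω * Y)⁻¹ 0 0 * sMon N ω p X Y (c * ω) τ' τ +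
        (c * ω)⁻¹ • (tauMon N ω p (c * ω * Y)⁻¹ 1 0 * sMon N ω p X Y (c * ω) (τ' - 1) τ) =
      dFun ω p (c * ω * Y)⁻¹ • (chargeOp N L ω * sMon N ω p X Y c (τ' - 1) (τ - 1)) := by
  have h :=
    congrFun₂ (fuseOut_tauMon_sMon (p := p) (X := X) hω hY hc) τ' (0, τ)
  rw [fuseOut_mul_apply, mul_fuseOut_apply, if_pos rfl, tens_apply, tens_apply,
    Matrix.smul_apply] at h
  exact h

theorem fuse_B_D (hω : ω ^ N = 1) (hY : Y ≠ 0) (hc : c ≠ 0) (τ' τ : ZMod N) :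
    tauMon N ω p (c * ω * Y)⁻¹ 0 1 * sMon N ω p X Y (c * ω) τ' τ +
        (c * ω)⁻¹ • (tauMon N ω p (c * ω * Y)⁻¹ 1 1 * sMon N ω p X Y (c * ω) (τ' - 1) τ) =
      (c * ω)⁻¹ • dFun ω p (c * ω * Y)⁻¹ • (chargeOp N L ω * sMon N ω p X Y c (τ' - 1) τ) := by
  have h :=
    congrFun₂ (fuseOut_tauMon_sMon (p := p) (X := X) hω hY hc) τ' (1, τ)
  rw [fuseOut_mul_apply, mul_fuseOut_apply, if_neg (by simp), tens_apply, tens_apply,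
    Matrix.smul_apply] at h
  simpa only [Matrix.of_apply, add_sub_cancel_right] using h

/-- The `TQ`-relation: in the sum over `τ` of `fuse_A_C` and `fuse_C_D`, the contributions of `C`
cancel. -/
theorem tau_mul_trace_sMon (hω : ω ^ N = 1) (hY : Y ≠ 0) (hc : c ≠ 0) :
    (tauMon N ω p (c * ω * Y)⁻¹ 0 0 + tauMon N ω p (c * ω * Y)⁻¹ 1 1) *
        ∑ τ, sMon N ω p X Y (c * ω) τ τ =
      aFun p (c * ω * Y)⁻¹ • ∑ τ, sMon N ω p X Y (c * ω * ω) τ τ +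
        dFun ω p (c * ω * Y)⁻¹ • (chargeOp N L ω * ∑ τ, sMon N ω p X Y c τ τ) := by
  have hω0 : ω ≠ 0 := by
    rw [← chi_one (N := N) hω]
    exact chi_ne_zero hω _
  have e1 := Equiv.sum_comp (Equiv.subRight (1 : ZMod N)) fun τ => sMon N ω p X Y c τ τ
  have e2 := Equiv.sum_comp (Equiv.addRight (1 : ZMod N)) fun τ => sMon N ω p X Y (c * ω * ω) τ τ
  have e3 := Equiv.sum_comp (Equiv.subRight (1 : ZMod N)) fun τ =>
    (c * ω)⁻¹ • (tauMon N ω p (c * ω * Y)⁻¹ 1 0 * sMon N ω p X Y (c * ω) τ (τ + 1))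
  simp only [Equiv.coe_addRight, Equiv.subRight_apply, sub_add_cancel] at e1 e2 e3
  rw [← e1, ← e2, add_mul, Finset.mul_sum, Finset.mul_sum, Finset.mul_sum, Finset.smul_sum,
    Finset.smul_sum]
  have h1 := fun τ => eq_sub_of_add_eq (fuse_A_C (p := p) (X := X) hω hY hc τ τ)
  have h2 := fun τ => eq_sub_of_add_eq'
    (fuse_C_D (p := p) (X := X) hω hY (mul_ne_zero hc hω0) τ τ)
  simp only [h1, h2, Finset.sum_sub_distrib, Finset.sum_add_distrib, neg_smul, sub_neg_eq_add, e3]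
  abel

end TQ

/-! ### Invariant blocks of the monodromy matrix -/

section Blocks

variable {N : ℕ} [NeZero N] {L : ℕ} {ω : ℂ} {p : Fin L → Rapidity} {X Y : ℂ}

/-- The auxiliary vector `v_0` spans a quotient on which the monodromy matrix with `c = x_q ω` is a
scalar. -/
theorem sMon_zero_row (hω : IsPrimitiveRoot ω N) (h : ∀ i, (p i).t ≠ X * Y) (τ : ZMod N) :
    sMon N ω p X Y (X * ω) 0 τ =
      if τ = 0 then ((N : ℂ) ^ (2 * L) * ∏ i, powQuot N (p i).t (X * Y)) • 1 else 0 := by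
  let π : Matrix Unit (ZMod N) ℂ := Matrix.of fun _ τ => if τ = 0 then 1 else 0
  let F : Fin L → Matrix Unit Unit (SiteOp N) := fun i =>
    Matrix.of fun _ _ => wshift 0 fun _ => (N : ℂ) ^ 2 * powQuot N (p i).t (X * Y)
  have hl : ∀ i, F i * scal (SiteOp N) π =
      scal (SiteOp N) π * sHat N ω (p i).x (p i).y X Y (X * ω) := by
    intro i
    ext a τ : 1
    simp only [Matrix.mul_apply, F, π, scal, Matrix.map_apply, Matrix.of_apply, apply_ite
      (algebraMap ℂ (SiteOp N)), map_one, map_zero, ite_mul, one_mul, zero_mul, mul_ite, mul_one,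
      mul_zero, Finset.sum_ite_eq', Finset.mem_univ, if_true, Fintype.sum_unique,
      sHat_zero_row hω (h i), wshift_zero_const]
    rfl
  have hg := congrFun₂ (glob_mul_scal (L := L) F _ π hl) () τ
  rw [Matrix.mul_apply, Matrix.mul_apply, Fintype.sum_unique] at hg
  simp only [π, scal, Matrix.map_apply, Matrix.of_apply, apply_ite
      (algebraMap ℂ (ChainOp N L)), map_one, map_zero, ite_mul, one_mul, zero_mul, mul_ite, mul_one,
      mul_zero, Finset.sum_ite_eq', Finset.mem_univ, if_true, F] at hg
  have e : ∏ i, (N : ℂ) ^ 2 * powQuot N (p i).t (X * Y) =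
      (N : ℂ) ^ (2 * L) * ∏ i, powQuot N (p i).t (X * Y) := by
    rw [Finset.prod_mul_distrib, Finset.prod_const, Finset.card_univ, Fintype.card_fin, pow_mul]
  rw [sMon, ← hg]
  split_ifs
  · refine (glob_unit_wshift _).trans ?_
    simp only [e]
    rw [← Matrix.smul_one_eq_diagonal]
  · rfl

/-- The auxiliary vector `v_{N-1}` spans an invariant subspace on which the monodromy matrix with
`c = x_q ω⁻¹` is a multiple of the inverse of the charge operator. -/
theorem sMon_last_col (hω : IsPrimitiveRoot ω N) (h : ∀ i, (p i).t ≠ X * Y * ω⁻¹) :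
    sMon N ω p X Y (X * ω⁻¹) (-1) (-1) = Matrix.diagonal fun σ => ∏ i,
      ((N : ℂ) ^ 2 * powQuot N (p i).t (X * Y * ω⁻¹) * (chi ω (σ i + 1))⁻¹) := by
  let ι : Matrix (ZMod N) Unit ℂ := Matrix.of fun τ _ => if τ = -1 then 1 else 0
  let F : Fin L → Matrix Unit Unit (SiteOp N) := fun i =>
    Matrix.of fun _ _ => wshift 0 fun σ => (N : ℂ) ^ 2 * powQuot N (p i).t (X * Y * ω⁻¹) *
      (chi ω (σ + 1))⁻¹
  have hl : ∀ i, sHat N ω (p i).x (p i).y X Y (X * ω⁻¹) * scal (SiteOp N) ι =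
      scal (SiteOp N) ι * F i := by
    intro i
    ext τ a : 1
    simp only [Matrix.mul_apply, F, ι, scal, Matrix.map_apply, Matrix.of_apply, apply_ite
      (algebraMap ℂ (SiteOp N)), map_one, map_zero, ite_mul, one_mul, zero_mul, mul_ite, mul_one,
      mul_zero, Finset.sum_ite_eq', Finset.mem_univ, if_true, Finset.univ_unique (α := Unit),
      Finset.sum_singleton, sHat_last_col hω (h i)]
    rfl
  have hg := congrFun₂ (glob_mul_scal (L := L) _ F ι hl) (-1) ()
  rw [Matrix.mul_apply, Matrix.mul_apply, Finset.univ_unique (α := Unit),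
    Finset.sum_singleton] at hg
  simp only [ι, scal, Matrix.map_apply, Matrix.of_apply, apply_ite
      (algebraMap ℂ (ChainOp N L)), map_one, map_zero, one_mul, mul_ite, mul_one,
      mul_zero, Finset.sum_ite_eq', Finset.mem_univ, if_true, F] at hg
  rw [sMon, hg]
  exact glob_unit_wshift _

theorem aFun_ne_zero (hX : X ≠ 0) (hY : Y ≠ 0) (hω0 : ω ≠ 0) {s : ℕ}
    (h : ∀ i, (p i).t ≠ X * Y * ω ^ s) : aFun p (X * ω ^ s * Y)⁻¹ ≠ 0 := by
  refine Finset.prod_ne_zero_iff.mpr fun i _ => ?_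
  rw [sub_ne_zero, ne_comm, ← div_eq_mul_inv, Ne,
    div_eq_one_iff_eq (mul_ne_zero (mul_ne_zero hX (pow_ne_zero s hω0)) hY)]
  intro h'
  exact h i (by rw [h']; ring)

/-- The span of the auxiliary vectors `v_s, …, v_{N-1}` is invariant under the monodromy matrix with
`c = x_q ω^s`. For `s = 1` this is `sMon_zero_row`, and `fuse_A_B` and `fuse_C_D` lead from `s` to
`s + 1`. -/
theorem sMon_triangular (hω : IsPrimitiveRoot ω N) (hX : X ≠ 0) (hY : Y ≠ 0)
    (h : ∀ i j, (p i).t ≠ X * Y * ω ^ j) {s : ℕ} (hs : 1 ≤ s) :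
    ∀ i j : ℕ, i < s → s ≤ j → j < N → sMon N ω p X Y (X * ω ^ s) i j = 0 := by
  have h1 := hω.pow_eq_one
  have hω0 : ω ≠ 0 := hω.ne_zero (NeZero.ne N)
  induction s, hs using Nat.le_induction with
  | base =>
    intro i j hi hj hjN
    obtain rfl : i = 0 := by omega
    rw [pow_one, Nat.cast_zero, sMon_zero_row hω fun i => by simpa using h i 0, if_neg]
    rw [ZMod.natCast_eq_zero_iff]
    exact fun hd => absurd (Nat.le_of_dvd (by omega) hd) (by omega)
  | succ s hs ih =>
    intro i j hi hj hjN
    have hc : X * ω ^ s ≠ 0 := mul_ne_zero hX (pow_ne_zero s hω0)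
    have ha := aFun_ne_zero hX hY hω0 (h · s)
    obtain ⟨j, rfl⟩ : ∃ k, j = k + 1 := ⟨j - 1, by omega⟩
    rw [pow_succ, ← mul_assoc]
    rcases i with _ | i
    · have e := fuse_A_B (p := p) (X := X) h1 hY hc ((0 : ℕ) : ZMod N) j
      have e1 := ih 0 (j + 1) (by omega) (by omega) hjN
      have e2 := ih 0 j (by omega) (by omega) (by omega)
      push_cast at e e1 e2 ⊢
      rw [e1, e2, mul_zero, mul_zero, smul_zero, add_zero, smul_smul] at e
      exact (smul_eq_zero.mp e.symm).resolve_left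
        (mul_ne_zero (neg_ne_zero.mpr (inv_ne_zero hc)) ha)
    · have e := fuse_C_D (p := p) (X := X) h1 hY hc i j
      have e1 := ih i (j + 1) (by omega) (by omega) hjN
      have e2 := ih i j (by omega) (by omega) (by omega)
      push_cast at e e1 e2 ⊢
      rw [e1, e2, mul_zero, mul_zero, smul_zero, add_zero] at e
      exact (smul_eq_zero.mp e.symm).resolve_left ha

/-- The trace of the monodromy matrix with `c = x_q ω^s` over the span of the auxiliary vectors
`v_s, …, v_{N-1}`. -/
def blockTrace (N : ℕ) [NeZero N] (ω : ℂ) (p : Fin L → Rapidity) (X Y : ℂ) (s : ℕ) :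
    ChainOp N L :=
  ∑ j ∈ Finset.Ico s N, sMon N ω p X Y (X * ω ^ s) j j

/-- The `TQ`-relation for the trace over an invariant block. The contributions of `C` no longer cancel
but telescope to two boundary terms: one vanishes by `sMon_triangular`, and the other one accounts for
the summands at the end of the block. -/
theorem tau_mul_blockTrace (hω : IsPrimitiveRoot ω N) (hX : X ≠ 0) (hY : Y ≠ 0)
    (h : ∀ i j, (p i).t ≠ X * Y * ω ^ j) {s : ℕ} (hs : s + 2 ≤ N) :
    (tauMon N ω p (X * ω ^ (s + 1) * Y)⁻¹ 0 0 + tauMon N ω p (X * ω ^ (s + 1) * Y)⁻¹ 1 1) *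
        blockTrace N ω p X Y (s + 1) =
      aFun p (X * ω ^ (s + 1) * Y)⁻¹ • blockTrace N ω p X Y (s + 2) +
        dFun ω p (X * ω ^ (s + 1) * Y)⁻¹ • (chargeOp N L ω * blockTrace N ω p X Y s) := by
  have h1 := hω.pow_eq_one
  have hω0 : ω ≠ 0 := hω.ne_zero (NeZero.ne N)
  have hc : X * ω ^ s ≠ 0 := mul_ne_zero hX (pow_ne_zero s hω0)
  have hc' : X * ω ^ s * ω ≠ 0 := mul_ne_zero hc hω0
  have tri := sMon_triangular (p := p) hω hX hY h (s := s + 1) (by omega)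
  obtain ⟨M, hM⟩ : ∃ M, N = M + 1 := ⟨N - 1, by omega⟩
  have hcast : ((M : ℕ) : ZMod N) + 1 = 0 := by
    rw [← Nat.cast_succ, ZMod.natCast_eq_zero_iff, ← Nat.add_one, ← hM]
  simp only [blockTrace, pow_succ, ← mul_assoc] at tri ⊢
  set c := X * ω ^ s with hcdef
  set A := fun j : ZMod N => sMon N ω p X Y c j j with hA
  set A2 := fun j : ZMod N => sMon N ω p X Y (c * ω * ω) j j with hA2
  set G := fun j : ZMod N => (c * ω)⁻¹ •
    (tauMon N ω p (c * ω * Y)⁻¹ 1 0 * sMon N ω p X Y (c * ω) j (j + 1)) with hG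
  set d := dFun ω p (c * ω * Y)⁻¹
  set a := aFun p (c * ω * Y)⁻¹
  -- the contribution of the diagonal entry with index `i + 1`, up to a difference
  have hstep : ∀ i : ℕ, (tauMon N ω p (c * ω * Y)⁻¹ 0 0 + tauMon N ω p (c * ω * Y)⁻¹ 1 1) *
      sMon N ω p X Y (c * ω) ((i + 1 : ℕ) : ZMod N) ((i + 1 : ℕ) : ZMod N) =
        d • (chargeOp N L ω * A i) + a • A2 ((i + 2 : ℕ) : ZMod N) +
          (G ((i + 1 : ℕ) : ZMod N) - G i) := by
    intro i
    have e1 := eq_sub_of_add_eq (fuse_A_C (p := p) (X := X) h1 hY hc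
      ((i + 1 : ℕ) : ZMod N) ((i + 1 : ℕ) : ZMod N))
    have e2 := eq_sub_of_add_eq' (fuse_C_D (p := p) (X := X) h1 hY hc'
      ((i + 1 : ℕ) : ZMod N) ((i + 1 : ℕ) : ZMod N))
    have e3 : (((i + 1 : ℕ) : ZMod N)) - 1 = i := by push_cast; ring
    have e4 : (((i + 1 : ℕ) : ZMod N)) + 1 = ((i + 2 : ℕ) : ZMod N) := by push_cast; ring
    have e5 : (i : ZMod N) + 1 = ((i + 1 : ℕ) : ZMod N) := by push_cast; ring
    rw [add_mul, e1, e2, e3]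
    simp only [hA, hA2, hG, e4, e5, neg_smul]
    abel
  -- the two boundary terms
  have b1 : G (s : ZMod N) = 0 := by
    have := tri s (s + 1) (by omega) le_rfl (by omega)
    push_cast at this
    simp only [hG, this, mul_zero, smul_zero]
  have b2 : a • A2 0 + G (M : ZMod N) = d • (chargeOp N L ω * A (M : ZMod N)) := by
    have e1 := fuse_B_D (p := p) (X := X) h1 hY hc 0 (M : ZMod N)
    have e2 := fuse_C_D (p := p) (X := X) h1 hY hc' (M : ZMod N) (M : ZMod N)
    have e3 := tri 0 M (by omega) (by omega) (by omega)
    have e4 : (0 : ZMod N) - 1 = M := by rw [← hcast]; ring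
    rw [Nat.cast_zero] at e3
    rw [e3, mul_zero, zero_add, e4] at e1
    have e5 := smul_right_injective _ (inv_ne_zero hc') e1
    rw [e5, hcast] at e2
    simp only [hA2, hG, hA, hcast]
    rw [← e2]
    module
  have hIco : ∀ r, Finset.Ico r N = Finset.Ico r (M + 1) := fun r => by rw [hM]
  have hA2M : A2 ((M + 1 : ℕ) : ZMod N) = A2 0 := by rw [Nat.cast_succ, hcast]
  have s2 := Finset.sum_Ico_add' (fun j : ℕ => A2 (j : ZMod N)) s M 2
  rw [Finset.sum_Ico_succ_top (by omega : s + 2 ≤ M + 1), hA2M] at s2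
  rw [hIco, hIco, hIco, ← Finset.sum_Ico_add', Finset.sum_Ico_succ_top (by omega : s ≤ M),
    Finset.mul_sum, Finset.sum_congr rfl fun i _ => hstep i, Finset.sum_add_distrib,
    Finset.sum_add_distrib, ← Finset.smul_sum, ← Finset.smul_sum, s2, ← Finset.mul_sum,
    Finset.sum_Ico_sub (fun i : ℕ => G (i : ZMod N)) (by omega : s ≤ M), b1, mul_add,
    smul_add, smul_add, ← b2]
  abel

end Blocks

/-! ### The eigenvalue for generic spectral parameters -/

section Eigenvalue

variable {N : ℕ} [NeZero N] {L R : ℕ} {ω : ℂ} {p : Fin L → Rapidity} {z : Fin R → ℂ} {X Y : ℂ}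

/-- The summand `ω^{τ(L+R)} N^{2L} ∏ₙ (t_n^N - t^N)/(t_n - t ω^τ) / (F(t ω^τ) F(t ω^{τ+1}))`
of the eigenvalue. -/
def eigTerm (N : ℕ) (ω : ℂ) (p : Fin L → Rapidity) (z : Fin R → ℂ) (t : ℂ) (τ : ℕ) : ℂ :=
  (N : ℂ) ^ (2 * L) * (∏ n, powQuot N (p n).t (t * ω ^ τ)) *
    (ω ^ (τ * (L + R)) / (FPoly z (t * ω ^ τ) * FPoly z (t * ω ^ (τ + 1))))

theorem dFun_succ (hω0 : ω ≠ 0) (s : ℕ) :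
    dFun ω p (X * ω ^ (s + 1) * Y)⁻¹ = aFun p (X * ω ^ s * Y)⁻¹ := by
  refine Finset.prod_congr rfl fun i _ => ?_
  rw [pow_succ]
  field_simp

/-- The eigenvalue of the `τ₂`-model at `u = (t ω^(s+1))⁻¹`, in terms of `F`. -/
theorem FPoly_mul_tauEig (hω0 : ω ≠ 0) (hX : X ≠ 0) (hY : Y ≠ 0) (s : ℕ)
    (hF : FPoly z (X * Y * ω ^ (s + 1)) ≠ 0) :
    FPoly z (X * Y * ω ^ (s + 1)) * tauEig ω p z (X * ω ^ (s + 1) * Y)⁻¹ =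
      aFun p (X * ω ^ (s + 1) * Y)⁻¹ * FPoly z (X * Y * ω ^ (s + 2)) +
        dFun ω p (X * ω ^ (s + 1) * Y)⁻¹ * (ω ^ R * FPoly z (X * Y * ω ^ s)) := by
  have hne : ∀ j, 1 - X * Y * ω ^ (s + 1) * z j ≠ 0 := fun j =>
    Finset.prod_ne_zero_iff.mp hF j (Finset.mem_univ j)
  have hu : X * ω ^ (s + 1) * Y ≠ 0 := mul_ne_zero (mul_ne_zero hX (pow_ne_zero _ hω0)) hY
  have e1 : ∏ j, ((X * ω ^ (s + 1) * Y)⁻¹ - ω * z j) / ((X * ω ^ (s + 1) * Y)⁻¹ - z j) =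
      FPoly z (X * Y * ω ^ (s + 2)) / FPoly z (X * Y * ω ^ (s + 1)) := by
    rw [FPoly, FPoly, ← Finset.prod_div_distrib]
    refine Finset.prod_congr rfl fun j _ => ?_
    rw [← mul_div_mul_left _ _ hu, mul_sub, mul_sub, mul_inv_cancel₀ hu]
    congr 1 <;> ring
  have e2 : ∏ j, (ω * (X * ω ^ (s + 1) * Y)⁻¹ - z j) / ((X * ω ^ (s + 1) * Y)⁻¹ - z j) =
      ω ^ R * FPoly z (X * Y * ω ^ s) / FPoly z (X * Y * ω ^ (s + 1)) := by
    have : ω ^ R = ∏ _j : Fin R, ω := by simp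
    rw [FPoly, FPoly, this, ← Finset.prod_mul_distrib, ← Finset.prod_div_distrib]
    refine Finset.prod_congr rfl fun j _ => ?_
    rw [← mul_div_mul_left _ _ hu, mul_sub, mul_sub, mul_left_comm, mul_inv_cancel₀ hu]
    congr 1 <;> ring
  rw [tauEig, e1, e2]
  field_simp

/-- Consecutive summands of the eigenvalue have a simple ratio, since
`(t_n - t ω^τ) * powQuot N t_n (t ω^τ) = t_n^N - t^N` does not depend on `τ`. -/
theorem aFun_mul_eigTerm (hω : IsPrimitiveRoot ω N) (hX : X ≠ 0) (hY : Y ≠ 0)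
    (h : ∀ i j, (p i).t ≠ X * Y * ω ^ j) (hF : ∀ s, FPoly z (X * Y * ω ^ s) ≠ 0) (s : ℕ) :
    aFun p (X * ω ^ (s + 1) * Y)⁻¹ * FPoly z (X * Y * ω ^ (s + 2)) *
        eigTerm N ω p z (X * Y) (s + 1) =
      dFun ω p (X * ω ^ (s + 1) * Y)⁻¹ * (ω ^ R * FPoly z (X * Y * ω ^ s)) *
        eigTerm N ω p z (X * Y) s := by
  have hω0 : ω ≠ 0 := hω.ne_zero (NeZero.ne N)
  have hpow : ∀ r, (X * Y * ω ^ r) ^ N = (X * Y) ^ N := fun r => by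
    rw [mul_pow, ← pow_mul, mul_comm r, pow_mul, hω.pow_eq_one, one_pow, mul_one]
  have e : aFun p (X * ω ^ (s + 1) * Y)⁻¹ *
        (ω ^ L * ∏ n, powQuot N (p n).t (X * Y * ω ^ (s + 1))) =
      dFun ω p (X * ω ^ (s + 1) * Y)⁻¹ * ∏ n, powQuot N (p n).t (X * Y * ω ^ s) := by
    have : ω ^ L = ∏ _n : Fin L, ω := by simp
    rw [dFun_succ hω0, this, aFun, aFun, ← Finset.prod_mul_distrib, ← Finset.prod_mul_distrib,
      ← Finset.prod_mul_distrib]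
    refine Finset.prod_congr rfl fun n _ => ?_
    rw [powQuot_eq_div (h n _), powQuot_eq_div (h n _), hpow, hpow]
    have h1 := sub_ne_zero.mpr (h n s)
    have h2 := sub_ne_zero.mpr (h n (s + 1))
    have e1 : 1 - (p n).t * (X * ω ^ (s + 1) * Y)⁻¹ =
        -((p n).t - X * Y * ω ^ (s + 1)) / (X * ω ^ (s + 1) * Y) := by
      field_simp
      ring
    have e2 : 1 - (p n).t * (X * ω ^ s * Y)⁻¹ =
        -((p n).t - X * Y * ω ^ s) / (X * ω ^ s * Y) := by
      field_simp
      ring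
    rw [e1, e2]
    generalize (p n).t - X * Y * ω ^ (s + 1) = A at *
    generalize (p n).t - X * Y * ω ^ s = B at *
    rw [pow_succ]
    field_simp
  have f0 := hF s
  have f1 := hF (s + 1)
  have f2 := hF (s + 2)
  have e3 : ω ^ ((s + 1) * (L + R)) = ω ^ (s * (L + R)) * ω ^ L * ω ^ R := by ring
  rw [eigTerm, eigTerm, e3]
  generalize FPoly z (X * Y * ω ^ s) = F0 at *
  generalize FPoly z (X * Y * ω ^ (s + 1)) = F1 at *
  generalize FPoly z (X * Y * ω ^ (s + 2)) = F2 at *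
  generalize ∏ n, powQuot N (p n).t (X * Y * ω ^ (s + 1)) = P1 at *
  generalize ∏ n, powQuot N (p n).t (X * Y * ω ^ s) = P0 at *
  generalize aFun p (X * ω ^ (s + 1) * Y)⁻¹ = a at *
  generalize dFun ω p (X * ω ^ (s + 1) * Y)⁻¹ = d at *
  field_simp
  linear_combination (N : ℂ) ^ (L * 2) * e

theorem mulVec_betheState_tau (hω : IsPrimitiveRoot ω N) (hp : ∀ n, (p n).mu ≠ 0)
    (hz : IsRegularBetheSolution ω p z) (hX : X ≠ 0) (hY : Y ≠ 0)
    (hF : ∀ s, FPoly z (X * Y * ω ^ s) ≠ 0) (s : ℕ) :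
    (tauMon N ω p (X * ω ^ s * Y)⁻¹ 0 0 + tauMon N ω p (X * ω ^ s * Y)⁻¹ 1 1).mulVec
      (betheState ω p z) = tauEig ω p z (X * ω ^ s * Y)⁻¹ • betheState ω p z := by
  have hω0 : ω ≠ 0 := hω.ne_zero (NeZero.ne N)
  refine tau_mulVec_betheState hω p hp z hz _ fun i hi => hF s ?_
  refine Finset.prod_eq_zero (Finset.mem_univ i) ?_
  rw [← hi]
  field_simp
  ring

theorem chargeOp_injective (hω : IsPrimitiveRoot ω N) {v w : (Fin L → ZMod N) → ℂ}
    (h : (chargeOp N L ω).mulVec v = (chargeOp N L ω).mulVec w) : v = w := by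
  funext σ
  have := congrFun h σ
  rw [chargeOp, Matrix.mulVec_diagonal, Matrix.mulVec_diagonal] at this
  exact mul_left_cancel₀ (Finset.prod_ne_zero_iff.mpr fun i _ => chi_ne_zero hω.pow_eq_one _) this

/-- The eigenvalue of `blockTrace N ω p X Y s`, by descending induction on `s = N - k`: the
`TQ`-relation is solved for its last term. -/
theorem blockTrace_mulVec_betheState (hω : IsPrimitiveRoot ω N) (hp : ∀ n, (p n).mu ≠ 0)
    (hz : IsRegularBetheSolution ω p z) (hX : X ≠ 0) (hY : Y ≠ 0)
    (h : ∀ i j, (p i).t ≠ X * Y * ω ^ j) (hF : ∀ s, FPoly z (X * Y * ω ^ s) ≠ 0) (k : ℕ) :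
    ∀ s, s + k = N → (blockTrace N ω p X Y s).mulVec (betheState ω p z) =
      (FPoly z (X * Y) * FPoly z (X * Y * ω ^ s) *
        ∑ τ ∈ Finset.Ico s N, eigTerm N ω p z (X * Y) τ) • betheState ω p z := by
  have h1 := hω.pow_eq_one
  have hω0 : ω ≠ 0 := hω.ne_zero (NeZero.ne N)
  have hQ := chargeOp_mulVec_betheState h1 p hp z
  induction k using Nat.twoStepInduction with
  | zero =>
    rintro s rfl
    simp [blockTrace]
  | one =>
    intro s hs
    have hsω : ω ^ s = ω⁻¹ := by
      rw [← hs, pow_succ] at h1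
      exact eq_inv_of_mul_eq_one_left h1
    have hcast : ((s : ℕ) : ZMod N) = -1 := by
      rw [eq_neg_iff_add_eq_zero, ← Nat.cast_succ, ZMod.natCast_eq_zero_iff, ← Nat.add_one, hs]
    have hIco : Finset.Ico s N = {s} := by
      rw [← hs]
      exact Nat.Ico_succ_singleton s
    apply chargeOp_injective hω
    rw [blockTrace, hIco, Finset.sum_singleton, Finset.sum_singleton, hcast, hsω,
      sMon_last_col hω (by simpa only [hsω] using fun i => h i s), Matrix.mulVec_smul, hQ, chargeOp,
      Matrix.mulVec_mulVec, Matrix.diagonal_mul_diagonal]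
    have e : (fun σ : Fin L → ZMod N => (∏ i, chi ω (σ i)) * ∏ i, ((N : ℂ) ^ 2 *
        powQuot N (p i).t (X * Y * ω⁻¹) * (chi ω (σ i + 1))⁻¹)) = fun _ =>
          (N : ℂ) ^ (2 * L) * (∏ n, powQuot N (p n).t (X * Y * ω⁻¹)) * (ω ^ L)⁻¹ := by
      funext σ
      have e1 : ∏ i, ((N : ℂ) ^ 2 * powQuot N (p i).t (X * Y * ω⁻¹) * ω⁻¹) =
          (N : ℂ) ^ (2 * L) * (∏ n, powQuot N (p n).t (X * Y * ω⁻¹)) * (ω ^ L)⁻¹ := by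
        simp [Finset.prod_mul_distrib, pow_mul]
      rw [← e1, ← Finset.prod_mul_distrib]
      refine Finset.prod_congr rfl fun i _ => ?_
      rw [chi_add h1, chi_one h1]
      have := chi_ne_zero h1 (σ i)
      field_simp
    have e2 : FPoly z (X * Y) * FPoly z (X * Y * ω⁻¹) * eigTerm N ω p z (X * Y) s * ω ^ R =
        (N : ℂ) ^ (2 * L) * (∏ n, powQuot N (p n).t (X * Y * ω⁻¹)) * (ω ^ L)⁻¹ := by
      have f0 : FPoly z (X * Y) ≠ 0 := by simpa using hF 0
      have f1 : FPoly z (X * Y * ω⁻¹) ≠ 0 := by simpa [hsω] using hF s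
      have e3 : ω ^ (s * (L + R)) = (ω ^ L)⁻¹ * (ω ^ R)⁻¹ := by
        rw [pow_mul, hsω, inv_pow, pow_add, mul_inv]
      have e4 : X * Y * ω ^ (s + 1) = X * Y := by
        rw [pow_succ, hsω, inv_mul_cancel₀ hω0, mul_one]
      rw [eigTerm, e3, e4, hsω]
      generalize FPoly z (X * Y * ω⁻¹) = F1 at *
      field_simp
    rw [e, smul_smul, e2, Matrix.diagonal_const_mulVec]
  | more k ih1 ih2 =>
    intro s hs
    have hs2 : s + 2 ≤ N := by omega
    have hd : dFun ω p (X * ω ^ (s + 1) * Y)⁻¹ ≠ 0 := by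
      rw [dFun_succ hω0]
      exact aFun_ne_zero hX hY hω0 (h · s)
    have key := congrArg (Matrix.mulVec · (betheState ω p z)) (tau_mul_blockTrace hω hX hY h hs2)
    simp only [Matrix.add_mulVec _ _ (betheState ω p z), Matrix.smul_mulVec,
      ← Matrix.mulVec_mulVec] at key
    rw [ih2 (s + 1) (by omega), ih1 (s + 2) (by omega), Matrix.mulVec_smul,
      mulVec_betheState_tau hω hp hz hX hY hF, smul_smul, smul_smul] at key
    apply chargeOp_injective hω
    have key' := eq_sub_of_add_eq' key.symm
    rw [← sub_smul, eq_comm, ← inv_smul_eq_iff₀ hd, eq_comm] at key'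
    rw [key', Matrix.mulVec_smul, hQ, smul_smul, smul_smul]
    congr 1
    have e1 := FPoly_mul_tauEig (p := p) (z := z) hω0 hX hY s (hF _)
    have e2 := aFun_mul_eigTerm (z := z) hω hX hY h hF s
    rw [inv_mul_eq_iff_eq_mul₀ hd]
    have s1 := Finset.sum_eq_sum_Ico_succ_bot (by omega : s < N)
      fun τ => eigTerm N ω p z (X * Y) τ
    have s2 := Finset.sum_eq_sum_Ico_succ_bot (by omega : s + 1 < N)
      fun τ => eigTerm N ω p z (X * Y) τ
    rw [s1, s2]
    linear_combination (eigTerm N ω p z (X * Y) (s + 1) +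
      ∑ τ ∈ Finset.Ico (s + 1 + 1) N, eigTerm N ω p z (X * Y) τ) * FPoly z (X * Y) * e1 +
      FPoly z (X * Y) * e2

/-- The eigenvalue of the trace of the monodromy matrix, by ascending induction on `s`. For `s = 0` and
`s = 1` it is given by `blockTrace_mulVec_betheState`, with `sMon_zero_row` for the summand that is
missing from the block if `s = 1`. -/
theorem trace_sMon_mulVec_betheState (hω : IsPrimitiveRoot ω N) (hp : ∀ n, (p n).mu ≠ 0)
    (hz : IsRegularBetheSolution ω p z) (hX : X ≠ 0) (hY : Y ≠ 0)
    (h : ∀ i j, (p i).t ≠ X * Y * ω ^ j) (hF : ∀ s, FPoly z (X * Y * ω ^ s) ≠ 0) (s : ℕ) :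
    (∑ τ, sMon N ω p X Y (X * ω ^ s) τ τ).mulVec (betheState ω p z) =
      (FPoly z (X * Y) * FPoly z (X * Y * ω ^ s) *
        ∑ τ ∈ Finset.range N, eigTerm N ω p z (X * Y) τ) • betheState ω p z := by
  have h1 := hω.pow_eq_one
  have hω0 : ω ≠ 0 := hω.ne_zero (NeZero.ne N)
  have hN : 0 < N := NeZero.pos N
  have hQ := chargeOp_mulVec_betheState h1 p hp z
  induction s using Nat.twoStepInduction with
  | zero =>
    have e := blockTrace_mulVec_betheState hω hp hz hX hY h hF N 0 (zero_add N)
    rw [blockTrace, Nat.Ico_zero_eq_range] at e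
    rw [sum_zmod_eq_sum_range fun τ => sMon N ω p X Y (X * ω ^ 0) τ τ, e]
  | one =>
    have e := blockTrace_mulVec_betheState hω hp hz hX hY h hF (N - 1) 1 (by omega)
    rw [blockTrace] at e
    rw [sum_zmod_eq_sum_range fun τ => sMon N ω p X Y (X * ω ^ 1) τ τ, Finset.range_eq_Ico,
      Finset.sum_eq_sum_Ico_succ_bot hN, Finset.sum_eq_sum_Ico_succ_bot hN, Matrix.add_mulVec, e,
      Nat.cast_zero, pow_one, sMon_zero_row hω fun i => by simpa using h i 0, if_pos rfl,
      Matrix.smul_mulVec, Matrix.one_mulVec, ← add_smul]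
    congr 1
    have f0 : FPoly z (X * Y) ≠ 0 := by simpa using hF 0
    have f1 : FPoly z (X * Y * ω) ≠ 0 := by simpa using hF 1
    rw [zero_add, mul_add, add_left_inj, eigTerm, pow_zero, mul_one, zero_add, pow_one, zero_mul,
      pow_zero]
    field_simp
  | more s ih1 ih2 =>
    have hc : X * ω ^ s ≠ 0 := mul_ne_zero hX (pow_ne_zero s hω0)
    have ha := aFun_ne_zero hX hY hω0 (h · (s + 1))
    have key := congrArg (Matrix.mulVec · (betheState ω p z))
      (tau_mul_trace_sMon (p := p) (X := X) h1 hY hc)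
    simp only [Matrix.add_mulVec _ _ (betheState ω p z), Matrix.smul_mulVec,
      ← Matrix.mulVec_mulVec] at key
    rw [show X * ω ^ s * ω = X * ω ^ (s + 1) by ring,
      show X * ω ^ (s + 1) * ω = X * ω ^ (s + 2) by ring, ih1, ih2, Matrix.mulVec_smul, Matrix.mulVec_smul, hQ,
      mulVec_betheState_tau hω hp hz hX hY hF, smul_smul, smul_smul, smul_smul] at key
    have key' := eq_sub_of_add_eq key.symm
    rw [← sub_smul, eq_comm, ← inv_smul_eq_iff₀ ha, eq_comm] at key'
    rw [key', smul_smul]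
    congr 1
    rw [inv_mul_eq_iff_eq_mul₀ ha]
    linear_combination (∑ τ ∈ Finset.range N, eigTerm N ω p z (X * Y) τ) * FPoly z (X * Y) *
      FPoly_mul_tauEig (p := p) (z := z) hω0 hX hY s (hF _)

end Eigenvalue

/-! ### The `S`-operator in terms of products of Boltzmann weights -/

section Reduction

variable {N : ℕ} [NeZero N] {L : ℕ} {ω : ℂ}

/-- The blocks of an operator on `ℂ^N ⊗ ℂ^N` with respect to the second factor. -/
def blocks (O : Matrix (ZMod N × ZMod N) (ZMod N × ZMod N) ℂ) :
    Matrix (ZMod N) (ZMod N) (SiteOp N) :=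
  Matrix.of fun τ' τ => Matrix.of fun σ' σ => O (σ', τ') (σ, τ)

/-- The monodromy matrix on the quantum space and the auxiliary space together, as a matrix of operators
on the quantum space. -/
theorem prod_atSiteAux_apply (O : Fin L → Matrix (ZMod N × ZMod N) (ZMod N × ZMod N) ℂ)
    (σ' σ : Fin L → ZMod N) (τ' τ : ZMod N) :
    (List.ofFn fun i => atSiteAux i (O i)).prod (σ', τ') (σ, τ) =
      glob (fun i => blocks (O i)) τ' τ σ' σ := by
  rw [glob_eq_prod_map, List.ofFn_eq_map]
  induction List.finRange L generalizing σ' τ' with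
  | nil =>
    simp only [List.map_nil, List.prod_nil, Matrix.one_apply, Prod.mk.injEq]
    by_cases h : τ' = τ <;> simp [h, Matrix.one_apply]
  | cons i l ih =>
    rw [List.map_cons, List.prod_cons, List.map_cons, List.prod_cons, Matrix.mul_apply,
      Fintype.sum_prod_type, Finset.sum_comm, Matrix.mul_apply, Matrix.sum_apply]
    refine Finset.sum_congr rfl fun c _ => ?_
    rw [Matrix.mul_apply]
    refine Finset.sum_congr rfl fun ρ _ => ?_
    rw [ih]
    rfl

theorem transferSCP_eq (q₁ q₂ : Rapidity) (p : Fin L → Rapidity) :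
    (transferSCP ω q₁ q₂ p : ChainOp N L) =
      ∑ τ, glob (fun i => blocks (opS ω (p i) (p i).bar q₁ q₂)) τ τ := by
  ext σ' σ
  rw [Matrix.sum_apply]
  exact Finset.sum_congr rfl fun τ _ => prod_atSiteAux_apply _ _ _ _ _

/-- The finite Fourier transform. -/
def fhat (ω : ℂ) (f : ZMod N → ℂ) (n : ZMod N) : ℂ := ∑ m, chi ω (-(n * m)) * f m

theorem weightHat_eq (hω : ω ^ N = 1) (p q : Rapidity) (n : ZMod N) :
    weightHat ω p q n = fhat ω (weight ω p q) n := by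
  refine Finset.sum_congr rfl fun m _ => ?_
  rw [chi_neg hω, chi, ZMod.val_mul, ← pow_eq_pow_mod _ hω]

/-- The convolution theorem. -/
theorem fhat_mul_sum (hω : ω ^ N = 1) (f g : ZMod N → ℂ) (r ρ : ZMod N) :
    fhat ω f r * ∑ m, chi ω (m * ρ) * g m =
      ∑ e, chi ω (-(r * e)) * ∑ m, chi ω (m * (ρ - r)) * (f (m + e) * g m) := by
  simp only [Finset.mul_sum]
  rw [Finset.sum_comm]
  refine Finset.sum_congr rfl fun m _ => ?_
  rw [fhat, ← Equiv.sum_comp (Equiv.addLeft m), Finset.sum_mul]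
  refine Finset.sum_congr rfl fun e _ => ?_
  have h : chi ω (-(r * (m + e))) * chi ω (m * ρ) = chi ω (-(r * e)) * chi ω (m * (ρ - r)) := by
    rw [← chi_add hω, ← chi_add hω]
    congr 1
    ring
  rw [Equiv.coe_addLeft]
  linear_combination f (m + e) * g m * h

/-- Two applications of the convolution theorem and orthogonality of characters. -/
theorem sum_fhat_mul_fhat (hω : IsPrimitiveRoot ω N) (v w g h : ZMod N → ℂ) (σ τ τ' : ZMod N) :
    ∑ r, fhat ω v (τ' - σ - r) * fhat ω w r * (∑ m, chi ω (m * (σ + r)) * g m) *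
        (∑ n, chi ω (n * (τ - r)) * h n) =
      N * ∑ e, chi ω (e * (σ - τ')) * ((∑ m, chi ω (m * σ) * (w (m + e) * g m)) *
        ∑ n, chi ω (n * (σ + τ - τ')) * (v (n + e) * h n)) := by
  have h1 := hω.pow_eq_one
  set P := fun e => ∑ m, chi ω (m * σ) * (w (m + e) * g m) with hP
  set Q := fun e => ∑ n, chi ω (n * (σ + τ - τ')) * (v (n + e) * h n) with hQ
  have e1 : ∀ r, fhat ω w r * ∑ m, chi ω (m * (σ + r)) * g m = ∑ e, chi ω (-(r * e)) * P e := by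
    intro r
    rw [fhat_mul_sum h1]
    simp only [hP, add_sub_cancel_right]
  have e2 : ∀ r, fhat ω v (τ' - σ - r) * ∑ n, chi ω (n * (τ - r)) * h n =
      ∑ f, chi ω (-((τ' - σ - r) * f)) * Q f := by
    intro r
    rw [fhat_mul_sum h1]
    have : τ - r - (τ' - σ - r) = σ + τ - τ' := by ring
    simp only [hQ, this]
  have e3 : ∀ r, fhat ω v (τ' - σ - r) * fhat ω w r * (∑ m, chi ω (m * (σ + r)) * g m) *
        (∑ n, chi ω (n * (τ - r)) * h n) =
      ∑ e, ∑ f, chi ω (r * (f - e)) * (chi ω (f * (σ - τ')) * (P e * Q f)) := by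
    intro r
    rw [mul_assoc (fhat ω v _), e1, mul_right_comm, e2, mul_comm, Finset.sum_mul_sum]
    refine Finset.sum_congr rfl fun e _ => Finset.sum_congr rfl fun f _ => ?_
    have : chi ω (-(r * e)) * chi ω (-((τ' - σ - r) * f)) =
        chi ω (r * (f - e)) * chi ω (f * (σ - τ')) := by
      rw [← chi_add h1, ← chi_add h1]
      congr 1
      ring
    linear_combination P e * Q f * this
  rw [Finset.sum_congr rfl fun r _ => e3 r, Finset.sum_comm, Finset.mul_sum]
  refine Finset.sum_congr rfl fun e _ => ?_
  rw [Finset.sum_comm]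
  simp only [← Finset.sum_mul, sum_chi_mul hω, sub_eq_zero, ite_mul, zero_mul, Finset.sum_ite_eq',
    Finset.mem_univ, if_true]
  rfl

theorem shift_clock_shift_apply (hω : ω ^ N = 1) (k l : ℕ) (n : ZMod N) (σ' σ : ZMod N) :
    ((opX ^ k * opZ ω ^ n.val * opX ^ l : SiteOp N)) σ' σ =
      if σ' = σ + (l : ZMod N) + (k : ZMod N) then chi ω (n * (σ + (l : ZMod N))) else 0 := by
  rw [opX_pow, opX_pow, opZ_pow, wshift_mul, wshift_mul]
  have : σ + ((k : ZMod N) + 0 + (l : ZMod N)) = σ + (l : ZMod N) + (k : ZMod N) := by ring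
  simp only [wshift, Matrix.of_apply, this]
  split_ifs with h
  · have : σ' - (k : ZMod N) = σ + (l : ZMod N) := by rw [h]; ring
    rw [this, ← chi_mul_natCast hω, ZMod.natCast_zmod_val, one_mul, mul_one, mul_comm]
  · rfl

theorem shift_inv_clock_shift_inv_apply (hω : ω ^ N = 1) (k l : ℕ) (n : ZMod N) (σ' σ : ZMod N) :
    ((opX⁻¹ ^ k * opZ ω ^ n.val * opX⁻¹ ^ l : SiteOp N)) σ' σ =
      if σ' = σ - (l : ZMod N) - (k : ZMod N) then chi ω (n * (σ - (l : ZMod N))) else 0 := by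
  rw [opX_inv_pow, opX_inv_pow, opZ_pow, wshift_mul, wshift_mul]
  have : σ + (-(k : ZMod N) + 0 + -(l : ZMod N)) = σ - (l : ZMod N) - (k : ZMod N) := by ring
  simp only [wshift, Matrix.of_apply, this]
  split_ifs with h
  · have : σ' - -(k : ZMod N) = σ - (l : ZMod N) := by rw [h]; ring
    rw [this, ← chi_mul_natCast hω, ZMod.natCast_zmod_val, one_mul, mul_one, mul_comm]
  · rfl

theorem opP_mul_apply (K : Matrix (ZMod N × ZMod N) (ZMod N × ZMod N) ℂ) (a b : ZMod N × ZMod N) :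
    ((opP : Matrix (ZMod N × ZMod N) (ZMod N × ZMod N) ℂ) * K) a b = K a.swap b := by
  rw [Matrix.mul_apply, Finset.sum_eq_single a.swap]
  · simp [opP]
  · intro c _ hc
    have : a ≠ c.swap := fun h => hc (by rw [h, Prod.swap_swap])
    simp [opP, this]
  · simp

/-- The sum over `n₁, …, n₄` in the `S`-operator: the matrix element fixes `n₁` in terms of `n₄`, and the
other three sums are Fourier transforms. -/
theorem opS_apply (hω : IsPrimitiveRoot ω N) (p p' q q' : Rapidity) (σ' σ τ' τ : ZMod N) :
    opS ω p p' q q' (σ', τ') (σ, τ) = if σ' = σ + (τ - τ') then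
      (N : ℂ)⁻¹ * ∑ e, chi ω (e * (σ - τ')) *
        ((∑ m, chi ω (m * σ) * (weight ω p' q (m + e) * weightBar ω p q m)) *
          ∑ n, chi ω (n * σ') * (weight ω p q' (n + e) * weightBar ω p' q' n)) else 0 := by
  have h1 := hω.pow_eq_one
  have hN : (N : ℂ) ≠ 0 := Nat.cast_ne_zero.mpr (NeZero.ne N)
  rw [opS, Matrix.smul_apply, opP_mul_apply]
  simp only [Matrix.sum_apply, Matrix.smul_apply, Matrix.kroneckerMap_apply, Prod.swap_prod_mk,
    shift_clock_shift_apply h1, shift_inv_clock_shift_inv_apply h1, ZMod.natCast_zmod_val,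
    smul_eq_mul, weightHat_eq h1]
  have hterm : ∀ n₁ n₂ n₃ n₄ : ZMod N,
      fhat ω (weight ω p q') n₁ * weightBar ω p q n₂ * weightBar ω p' q' n₃ *
        fhat ω (weight ω p' q) n₄ *
          ((if τ' = σ + n₄ + n₁ then chi ω (n₂ * (σ + n₄)) else 0) *
            if σ' = τ - n₄ - n₁ then chi ω (n₃ * (τ - n₄)) else 0) =
        if n₁ = τ' - σ - n₄ then (if σ' = σ + (τ - τ') then
          fhat ω (weight ω p q') (τ' - σ - n₄) * fhat ω (weight ω p' q) n₄ *
            (chi ω (n₂ * (σ + n₄)) * weightBar ω p q n₂) *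
              (chi ω (n₃ * (τ - n₄)) * weightBar ω p' q' n₃) else 0) else 0 := by
    intro n₁ n₂ n₃ n₄
    by_cases c1 : n₁ = τ' - σ - n₄
    · have c2 : τ' = σ + n₄ + n₁ := by rw [c1]; ring
      have c3 : σ' = τ - n₄ - n₁ ↔ σ' = σ + (τ - τ') := by
        rw [c1, show τ - n₄ - (τ' - σ - n₄) = σ + (τ - τ') by ring]
      rw [if_pos c1, if_pos c2]
      simp only [c3]
      split_ifs
      · rw [c1]; ring
      · ring
    · have c2 : ¬ τ' = σ + n₄ + n₁ := fun h => c1 (by rw [h]; ring)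
      rw [if_neg c1, if_neg c2, zero_mul, mul_zero]
  simp only [hterm]
  split_ifs with hc
  · have e := sum_fhat_mul_fhat hω (weight ω p q') (weight ω p' q) (weightBar ω p q)
      (weightBar ω p' q') σ τ τ'
    rw [show σ + τ - τ' = σ' by rw [hc]; ring] at e
    have hsum : ∀ F : ZMod N → ZMod N → ZMod N → ℂ, (∑ n₁, ∑ n₂, ∑ n₃, ∑ n₄,
        if n₁ = τ' - σ - n₄ then F n₂ n₃ n₄ else 0) = ∑ n₄, ∑ n₂, ∑ n₃, F n₂ n₃ n₄ := by
      intro F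
      calc _ = ∑ n₂, ∑ n₃, ∑ n₄, F n₂ n₃ n₄ := by
            rw [Finset.sum_comm]
            refine Finset.sum_congr rfl fun n₂ _ => ?_
            rw [Finset.sum_comm]
            refine Finset.sum_congr rfl fun n₃ _ => ?_
            rw [Finset.sum_comm]
            exact Finset.sum_congr rfl fun n₄ _ => by
              rw [Finset.sum_ite_eq', if_pos (Finset.mem_univ _)]
        _ = ∑ n₂, ∑ n₄, ∑ n₃, F n₂ n₃ n₄ := Finset.sum_congr rfl fun n₂ _ => Finset.sum_comm
        _ = _ := Finset.sum_comm
    rw [hsum]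
    simp only [← Finset.mul_sum, ← Finset.sum_mul]
    rw [e]
    field_simp
  · simp

/-! ### The weights as functions on `ℤ/N` -/

/-- The common form of the weights `W_{p̄ q}`, with `(a, b, c, d) = (x_p, y_p, y_q, x_q)`, and
`W_{p q̄(s)}`, with `(a, b, c, d) = (y_p, x_p, x_q ω^s, y_q)`. -/
def ratioProd (ω κ a b c d : ℂ) (n : ZMod N) : ℂ :=
  ∏ j ∈ Finset.Icc 1 n.val, κ * ((c - b * ω ^ j) / (a - d * ω ^ j))

variable {κ a b c d : ℂ}

theorem sub_mul_pow_ne_zero (hω : ω ^ N = 1) (h : a ^ N ≠ d ^ N) (j : ℕ) : a - d * ω ^ j ≠ 0 := by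
  intro h0
  apply h
  rw [sub_eq_zero.mp h0, mul_pow, ← pow_mul, mul_comm j, pow_mul, hω, one_pow, mul_one]

theorem sub_mul_chi_ne_zero (hω : ω ^ N = 1) (h : a ^ N ≠ d ^ N) (j : ℕ) (m : ZMod N) :
    a - d * ω ^ j * chi ω m ≠ 0 := by
  rw [chi, mul_assoc, ← pow_add]
  exact sub_mul_pow_ne_zero hω h _

/-- The recursion of the weights holds on all of `ℤ/N`, because the product over a full period
is `1` on the curve. -/
theorem ratioProd_add_one (hω : IsPrimitiveRoot ω N) (h : a ^ N ≠ d ^ N)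
    (hκ : κ ^ N * (c ^ N - b ^ N) = a ^ N - d ^ N) (n : ZMod N) :
    ratioProd ω κ a b c d (n + 1) =
      ratioProd ω κ a b c d n * (κ * ((c - b * ω * chi ω n) / (a - d * ω * chi ω n))) := by
  have h1 := hω.pow_eq_one
  have hstep : ratioProd ω κ a b c d n *
      (κ * ((c - b * ω * chi ω n) / (a - d * ω * chi ω n))) =
        ∏ j ∈ Finset.Icc 1 (n.val + 1), κ * ((c - b * ω ^ j) / (a - d * ω ^ j)) := by
    rw [Finset.prod_Icc_succ_top (by omega), ratioProd, chi, pow_succ]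
    congr 4 <;> ring
  rw [hstep]
  rcases Nat.lt_or_ge (n.val + 1) N with hn | hn
  · rw [ratioProd]
    congr 2
    have : n + 1 = ((n.val + 1 : ℕ) : ZMod N) := by
      rw [Nat.cast_succ, ZMod.natCast_zmod_val]
    rw [this, ZMod.val_natCast, Nat.mod_eq_of_lt hn]
  · have hN : n.val + 1 = N := le_antisymm (ZMod.val_lt n) hn
    have h0 : n + 1 = 0 := by
      rw [← ZMod.natCast_zmod_val n, ← Nat.cast_succ, ZMod.natCast_eq_zero_iff, ← Nat.add_one, hN]
    rw [h0, ratioProd, ZMod.val_zero, Finset.Icc_eq_empty (by omega), Finset.prod_empty, hN,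
      Finset.prod_mul_distrib, Finset.prod_const, Finset.prod_div_distrib, Nat.card_Icc,
      Nat.add_sub_cancel]
    have hr : ∀ f : ℕ → ℂ, ∏ j ∈ Finset.Icc 1 N, f j = ∏ j ∈ Finset.range N, f (j + 1) := by
      intro f
      rw [Finset.range_eq_Ico, Finset.prod_Ico_add' f 0 N 1]
      rfl
    rw [hr, hr, prod_sub_mul_pow_succ hω, prod_sub_mul_pow_succ hω, ← mul_div_assoc, hκ,
      div_self (sub_ne_zero.mpr h)]

theorem ratioProd_add_natCast (hω : IsPrimitiveRoot ω N) (h : a ^ N ≠ d ^ N)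
    (hκ : κ ^ N * (c ^ N - b ^ N) = a ^ N - d ^ N) (n : ZMod N) (e : ℕ) :
    ratioProd ω κ a b c d (n + (e : ZMod N)) = ratioProd ω κ a b c d n * (κ ^ e *
      ∏ j ∈ Finset.range e, ((c - b * ω ^ (j + 1) * chi ω n) /
        (a - d * ω ^ (j + 1) * chi ω n))) := by
  have h1 := hω.pow_eq_one
  induction e with
  | zero => simp
  | succ e ih =>
    rw [Nat.cast_succ, ← add_assoc, ratioProd_add_one hω h hκ, ih, Finset.prod_range_succ,
      chi_add h1, chi_natCast h1, pow_succ κ, pow_succ ω]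
    have e1 : ∀ r, r * ω * (chi ω n * ω ^ e) = r * (ω ^ e * ω) * chi ω n := fun r => by ring
    rw [e1, e1]
    ring

/-- The product `W(n) W̄(n)` telescopes. -/
theorem ratioProd_mul_prod (hω : ω ^ N = 1) {κ' : ℂ} (hκκ : κ * κ' = 1) (h : a ^ N ≠ d ^ N)
    (h' : c ^ N ≠ b ^ N) (n : ZMod N) :
    ratioProd ω κ a b c d n * ∏ j ∈ Finset.Icc 1 n.val,
        κ' * ((a * ω - d * ω ^ j) / (c - b * ω ^ j)) =
      chi ω n * ((a - d) / (a - d * chi ω n)) := by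
  rw [ratioProd, ← Finset.prod_mul_distrib, chi]
  induction n.val with
  | zero =>
    have := sub_mul_pow_ne_zero hω h 0
    rw [pow_zero, mul_one] at this
    simp [div_self this]
  | succ m ih =>
    rw [Finset.prod_Icc_succ_top (by omega), ih]
    have h1 := sub_mul_pow_ne_zero hω h m
    have h2 := sub_mul_pow_ne_zero hω h (m + 1)
    have h3 := sub_mul_pow_ne_zero hω h' (m + 1)
    generalize hA : a - d * ω ^ (m + 1) = A at *
    generalize hC : c - b * ω ^ (m + 1) = C at *
    have e : a * ω - d * ω ^ (m + 1) = ω * (a - d * ω ^ m) := by ring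
    rw [e, pow_succ]
    generalize a - d * ω ^ m = D at *
    rw [← mul_one (ω ^ m * ω * _), ← hκκ]
    field_simp

/-- The product of weights that enters the `S`-operator, without denominators depending on `m`. -/
theorem ratioProd_add_mul_prod (hω : IsPrimitiveRoot ω N) {κ' : ℂ} (hκκ : κ * κ' = 1)
    (h : a ^ N ≠ d ^ N) (h' : c ^ N ≠ b ^ N)
    (hκ : κ ^ N * (c ^ N - b ^ N) = a ^ N - d ^ N) (m : ZMod N) {e : ℕ} (he : e < N) :
    ratioProd ω κ a b c d (m + (e : ZMod N)) * ∏ j ∈ Finset.Icc 1 m.val,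
        κ' * ((a * ω - d * ω ^ j) / (c - b * ω ^ j)) =
      (a - d) / (a ^ N - d ^ N) * κ ^ e * (chi ω m * pairFun N ω a b c d e (chi ω m)) := by
  have h1 := hω.pow_eq_one
  rw [ratioProd_add_natCast hω h hκ, mul_right_comm, ratioProd_mul_prod h1 hκκ h h', pairFun,
    Finset.prod_div_distrib]
  have e1 : a ^ N - d ^ N = (a - d * chi ω m) *
      (∏ j ∈ Finset.range e, (a - d * ω ^ (j + 1) * chi ω m)) *
        ∏ j ∈ Finset.Ico (e + 1) N, (a - d * ω ^ j * chi ω m) := by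
    have := prod_sub_mul_pow hω a (d * chi ω m)
    rw [mul_pow, chi_pow h1, mul_one, Finset.prod_congr rfl fun j _ =>
      show a - d * chi ω m * ω ^ j = a - d * ω ^ j * chi ω m by ring] at this
    rw [← this, ← Finset.prod_range_mul_prod_Ico _ (by omega : e + 1 ≤ N), Finset.prod_range_succ',
      pow_zero, mul_one, mul_comm (Finset.prod _ _) (a - _)]
  have n0 : a - d * chi ω m ≠ 0 := by simpa using sub_mul_chi_ne_zero h1 h 0 m
  have n1 : ∏ j ∈ Finset.range e, (a - d * ω ^ (j + 1) * chi ω m) ≠ 0 :=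
    Finset.prod_ne_zero_iff.mpr fun j _ => sub_mul_chi_ne_zero h1 h _ m
  have n2 : ∏ j ∈ Finset.Ico (e + 1) N, (a - d * ω ^ j * chi ω m) ≠ 0 :=
    Finset.prod_ne_zero_iff.mpr fun j _ => sub_mul_chi_ne_zero h1 h _ m
  rw [e1]
  generalize ∏ j ∈ Finset.range e, (a - d * ω ^ (j + 1) * chi ω m) = A at *
  generalize ∏ j ∈ Finset.Ico (e + 1) N, (a - d * ω ^ j * chi ω m) = B at *
  generalize a - d * chi ω m = D at *
  field_simp

/-- The `S`-operator of the superintegrable model is a multiple of `sHat`: the factors `κ^e` of the two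
products of weights cancel. -/
theorem blocks_opS (hω : IsPrimitiveRoot ω N) {k k' : ℂ} (hk : k ≠ 0) {p q : Rapidity}
    (hp : p.OnCurve N k k') (hq : q.OnCurve N k k') (hx : p.x ^ N ≠ q.x ^ N)
    (hy : p.y ^ N ≠ q.y ^ N) (s : ℕ) :
    blocks (opS ω p p.bar q (q.barShift ω s)) =
      ((N : ℂ)⁻¹ * ((p.x - q.x) / (p.x ^ N - q.x ^ N) * ((p.y - q.y) / (p.y ^ N - q.y ^ N)))) •
        sHat N ω p.x p.y q.x q.y (q.x * ω ^ s) := by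
  have h1 := hω.pow_eq_one
  obtain ⟨hpm, hpx, hpy⟩ := hp
  obtain ⟨hqm, hqx, hqy⟩ := hq
  have hxs : (q.x * ω ^ s) ^ N = q.x ^ N := by
    rw [mul_pow, ← pow_mul, mul_comm s, pow_mul, h1, one_pow, mul_one]
  have hpmN := pow_ne_zero N hpm
  have hqmN := pow_ne_zero N hqm
  have curve : (p.mu * q.mu) ^ N * (p.x ^ N - q.x ^ N) = q.y ^ N - p.y ^ N := by
    have e1 : k * (p.x ^ N - q.x ^ N) = k' * ((q.mu ^ N)⁻¹ - (p.mu ^ N)⁻¹) := by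
      linear_combination hpx - hqx
    have e2 : k * (q.y ^ N - p.y ^ N) = k' * (p.mu ^ N - q.mu ^ N) := by
      linear_combination hqy - hpy
    apply mul_left_cancel₀ hk
    rw [e2, mul_left_comm, e1, mul_pow]
    field_simp
  have w₁ : ∀ (m : ZMod N) {e : ℕ}, e < N →
      weight ω p.bar q (m + (e : ZMod N)) * weightBar ω p q m =
        (p.x - q.x) / (p.x ^ N - q.x ^ N) * (p.mu⁻¹ / q.mu) ^ e *
          (chi ω m * pairFun N ω p.x p.y q.y q.x e (chi ω m)) := fun m e he =>
    ratioProd_add_mul_prod hω (κ := p.mu⁻¹ / q.mu) (κ' := p.mu * q.mu) (by field_simp) hx hy.symm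
      (by
        have : p.mu⁻¹ / q.mu * (p.mu * q.mu) = 1 := by field_simp
        rw [← curve, ← mul_assoc, ← mul_pow, this, one_pow, one_mul]) m he
  have w₂ : ∀ (n : ZMod N) {e : ℕ}, e < N →
      weight ω p (q.barShift ω s) (n + (e : ZMod N)) * weightBar ω p.bar (q.barShift ω s) n =
        (p.y - q.y) / (p.y ^ N - q.y ^ N) * (p.mu / q.mu⁻¹) ^ e *
          (chi ω n * pairFun N ω p.y p.x (q.x * ω ^ s) q.y e (chi ω n)) := fun n e he =>
    ratioProd_add_mul_prod hω (κ := p.mu / q.mu⁻¹) (κ' := p.mu⁻¹ * q.mu⁻¹) (b := p.x)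
      (c := q.x * ω ^ s) (by field_simp) hy
      (by rw [hxs]; exact hx.symm) (by rw [hxs, div_inv_eq_mul]; linear_combination -curve) n he
  ext τ' τ : 1
  ext σ' σ
  rw [Matrix.smul_apply, Matrix.smul_apply]
  simp only [blocks, sHat, wshift, Matrix.of_apply]
  rw [opS_apply hω, sum_zmod_eq_sum_range]
  by_cases hc : σ' = σ + (τ - τ')
  · have c1 : σ' - τ = σ - τ' := by rw [hc]; ring
    have c2 : σ' + τ' - τ = σ := by rw [hc]; ring
    rw [if_pos hc, if_pos hc, smul_eq_mul, mul_assoc, c1, c2]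
    congr 1
    rw [Finset.mul_sum]
    refine Finset.sum_congr rfl fun e he => ?_
    rw [Finset.mem_range] at he
    simp only [w₁ _ he, w₂ _ he]
    have d₁ : ∀ (r : ℂ) (f : ZMod N → ℂ) (ρ : ZMod N),
        ∑ m, chi ω (m * ρ) * (r * (chi ω m * f m)) = r * dft ω f ρ := by
      intro r f ρ
      rw [dft, Finset.mul_sum]
      refine Finset.sum_congr rfl fun m _ => ?_
      rw [mul_add, mul_one, chi_add h1]
      ring
    rw [d₁ _ fun m => pairFun N ω p.x p.y q.y q.x e (chi ω m),
      d₁ _ fun m => pairFun N ω p.y p.x (q.x * ω ^ s) q.y e (chi ω m), mul_comm (e : ZMod N),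
      chi_mul_natCast h1]
    have hμ : (p.mu⁻¹ / q.mu) ^ e * (p.mu / q.mu⁻¹) ^ e = 1 := by
      rw [← mul_pow]
      field_simp
      exact one_pow e
    rw [pairDft, pairDft]
    linear_combination (chi ω (σ - τ') ^ e * ((p.x - q.x) / (p.x ^ N - q.x ^ N)) *
      ((p.y - q.y) / (p.y ^ N - q.y ^ N)) *
      dft ω (fun m => pairFun N ω p.x p.y q.y q.x e (chi ω m)) σ *
      dft ω (fun m => pairFun N ω p.y p.x (q.x * ω ^ s) q.y e (chi ω m)) σ') * hμ
  · rw [if_neg hc, if_neg hc, smul_zero]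

/-- The transfer matrix is a multiple of the trace of the monodromy matrix `sMon`. -/
theorem transferSCP_eq_smul (hω : IsPrimitiveRoot ω N) {k k' : ℂ} (hk : k ≠ 0)
    {p : Fin L → Rapidity} (hp : ∀ n, (p n).OnCurve N k k') {q : Rapidity}
    (hq : q.OnCurve N k k') (hx : ∀ n, (p n).x ^ N ≠ q.x ^ N)
    (hy : ∀ n, (p n).y ^ N ≠ q.y ^ N) (s : ℕ) :
    (transferSCP ω q (q.barShift ω s) p : ChainOp N L) =
      (prefactor N p q * ((N : ℂ) ^ (2 * L))⁻¹) • ∑ τ, sMon N ω p q.x q.y (q.x * ω ^ s) τ τ := by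
  have hN : (N : ℂ) ≠ 0 := Nat.cast_ne_zero.mpr (NeZero.ne N)
  rw [transferSCP_eq]
  simp only [blocks_opS hω hk (hp _) hq (hx _) (hy _), glob_smul, Matrix.smul_apply]
  rw [← Finset.smul_sum, Finset.prod_mul_distrib, Finset.prod_const, Finset.card_univ,
    Fintype.card_fin, prefactor]
  congr 1
  rw [two_mul, pow_add, inv_pow]
  field_simp

end Reduction

/-! ### Passage to arbitrary spectral parameters -/

section Closure

open Filter Topology

variable {N : ℕ} [NeZero N] {L R : ℕ} {ω : ℂ} {p : Fin L → Rapidity} {z : Fin R → ℂ}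

theorem continuous_trace_sMon (X Y c : ℂ → ℂ) (hX : Continuous X) (hY : Continuous Y)
    (hc : Continuous c) :
    Continuous fun ε => ∑ τ, sMon N ω p (X ε) (Y ε) (c ε) τ τ := by
  refine continuous_finsetSum _ fun τ _ => ?_
  have hd : ∀ (a b c d : ℂ → ℂ), Continuous a → Continuous b → Continuous c → Continuous d →
      ∀ e (σ : ZMod N), Continuous fun ε => pairDft ω (a ε) (b ε) (c ε) (d ε) e σ := by
    intro a b c d ha hb hc hd e σ
    exact continuous_finsetSum _ fun m _ => continuous_const.mul
      (continuous_pairFun ha hb hc hd continuous_const e)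
  have h : ∀ i τ' τ, Continuous fun ε => sHat N ω (p i).x (p i).y (X ε) (Y ε) (c ε) τ' τ := by
    intro i τ' τ
    refine continuous_matrix fun σ' σ => ?_
    simp only [sHat, wshift, Matrix.of_apply]
    split_ifs
    · exact continuous_finsetSum _ fun e _ => continuous_const.mul
        ((hd _ _ _ _ continuous_const continuous_const hY hX e _).mul
          (hd _ _ _ _ continuous_const continuous_const hc hY e _))
    · exact continuous_const
  exact (continuous_glob (fun ε i => sHat N ω (p i).x (p i).y (X ε) (Y ε) (c ε))
    fun i => continuous_matrix (h i)).matrix_elem τ τ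

theorem eventually_pow_ne (x y c : ℂ) : ∀ᶠ ε in 𝓝[≠] (0 : ℂ), ((x + ε) * (y + ε)) ^ N ≠ c := by
  let P : Polynomial ℂ :=
    ((Polynomial.X + Polynomial.C x) * (Polynomial.X + Polynomial.C y)) ^ N - Polynomial.C c
  have hm : ((Polynomial.X + Polynomial.C x) * (Polynomial.X + Polynomial.C y)).Monic :=
    (Polynomial.monic_X_add_C x).mul (Polynomial.monic_X_add_C y)
  have hP : P ≠ 0 := by
    intro h0
    have h1 := congrArg Polynomial.natDegree (sub_eq_zero.mp h0)
    rw [hm.natDegree_pow, (Polynomial.monic_X_add_C x).natDegree_mul (Polynomial.monic_X_add_C y),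
      Polynomial.natDegree_X_add_C, Polynomial.natDegree_X_add_C, Polynomial.natDegree_C] at h1
    have := NeZero.pos N
    omega
  have hfin := Polynomial.finite_setOfPred_isRoot hP
  filter_upwards [nhdsNE_le_cofinite 0 hfin.compl_mem_cofinite] with ε hε h
  apply hε
  simp only [Set.mem_ofPred_eq, Polynomial.IsRoot, P, Polynomial.eval_sub, Polynomial.eval_pow,
    Polynomial.eval_mul, Polynomial.eval_add, Polynomial.eval_X, Polynomial.eval_C]
  rw [add_comm ε, add_comm ε, h, sub_self]

theorem FPoly_ne_zero_of_pow (hω : ω ^ N = 1) {t : ℂ} (h : ∀ i, t ^ N ≠ ((z i)⁻¹) ^ N) (r : ℕ) :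
    FPoly z (t * ω ^ r) ≠ 0 := by
  refine Finset.prod_ne_zero_iff.mpr fun i _ h0 => h i ?_
  have h1 : t * ω ^ r = (z i)⁻¹ := eq_inv_of_mul_eq_one_left (sub_eq_zero.mp h0).symm
  rw [← h1, mul_pow, ← pow_mul, mul_comm r, pow_mul, hω, one_pow, mul_one]

/-- For all small `ε ≠ 0`, the parameters `(X + ε, Y + ε)` satisfy the conditions of
`trace_sMon_mulVec_betheState`. -/
theorem eventually_trace_sMon_mulVec (hω : IsPrimitiveRoot ω N) (hp : ∀ n, (p n).mu ≠ 0)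
    (hz : IsRegularBetheSolution ω p z) (X Y : ℂ) (s : ℕ) :
    ∀ᶠ ε in 𝓝[≠] (0 : ℂ),
      (∑ τ, sMon N ω p (X + ε) (Y + ε) ((X + ε) * ω ^ s) τ τ).mulVec (betheState ω p z) =
        (FPoly z ((X + ε) * (Y + ε)) * FPoly z ((X + ε) * (Y + ε) * ω ^ s) *
          ∑ τ ∈ Finset.range N, eigTerm N ω p z ((X + ε) * (Y + ε)) τ) • betheState ω p z := by
  filter_upwards [eventually_pow_ne (N := N) X Y 0,
    eventually_all.mpr fun i => eventually_pow_ne (N := N) X Y ((p i).t ^ N),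
    eventually_all.mpr fun i => eventually_pow_ne (N := N) X Y ((z i)⁻¹ ^ N)] with ε h0 h1 h2
  have h0' : (X + ε) * (Y + ε) ≠ 0 := fun h => h0 (by rw [h, zero_pow (NeZero.ne N)])
  refine trace_sMon_mulVec_betheState hω hp hz (left_ne_zero_of_mul h0') (right_ne_zero_of_mul h0')
    (fun i j h => h1 i ?_) (FPoly_ne_zero_of_pow hω.pow_eq_one h2) s
  rw [h, mul_pow _ (ω ^ j), ← pow_mul, mul_comm j, pow_mul, hω.pow_eq_one, one_pow, mul_one]

theorem tendsto_trace_sMon_mulVec (X Y : ℂ) (s : ℕ) (v : (Fin L → ZMod N) → ℂ) :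
    Tendsto (fun ε : ℂ =>
        (∑ τ, sMon N ω p (X + ε) (Y + ε) ((X + ε) * ω ^ s) τ τ).mulVec v) (𝓝[≠] 0)
      (𝓝 ((∑ τ, sMon N ω p X Y (X * ω ^ s) τ τ).mulVec v)) := by
  have hc := (continuous_trace_sMon (N := N) (ω := ω) (p := p) (fun ε => X + ε) (fun ε => Y + ε)
    (fun ε => (X + ε) * ω ^ s) (by fun_prop) (by fun_prop) (by fun_prop)).matrix_mulVec
      (continuous_const (y := v))
  have := (hc.tendsto 0).mono_left (nhdsWithin_le_nhds (s := {0}ᶜ))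
  simpa only [add_zero] using this

/-- The image of the Bethe state is proportional to it: a line is closed. -/
theorem exists_trace_sMon_mulVec (hω : IsPrimitiveRoot ω N) (hp : ∀ n, (p n).mu ≠ 0)
    (hz : IsRegularBetheSolution ω p z) (X Y : ℂ) (s : ℕ) :
    ∃ Λ : ℂ, (∑ τ, sMon N ω p X Y (X * ω ^ s) τ τ).mulVec (betheState ω p z) =
      Λ • betheState ω p z := by
  have hcl : IsClosed (Submodule.span ℂ {betheState (N := N) ω p z} : Set ((Fin L → ZMod N) → ℂ)) :=
    Submodule.closed_of_finiteDimensional _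
  have h := hcl.mem_of_tendsto (tendsto_trace_sMon_mulVec X Y s (betheState ω p z)) <| by
    filter_upwards [eventually_trace_sMon_mulVec hω hp hz X Y s] with ε hε
    rw [hε]
    exact Submodule.smul_mem _ _ (Submodule.mem_span_singleton_self _)
  obtain ⟨Λ, hΛ⟩ := Submodule.mem_span_singleton.mp h
  exact ⟨Λ, hΛ.symm⟩

/-- Where its denominators do not vanish, the formula for the eigenvalue persists in the limit. -/
theorem trace_sMon_mulVec_of_FPoly_ne_zero (hω : IsPrimitiveRoot ω N) (hp : ∀ n, (p n).mu ≠ 0)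
    (hz : IsRegularBetheSolution ω p z) (X Y : ℂ) (s : ℕ)
    (hF : ∀ τ, FPoly z (X * Y * ω ^ τ) ≠ 0) :
    (∑ τ, sMon N ω p X Y (X * ω ^ s) τ τ).mulVec (betheState ω p z) =
      (FPoly z (X * Y) * FPoly z (X * Y * ω ^ s) *
        ∑ τ ∈ Finset.range N, eigTerm N ω p z (X * Y) τ) • betheState ω p z := by
  have hFc : Continuous (FPoly z) := by
    unfold FPoly
    fun_prop
  have hqc : ∀ a : ℂ, Continuous (powQuot N a) := by
    intro a
    unfold powQuot
    fun_prop
  have hT : Continuous fun ε : ℂ => (X + ε) * (Y + ε) := by fun_prop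
  have h0 : (X + 0) * (Y + 0) = X * Y := by rw [add_zero, add_zero]
  have hcont : ContinuousAt (fun ε : ℂ => (FPoly z ((X + ε) * (Y + ε)) *
      FPoly z ((X + ε) * (Y + ε) * ω ^ s) *
        ∑ τ ∈ Finset.range N, eigTerm N ω p z ((X + ε) * (Y + ε)) τ) •
          betheState (N := N) ω p z) 0 := by
    refine ContinuousAt.smul (f := fun ε : ℂ => FPoly z ((X + ε) * (Y + ε)) *
      FPoly z ((X + ε) * (Y + ε) * ω ^ s) * ∑ τ ∈ Finset.range N,
        eigTerm N ω p z ((X + ε) * (Y + ε)) τ) (ContinuousAt.mul ?_ ?_) continuousAt_const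
    · exact ((hFc.comp hT).mul (hFc.comp (hT.mul continuous_const))).continuousAt
    · refine tendsto_finsetSum _ fun τ _ => ?_
      refine ContinuousAt.mul (Continuous.continuousAt ?_) (ContinuousAt.div continuousAt_const
        (Continuous.continuousAt ?_) ?_)
      · exact continuous_const.mul (continuous_finsetProd _ fun n _ =>
          (hqc _).comp (hT.mul continuous_const))
      · exact (hFc.comp (hT.mul continuous_const)).mul (hFc.comp (hT.mul continuous_const))
      · rw [h0]
        exact mul_ne_zero (hF τ) (hF (τ + 1))
  have hlim := hcont.tendsto.mono_left (nhdsWithin_le_nhds (s := {0}ᶜ))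
  rw [h0] at hlim
  exact tendsto_nhds_unique (tendsto_trace_sMon_mulVec X Y s _)
    (hlim.congr' ((eventually_trace_sMon_mulVec hω hp hz X Y s).mono fun ε h => h.symm))

theorem prod_muFun (q : Rapidity) (s τ : ℕ) :
    ∏ i, muFun ω q s τ τ (z i) = ω ^ (τ * R) * FPoly z q.t * FPoly z (q.t * ω ^ s) /
      (FPoly z (q.t * ω ^ τ) * FPoly z (q.t * ω ^ (τ + 1))) := by
  have e : ω ^ (τ * R) = ∏ _i : Fin R, ω ^ τ := by simp [pow_mul]
  rw [e]
  simp only [FPoly]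
  rw [← Finset.prod_mul_distrib, ← Finset.prod_mul_distrib, ← Finset.prod_mul_distrib,
    ← Finset.prod_div_distrib]
  refine Finset.prod_congr rfl fun i _ => ?_
  rw [muFun]
  congr 1 <;> ring

end Closure

end

end SCP

open SCP in
theorem mainTheorem1 (N : ℕ) [NeZero N] (ω : ℂ) (hω : IsPrimitiveRoot ω N)
    (k k' : ℂ) (hk : k ≠ 0) (hkk' : k ^ 2 + k' ^ 2 = 1)
    (L : ℕ) (p : Fin L → SCP.Rapidity) (hp : ∀ n, (p n).OnCurve N k k')
    (q : SCP.Rapidity) (hq : q.OnCurve N k k') (s : ℕ)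
    (hx : ∀ n, (p n).x ^ N ≠ q.x ^ N) (hy : ∀ n, (p n).y ^ N ≠ q.y ^ N)
    (R : ℕ) (z : Fin R → ℂ) (hz : SCP.IsRegularBetheSolution ω p z) :
    -- the Bethe state, if it does not vanish, is an eigenvector
    (SCP.betheState (N := N) ω p z ≠ 0 →
      ∃ Λ : ℂ, Module.End.HasEigenvector
        (Matrix.toLin' (SCP.transferSCP (N := N) ω q (q.barShift ω s) p)) Λ (SCP.betheState (N := N) ω p z)) ∧
    -- the eigenvalue, whenever the denominators in it do not vanish
    ((∀ τ < N, SCP.FPoly z (q.t * ω ^ τ) ≠ 0) →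
      (SCP.transferSCP (N := N) ω q (q.barShift ω s) p).mulVec (SCP.betheState (N := N) ω p z) =
        (∑ τ ∈ Finset.range N, SCP.lam N ω p q τ * ∏ i, SCP.muFun ω q s τ τ (z i)) •
          SCP.betheState (N := N) ω p z ∧
      ∑ τ ∈ Finset.range N, SCP.lam N ω p q τ * ∏ i, SCP.muFun ω q s τ τ (z i) =
        SCP.prefactor N p q * ∑ τ ∈ Finset.range N,
          (∏ n, SCP.powQuot N (p n).t (q.t * ω ^ τ)) *
            (ω ^ (τ * (L + R)) * SCP.FPoly z q.t * SCP.FPoly z (q.t * ω ^ s) /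
              (SCP.FPoly z (q.t * ω ^ τ) * SCP.FPoly z (q.t * ω ^ (τ + 1)))) ∧
      -- the same with the quotients written as fractions, when these are defined
      ((∀ n, (p n).t ^ N ≠ q.t ^ N) →
        ∑ τ ∈ Finset.range N, SCP.lam N ω p q τ * ∏ i, SCP.muFun ω q s τ τ (z i) =
          SCP.prefactor N p q * ∑ τ ∈ Finset.range N,
            (∏ n, ((p n).t ^ N - q.t ^ N) / ((p n).t - q.t * ω ^ τ)) *
              (ω ^ (τ * (L + R)) * SCP.FPoly z q.t * SCP.FPoly z (q.t * ω ^ s) /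
                (SCP.FPoly z (q.t * ω ^ τ) * SCP.FPoly z (q.t * ω ^ (τ + 1)))))) := by
  have hmu : ∀ n, (p n).mu ≠ 0 := fun n => (hp n).1
  have hT := transferSCP_eq_smul hω hk hp hq hx hy s
  have hval : ∑ τ ∈ Finset.range N, lam N ω p q τ * ∏ i, muFun ω q s τ τ (z i) =
      prefactor N p q * ∑ τ ∈ Finset.range N, (∏ n, powQuot N (p n).t (q.t * ω ^ τ)) *
        (ω ^ (τ * (L + R)) * FPoly z q.t * FPoly z (q.t * ω ^ s) /
          (FPoly z (q.t * ω ^ τ) * FPoly z (q.t * ω ^ (τ + 1)))) := by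
    rw [Finset.mul_sum]
    refine Finset.sum_congr rfl fun τ _ => ?_
    rw [prod_muFun, lam, mul_add, pow_add]
    ring
  refine ⟨fun hne => ?_, fun hF => ⟨?_, hval, fun ht => ?_⟩⟩
  · obtain ⟨Λ, hΛ⟩ := exists_trace_sMon_mulVec hω hmu hz q.x q.y s
    refine ⟨prefactor N p q * ((N : ℂ) ^ (2 * L))⁻¹ * Λ, ?_, hne⟩
    rw [Module.End.mem_eigenspace_iff, Matrix.toLin'_apply, hT, Matrix.smul_mulVec, hΛ, smul_smul]
  · have hF' : ∀ τ, FPoly z (q.x * q.y * ω ^ τ) ≠ 0 := fun τ => by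
      rw [pow_eq_pow_mod τ hω.pow_eq_one]
      exact hF _ (Nat.mod_lt _ (NeZero.pos N))
    have hN : (N : ℂ) ^ (2 * L) ≠ 0 := pow_ne_zero _ (Nat.cast_ne_zero.mpr (NeZero.ne N))
    rw [hT, Matrix.smul_mulVec, trace_sMon_mulVec_of_FPoly_ne_zero hω hmu hz q.x q.y s hF',
      smul_smul, hval]
    congr 1
    rw [Finset.mul_sum, Finset.mul_sum, Finset.mul_sum]
    refine Finset.sum_congr rfl fun τ _ => ?_
    rw [eigTerm, Rapidity.t]
    field_simp
  · rw [hval]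
    congr 1
    refine Finset.sum_congr rfl fun τ _ => ?_
    congr 1
    refine Finset.prod_congr rfl fun n _ => ?_
    have hpow : (q.t * ω ^ τ) ^ N = q.t ^ N := by
      rw [mul_pow, ← pow_mul, mul_comm τ, pow_mul, hω.pow_eq_one, one_pow, mul_one]
    rw [powQuot_eq_div, hpow]
    intro h
    exact ht n (by rw [h, hpow])
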